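/- Let $(M,g)$ be a smooth, closed (compact without boundary), connected Riemannian manifold of dimension $n\ge 2$. Let $SM=\{v\in TM: |v|_g=1\}$ be its unit sphere bundle, an embedded submanifold of $TM$, with inclusion $\iota: SM\hookrightarrow TM$ and projection $\pi: SM\to M$; let $\pi_{TM}:TM\to M$ be the projection, $p:SM\times\mathbb R\to SM$ the projection onto the first factor, and $\Phi: SM\times\mathbb R\to SM$, $\Phi(v,s)=\dot\gamma_v(s)$, the geodesic flow. Write $d_v\Phi|_{(v,s)}$ for the differential of $\Phi(\cdot,s)$ at $v$, and $A^t$ for the transpose of a linear map $A$. For $(v,s)\in SM\times\mathbb R$ put $$K_{(v,s)}=\ker\big(d\pi|_{\Phi(v,s)}\circ d_v\Phi|_{(v,s)}\big)\cap\ker(d\pi|_v)\subset T_vSM .$$ Call $(v,s)$ a *conjugate pair* if $s\ne0$ and $K_{(v,s)}\ne\{0\}$, and a conjugate pair *of order $k$* if moreover $\dim K_{(v,s)}=k$. For $1\le k\le n-1$ let $\mathcal C_{R,k}$ be the set of conjugate pairs of order $k$ that have a neighborhood in $SM\times\mathbb R$ in which all conjugate pairs have order $k$, and let $E_{R,k}=\{((v,s),X):(v,s)\in\mathcal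 C_{R,k},\ X\in K_{(v,s)}\}$. Let $\omega_g$ be the pullback to $TM$, under $v\mapsto g(v,\cdot)$, of the canonical symplectic form $d\xi_i\wedge dx^i$ of $T^*M$, and let $F_k:E_{R,k}\to T^*M\times T^*M$, $F_k((v,s),X)=(\eta,\tilde\eta)\in T^*_{\pi(v)}M\times T^*_{\pi(\Phi(v,s))}M$, be the map determined by $$\omega_g(d\iota|_vX,\,\cdot\,)=d\pi_{TM}|_v^t\,\eta,\qquad \omega_g\big(d\iota|_{\Phi(v,s)}\,d_v\Phi|_{(v,s)}X,\,\cdot\,\big)=d\pi_{TM}|_{\Phi(v,s)}^t\,\tilde\eta .$$ Let $(v,s)\in SM\times\mathbb R$, $\tilde v=\Phi(v,s)$, $\eta\in T^*_{\pi(v)}M$ and $\tilde\eta\in T^*_{\pi(\tilde v)}M$. Then $$dp|_{(v,s)}^t\, d\pi|_v^t\,\eta=d\Phi|_{(v,s)}^t\, d\pi|_{\tilde v}^t\,\tilde\eta \tag{1}$$ holds if and only if $$d\pi|_v^t\,\eta=d_v\Phi|_{(v,s)}^t\, d\pi|_{\tilde v}^t\,\tilde\eta\quad\text{and}\quad \eta(v)=\tilde\eta(\tilde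 v)=0. \tag{2}$$ Suppose (2) holds and $s\ne0$. If $\eta$ and $\tilde\eta$ are not both zero, then $(v,s)$ is a conjugate pair. If $1\le k\le n-1$ and $(v,s)\in\mathcal C_{R,k}$, then $(\eta,\tilde\eta)\in F_k(E_{R,k})$. Conversely, if $1\le k\le n-1$ and $(\eta,\tilde\eta)\in F_k(E_{R,k})$, then there is $(v,s)\in\mathcal C_{R,k}$ with $\eta\in T^*_{\pi(v)}M$ and $\tilde\eta\in T^*_{\pi(\Phi(v,s))}M$ such that (2) holds with $\tilde v=\Phi(v,s)$. -/

import Mathlib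

open scoped Manifold ContDiff Topology
open Bundle Set

noncomputable section

/-! ### The ambient objects

`M` is a manifold of dimension `n = d + 1` without boundary, modelled on `ℝ^(d+1)`. -/

/-- The Euclidean model space `ℝ^(d+1)`. -/
abbrev EucModel (d : ℕ) : Type := EuclideanSpace ℝ (Fin (d + 1))

/-- Smooth Riemannian metrics on `M`. -/
abbrev SmoothMetric (d : ℕ) (M : Type*) [TopologicalSpace M] [ChartedSpace (EucModel d) M]
    [IsManifold (𝓡 (d + 1)) ∞ M] : Type _ :=
  ContMDiffRiemannianMetric (𝓡 (d + 1)) ∞ (EucModel d)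
    (fun x : M => TangentSpace (𝓡 (d + 1)) x)

/-- The unit sphere of the model space. -/
abbrev ModelSphere (d : ℕ) : Type := Metric.sphere (0 : EucModel d) 1

instance modelSphere_fact (d : ℕ) : Fact (Module.finrank ℝ (EucModel d) = d + 1) :=
  ⟨finrank_euclideanSpace_fin⟩

/-- The total space of the cotangent bundle `T*M`: pairs of a base point and a covector. -/
abbrev CotangentTotal (d : ℕ) (M : Type*) [TopologicalSpace M]
    [ChartedSpace (EucModel d) M] : Type _ :=
  TotalSpace (EucModel d →L[ℝ] ℝ) (fun x : M => TangentSpace (𝓡 (d + 1)) x →L[ℝ] ℝ)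

/-- Radial projection `w ↦ w / |w|` of the model space minus the origin onto the unit sphere
(an arbitrary value at the origin). -/
def radialProj (d : ℕ) (w : EucModel d) : ModelSphere d :=
  if h : w ≠ 0 then ⟨‖w‖⁻¹ • w, by simp [norm_smul, h]⟩
  else ⟨EuclideanSpace.single 0 1, by simp⟩

theorem radialProj_coe {d : ℕ} {w : EucModel d} (h : w ≠ 0) :
    (radialProj d w : EucModel d) = ‖w‖⁻¹ • w := by
  simp [radialProj, h]

theorem radialProj_smul {d : ℕ} {w : EucModel d} (h : w ≠ 0) {c : ℝ} (hc : 0 < c) :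
    radialProj d (c • w) = radialProj d w := by
  apply Subtype.ext
  rw [radialProj_coe h, radialProj_coe (smul_ne_zero hc.ne' h), norm_smul, smul_smul,
    Real.norm_of_nonneg hc.le]
  congr 1
  field_simp

theorem radialProj_sphere {d : ℕ} (u : ModelSphere d) : radialProj d (u : EucModel d) = u := by
  have hu : ‖(u : EucModel d)‖ = 1 := by simp
  have h : (u : EucModel d) ≠ 0 := fun h => by simp [h] at hu
  apply Subtype.ext
  rw [radialProj_coe h, hu]
  simp

theorem contMDiffAt_radialProj {d : ℕ} {w : EucModel d} (h : w ≠ 0) :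
    ContMDiffAt 𝓘(ℝ, EucModel d) (𝓡 d) ∞ (radialProj d) w := by
  let U : TopologicalSpace.Opens (EucModel d) := ⟨{0}ᶜ, isOpen_compl_singleton⟩
  have hU : ∀ x : U, (x : EucModel d) ≠ 0 := fun x => x.2
  have h1 : ContMDiff 𝓘(ℝ, EucModel d) 𝓘(ℝ, EucModel d) ∞
      (fun x : U => ‖(x : EucModel d)‖⁻¹ • (x : EucModel d)) := by
    intro x
    have : ContMDiffAt 𝓘(ℝ, EucModel d) 𝓘(ℝ, EucModel d) ∞
        (fun y : EucModel d => ‖y‖⁻¹ • y) x.1 := by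
      apply ContDiffAt.contMDiffAt
      exact ((contDiffAt_norm ℝ (hU x)).inv (norm_ne_zero_iff.2 (hU x))).smul contDiffAt_id
    exact contMDiffAt_subtype_iff.2 this
  have h2 : ∀ x : U, ‖(x : EucModel d)‖⁻¹ • (x : EucModel d) ∈
      Metric.sphere (0 : EucModel d) 1 := fun x => by simp [norm_smul, hU x]
  have h3 := h1.codRestrict_sphere (n := d) h2
  have h4 : (Set.codRestrict _ _ h2 : U → ModelSphere d) = fun x : U => radialProj d x.1 := by
    funext x
    apply Subtype.ext
    rw [radialProj_coe (hU x)]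
    rfl
  rw [h4] at h3
  exact contMDiffAt_subtype_iff.1 (h3 ⟨w, h⟩)

variable {d : ℕ} {M : Type*} [TopologicalSpace M] [ChartedSpace (EucModel d) M]
  [IsManifold (𝓡 (d + 1)) ∞ M]

/-! ### The unit sphere bundle as a smooth manifold -/

/-- The squared length `|v|²` of a tangent vector. -/
def sqLen (g : SmoothMetric d M) (v : TangentBundle (𝓡 (d + 1)) M) : ℝ :=
  g.inner v.1 v.2 v.2

theorem contMDiff_sqLen (g : SmoothMetric d M) :
    ContMDiff (𝓡 (d + 1)).tangent 𝓘(ℝ, ℝ) ∞ (sqLen g) := by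
  intro v
  have hid : ContMDiffAt (𝓡 (d + 1)).tangent (𝓡 (d + 1)).tangent ∞
      (fun m : TangentBundle (𝓡 (d + 1)) M =>
        (TotalSpace.mk' (EucModel d) m.1 m.2 : TangentBundle (𝓡 (d + 1)) M)) v := contMDiffAt_id
  have hb : ContMDiffAt (𝓡 (d + 1)).tangent (𝓡 (d + 1)) ∞
      (fun m : TangentBundle (𝓡 (d + 1)) M => m.1) v := contMDiffAt_proj _
  have : ContMDiffAt (𝓡 (d + 1)).tangent ((𝓡 (d + 1)).prod 𝓘(ℝ)) ∞
      (fun m : TangentBundle (𝓡 (d + 1)) M => TotalSpace.mk' ℝ (E := Bundle.Trivial M ℝ) m.1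
        (g.inner m.1 m.2 m.2)) v := by
    apply ContMDiffAt.clm_bundle_apply₂ (F₁ := EucModel d) (F₂ := EucModel d)
    · exact ContMDiffAt.comp v g.contMDiff.contMDiffAt hb
    · exact hid
    · exact hid
  simp only [contMDiffAt_totalSpace] at this
  exact this.2

variable (M) in
/-- The unit sphere bundle `SM = {v ∈ TM : |v| = 1}`, with the subspace topology of `TM`. -/
def UnitTangent (g : SmoothMetric d M) : Type _ :=
  {v : TangentBundle (𝓡 (d + 1)) M // sqLen g v = 1}

instance (g : SmoothMetric d M) : TopologicalSpace (UnitTangent M g) :=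
  instTopologicalSpaceSubtype

/-- The inclusion `ι : SM → TM`. -/
def UnitTangent.incl (g : SmoothMetric d M) (v : UnitTangent M g) :
    TangentBundle (𝓡 (d + 1)) M := v.1

/-- The projection `π : SM → M`. -/
def UnitTangent.base (g : SmoothMetric d M) (v : UnitTangent M g) : M := v.1.1

/-- The unit vector `v` itself, as an element of the tangent space at its base point. -/
def UnitTangent.vec (g : SmoothMetric d M) (v : UnitTangent M g) :
    TangentSpace (𝓡 (d + 1)) (v.base g) := v.1.2

theorem sqLen_pos (g : SmoothMetric d M) {v : TangentBundle (𝓡 (d + 1)) M} (h : v.2 ≠ 0) :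
    0 < sqLen g v := g.pos _ _ h

/-- The normalisation `v ↦ v / |v|` of a nonzero tangent vector. -/
def normalizeVec (g : SmoothMetric d M) (v : TangentBundle (𝓡 (d + 1)) M) (h : v.2 ≠ 0) :
    UnitTangent M g :=
  ⟨⟨v.1, (Real.sqrt (sqLen g v))⁻¹ • v.2⟩, by
    have h0 := sqLen_pos g h
    have h1 : sqLen g (⟨v.1, (Real.sqrt (sqLen g v))⁻¹ • v.2⟩ : TangentBundle (𝓡 (d + 1)) M)
        = (Real.sqrt (sqLen g v))⁻¹ * ((Real.sqrt (sqLen g v))⁻¹ * sqLen g v) := by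
      simp [sqLen]
    rw [h1, ← mul_assoc, ← mul_inv, Real.mul_self_sqrt h0.le, inv_mul_cancel₀ h0.ne']⟩

theorem triv_snd_ne_zero {x₀ : M} {v : TangentBundle (𝓡 (d + 1)) M}
    (hv : v.1 ∈ (trivializationAt (EucModel d) (TangentSpace (𝓡 (d + 1))) x₀).baseSet)
    (h : v.2 ≠ 0) :
    (trivializationAt (EucModel d) (TangentSpace (𝓡 (d + 1))) x₀ v).2 ≠ 0 := by
  set e := trivializationAt (EucModel d) (TangentSpace (𝓡 (d + 1))) x₀
  have h1 : (e v).2 = e.continuousLinearEquivAt ℝ v.1 hv v.2 := rfl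
  rw [h1]
  exact (map_ne_zero_iff _ (e.continuousLinearEquivAt ℝ v.1 hv).injective).2 h

theorem triv_smul {x₀ : M} {v : TangentBundle (𝓡 (d + 1)) M}
    (hv : v.1 ∈ (trivializationAt (EucModel d) (TangentSpace (𝓡 (d + 1))) x₀).baseSet)
    (c : ℝ) :
    (trivializationAt (EucModel d) (TangentSpace (𝓡 (d + 1))) x₀
      (⟨v.1, c • v.2⟩ : TangentBundle (𝓡 (d + 1)) M)).2 =
    c • (trivializationAt (EucModel d) (TangentSpace (𝓡 (d + 1))) x₀ v).2 := by
  set e := trivializationAt (EucModel d) (TangentSpace (𝓡 (d + 1))) x₀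
  have h1 : ∀ w : TangentSpace (𝓡 (d + 1)) v.1,
      (e (⟨v.1, w⟩ : TangentBundle (𝓡 (d + 1)) M)).2 = e.continuousLinearEquivAt ℝ v.1 hv w :=
    fun w => rfl
  have h2 : (e v).2 = e.continuousLinearEquivAt ℝ v.1 hv v.2 := rfl
  rw [h1, h2, map_smul]

theorem triv_symm_ne_zero {x₀ x : M} (u : ModelSphere d)
    (hx : x ∈ (trivializationAt (EucModel d) (TangentSpace (𝓡 (d + 1))) x₀).baseSet) :
    ((trivializationAt (EucModel d) (TangentSpace (𝓡 (d + 1)))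
      x₀).toOpenPartialHomeomorph.symm (x, (u : EucModel d))).2 ≠ 0 := by
  set e := trivializationAt (EucModel d) (TangentSpace (𝓡 (d + 1))) x₀
  have hm : (x, (u : EucModel d)) ∈ e.target := e.mem_target.2 hx
  intro h
  have hp : (e.toOpenPartialHomeomorph.symm (x, (u : EucModel d))).1 = x := e.proj_symm_apply hm
  have h2 : e (e.toOpenPartialHomeomorph.symm (x, (u : EucModel d))) = (x, (u : EucModel d)) :=
    e.apply_symm_apply hm
  have hb : (e.toOpenPartialHomeomorph.symm (x, (u : EucModel d))).1 ∈ e.baseSet := by rwa [hp]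
  have h1 : (e (e.toOpenPartialHomeomorph.symm (x, (u : EucModel d)))).2 =
      e.continuousLinearEquivAt ℝ _ hb
        (e.toOpenPartialHomeomorph.symm (x, (u : EucModel d))).2 := rfl
  rw [h, map_zero, h2] at h1
  have hu : ‖(u : EucModel d)‖ = 1 := by simp
  simp only at h1
  rw [h1] at hu
  simp at hu

theorem triv_symm_smul {x₀ x : M} {u : EucModel d}
    (hx : x ∈ (trivializationAt (EucModel d) (TangentSpace (𝓡 (d + 1))) x₀).baseSet) (c : ℝ) :
    (trivializationAt (EucModel d) (TangentSpace (𝓡 (d + 1)) : M → Type _)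
      x₀).toOpenPartialHomeomorph.symm (x, c • u) =
    (⟨((trivializationAt (EucModel d) (TangentSpace (𝓡 (d + 1)))
        x₀).toOpenPartialHomeomorph.symm (x, u)).1,
      c • ((trivializationAt (EucModel d) (TangentSpace (𝓡 (d + 1)))
        x₀).toOpenPartialHomeomorph.symm (x, u)).2⟩ : TangentBundle (𝓡 (d + 1)) M) := by
  set e := trivializationAt (EucModel d) (TangentSpace (𝓡 (d + 1)) : M → Type _) x₀
  have hm : (x, u) ∈ e.target := e.mem_target.2 hx
  have hp : (e.toOpenPartialHomeomorph.symm (x, u)).1 = x := e.proj_symm_apply hm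
  have hb : (e.toOpenPartialHomeomorph.symm (x, u)).1 ∈ e.baseSet := by rwa [hp]
  have hs2 : (⟨(e.toOpenPartialHomeomorph.symm (x, u)).1,
      c • (e.toOpenPartialHomeomorph.symm (x, u)).2⟩ : TangentBundle (𝓡 (d + 1)) M) ∈ e.source :=
    e.mem_source.2 hb
  rw [← e.symm_apply_apply hs2]
  congr 1
  refine Prod.ext ?_ ?_
  · exact (hp.symm.trans (e.coe_fst hs2).symm)
  · refine Eq.trans ?_ (triv_smul hb c).symm
    rw [e.apply_symm_apply hm]

theorem incl_snd_ne_zero (g : SmoothMetric d M) (v : UnitTangent M g) : v.1.2 ≠ 0 := by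
  intro h
  have := v.2
  simp [sqLen, h] at this

theorem modelSphere_ne_zero (u : ModelSphere d) : (u : EucModel d) ≠ 0 := by
  intro h
  have hu : ‖(u : EucModel d)‖ = 1 := by simp
  simp [h] at hu

theorem continuousAt_radialProj {w : EucModel d} (h : w ≠ 0) : ContinuousAt (radialProj d) w :=
  (contMDiffAt_radialProj h).continuousAt

open Classical in
/-- The local trivialisation `SM|_U ≅ U × S^d` of the sphere bundle over the domain `U` of the
preferred chart at `x₀`: a unit vector `v` is sent to its base point and the direction of its
coordinate vector; the inverse normalises the vector with coordinates `u`. -/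
def sphereTriv (g : SmoothMetric d M) (x₀ : M) :
    OpenPartialHomeomorph (UnitTangent M g) (M × ModelSphere d) :=
  let e := trivializationAt (EucModel d) (TangentSpace (𝓡 (d + 1)) : M → Type _) x₀
  { toFun := fun v => (v.base g, radialProj d (e v.1).2)
    invFun := fun p =>
      if h : (e.toOpenPartialHomeomorph.symm (p.1, (p.2 : EucModel d))).2 ≠ 0 then
        normalizeVec g (e.toOpenPartialHomeomorph.symm (p.1, (p.2 : EucModel d))) h
      else normalizeVec g ⟨p.1, (p.2 : EucModel d)⟩ (modelSphere_ne_zero p.2)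
    source := {v | v.base g ∈ e.baseSet}
    target := e.baseSet ×ˢ univ
    map_source' := fun v hv => ⟨hv, mem_univ _⟩
    map_target' := by
      rintro ⟨x, u⟩ ⟨hx, -⟩
      have hm : (x, (u : EucModel d)) ∈ e.target := e.mem_target.2 hx
      have h0 := triv_symm_ne_zero u hx
      have hp : (e.toOpenPartialHomeomorph.symm (x, (u : EucModel d))).1 = x :=
        e.proj_symm_apply hm
      simp only [mem_ofPred_eq]
      rw [dif_pos h0]
      change (e.toOpenPartialHomeomorph.symm (x, (u : EucModel d))).1 ∈ e.baseSet
      rw [hp]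
      exact hx
    left_inv' := by
      intro v hv
      have hv' : v.1.1 ∈ e.baseSet := hv
      have hs : v.1 ∈ e.source := e.mem_source.2 hv'
      have hne : (e v.1).2 ≠ 0 := triv_snd_ne_zero hv' (incl_snd_ne_zero g v)
      have hc : 0 < ‖(e v.1).2‖⁻¹ := inv_pos.2 (norm_pos_iff.2 hne)
      have hz : e.toOpenPartialHomeomorph.symm (v.1.1, ‖(e v.1).2‖⁻¹ • (e v.1).2) =
          (⟨v.1.1, ‖(e v.1).2‖⁻¹ • v.1.2⟩ : TangentBundle (𝓡 (d + 1)) M) := by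
        have hs2 : (⟨v.1.1, ‖(e v.1).2‖⁻¹ • v.1.2⟩ : TangentBundle (𝓡 (d + 1)) M) ∈ e.source :=
          e.mem_source.2 hv'
        rw [← e.symm_apply_apply hs2]
        congr 1
        refine Prod.ext ?_ ?_
        · exact (e.coe_fst hs2).symm
        · exact (triv_smul hv' _).symm
      have hn2 : (‖(e v.1).2‖⁻¹ • v.1.2) ≠ 0 := smul_ne_zero hc.ne' (incl_snd_ne_zero g v)
      have key : ∀ z : TangentBundle (𝓡 (d + 1)) M,
          z = (⟨v.1.1, ‖(e v.1).2‖⁻¹ • v.1.2⟩ : TangentBundle (𝓡 (d + 1)) M) →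
          ∀ h : z.2 ≠ 0, normalizeVec g z h = v := by
        rintro _ rfl h
        apply Subtype.ext
        have hq : sqLen g (⟨v.1.1, ‖(e v.1).2‖⁻¹ • v.1.2⟩ : TangentBundle (𝓡 (d + 1)) M)
            = ‖(e v.1).2‖⁻¹ * (‖(e v.1).2‖⁻¹ * sqLen g v.1) := by
          simp [sqLen]
        have hq2 : Real.sqrt (sqLen g
            (⟨v.1.1, ‖(e v.1).2‖⁻¹ • v.1.2⟩ : TangentBundle (𝓡 (d + 1)) M)) =
            ‖(e v.1).2‖⁻¹ := by
          rw [hq, v.2, mul_one, Real.sqrt_mul_self hc.le]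
        simp only [normalizeVec]
        rw [hq2, smul_smul, inv_mul_cancel₀ hc.ne', one_smul]
      simp only
      have hz' : e.toOpenPartialHomeomorph.symm
          (v.base g, (radialProj d (e v.1).2 : EucModel d)) =
          (⟨v.1.1, ‖(e v.1).2‖⁻¹ • v.1.2⟩ : TangentBundle (𝓡 (d + 1)) M) := by
        rw [radialProj_coe hne]; exact hz
      rw [dif_pos (by rw [hz']; exact hn2)]
      exact key _ hz' _
    right_inv' := by
      rintro ⟨x, u⟩ ⟨hx, -⟩
      have hm : (x, (u : EucModel d)) ∈ e.target := e.mem_target.2 hx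
      have h0 := triv_symm_ne_zero u hx
      have hp : (e.toOpenPartialHomeomorph.symm (x, (u : EucModel d))).1 = x :=
        e.proj_symm_apply hm
      have hb : (e.toOpenPartialHomeomorph.symm (x, (u : EucModel d))).1 ∈ e.baseSet := by
        rwa [hp]
      simp only
      rw [dif_pos h0]
      refine Prod.ext hp ?_
      have h3 : (e (normalizeVec g _ h0).1).2 =
          (Real.sqrt (sqLen g (e.toOpenPartialHomeomorph.symm (x, (u : EucModel d)))))⁻¹ •
          (e (e.toOpenPartialHomeomorph.symm (x, (u : EucModel d)))).2 := triv_smul hb _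
      have h4 : (e (e.toOpenPartialHomeomorph.symm (x, (u : EucModel d)))).2 = u := by
        rw [e.apply_symm_apply hm]
      change radialProj d (e (normalizeVec g _ h0).1).2 = u
      rw [h3, h4, radialProj_smul (modelSphere_ne_zero u), radialProj_sphere]
      exact inv_pos.2 (Real.sqrt_pos.2 (sqLen_pos g h0))
    open_source := e.open_baseSet.preimage
      ((FiberBundle.continuous_proj (EucModel d) (TangentSpace (𝓡 (d + 1)) : M → Type _)).comp
        continuous_subtype_val)
    open_target := e.open_baseSet.prod isOpen_univ
    continuousOn_toFun := by
      intro v hv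
      have hv' : v.1.1 ∈ e.baseSet := hv
      have hs : v.1 ∈ e.source := e.mem_source.2 hv'
      have hne : (e v.1).2 ≠ 0 := triv_snd_ne_zero hv' (incl_snd_ne_zero g v)
      apply ContinuousAt.continuousWithinAt
      have hval : ContinuousAt (fun w : UnitTangent M g => w.1) v :=
        continuous_subtype_val.continuousAt
      have h1 : ContinuousAt (fun w : UnitTangent M g => w.base g) v :=
        ((FiberBundle.continuous_proj (EucModel d)
          (TangentSpace (𝓡 (d + 1)) : M → Type _)).comp continuous_subtype_val).continuousAt
      have h2 : ContinuousAt (fun w : UnitTangent M g => (e w.1).2) v :=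
        continuousAt_snd.comp ((e.continuousAt hs).comp (f := fun w : UnitTangent M g => w.1) hval)
      exact h1.prodMk (ContinuousAt.comp (f := fun w : UnitTangent M g => (e w.1).2)
        (continuousAt_radialProj hne) h2)
    continuousOn_invFun := by
      refine Topology.IsInducing.subtypeVal.continuousOn_iff.2 ?_
      have hco : ContinuousOn (fun p : M × ModelSphere d =>
          e.toOpenPartialHomeomorph.symm (p.1, (p.2 : EucModel d))) (e.baseSet ×ˢ univ) := by
        refine e.toOpenPartialHomeomorph.continuousOn_symm.comp (by fun_prop) ?_
        rintro ⟨x, u⟩ ⟨hx, -⟩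
        exact e.mem_target.2 hx
      have hq : ContinuousOn (fun p : M × ModelSphere d => (Real.sqrt (sqLen g
          (e.toOpenPartialHomeomorph.symm (p.1, (p.2 : EucModel d)))))⁻¹)
          (e.baseSet ×ˢ univ) := by
        refine ContinuousOn.inv₀ (Real.continuous_sqrt.comp_continuousOn
          ((contMDiff_sqLen g).continuous.comp_continuousOn hco)) ?_
        rintro ⟨x, u⟩ ⟨hx, -⟩
        exact (Real.sqrt_pos.2 (sqLen_pos g (triv_symm_ne_zero u hx))).ne'
      have hfin : ContinuousOn (fun p : M × ModelSphere d =>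
          e.toOpenPartialHomeomorph.symm (p.1, (Real.sqrt (sqLen g
          (e.toOpenPartialHomeomorph.symm (p.1, (p.2 : EucModel d)))))⁻¹ • (p.2 : EucModel d)))
          (e.baseSet ×ˢ univ) := by
        refine e.toOpenPartialHomeomorph.continuousOn_symm.comp
          (continuousOn_fst.prodMk (hq.smul (by fun_prop))) ?_
        rintro ⟨x, u⟩ ⟨hx, -⟩
        exact e.mem_target.2 hx
      refine hfin.congr ?_
      rintro ⟨x, u⟩ ⟨hx, -⟩
      simp only [Function.comp]
      rw [dif_pos (triv_symm_ne_zero u hx), triv_symm_smul hx]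
      rfl }

open Classical in
theorem sphereTriv_symm_coe (g : SmoothMetric d M) {x₀ x : M} (u : ModelSphere d)
    (hx : x ∈ (trivializationAt (EucModel d) (TangentSpace (𝓡 (d + 1))) x₀).baseSet) :
    ((sphereTriv g x₀).symm (x, u)).1 =
      (trivializationAt (EucModel d) (TangentSpace (𝓡 (d + 1)) : M → Type _)
        x₀).toOpenPartialHomeomorph.symm (x, (Real.sqrt (sqLen g
          ((trivializationAt (EucModel d) (TangentSpace (𝓡 (d + 1)) : M → Type _)
            x₀).toOpenPartialHomeomorph.symm (x, (u : EucModel d)))))⁻¹ • (u : EucModel d)) := by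
  rw [triv_symm_smul hx]
  change (dite _ _ _ : UnitTangent M g).1 = _
  rw [dif_pos (triv_symm_ne_zero u hx)]
  rfl

variable (d) in
/-- The model with corners (without boundary) of the `(2d+1)`-dimensional manifold `SM`. -/
abbrev unitModel : ModelWithCorners ℝ (EucModel d × EuclideanSpace ℝ (Fin d))
    (ModelProd (EucModel d) (EuclideanSpace ℝ (Fin d))) :=
  (𝓡 (d + 1)).prod (𝓡 d)

/-- The charts of `SM`: local trivialisations `SM|_U ≅ U × S^d` followed by a product of charts of
`M` and of the sphere. As `ι` and (locally) the normalisation `TM ∖ 0 → SM` are smooth in these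
charts, this is the structure of `SM` as an embedded submanifold of `TM`. -/
instance unitTangentChartedSpace (g : SmoothMetric d M) :
    ChartedSpace (ModelProd (EucModel d) (EuclideanSpace ℝ (Fin d))) (UnitTangent M g) where
  atlas := {c | ∃ v : UnitTangent M g, c = (sphereTriv g (v.base g)).trans
    (chartAt (ModelProd (EucModel d) (EuclideanSpace ℝ (Fin d)))
      (sphereTriv g (v.base g) v))}
  chartAt v := (sphereTriv g (v.base g)).trans
    (chartAt (ModelProd (EucModel d) (EuclideanSpace ℝ (Fin d)))
      (sphereTriv g (v.base g) v))
  mem_chart_source v := by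
    have h : v ∈ (sphereTriv g (v.base g)).source :=
      FiberBundle.mem_baseSet_trivializationAt' (F := EucModel d)
        (E := (TangentSpace (𝓡 (d + 1)) : M → Type _)) (v.base g)
    rw [OpenPartialHomeomorph.trans_source]
    exact ⟨h, mem_chart_source (ModelProd (EucModel d) (EuclideanSpace ℝ (Fin d)))
      (sphereTriv g (v.base g) v)⟩
  chart_mem_atlas v := ⟨v, rfl⟩

theorem contMDiffOn_sphereTriv_symm (g : SmoothMetric d M) (x₀ : M) :
    ContMDiffOn (unitModel d) (𝓡 (d + 1)).tangent ∞
      (fun p : M × ModelSphere d => ((sphereTriv g x₀).symm p).1)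
      (sphereTriv g x₀).target := by
  set e := trivializationAt (EucModel d) (TangentSpace (𝓡 (d + 1)) : M → Type _) x₀ with he
  have hsm : ContMDiffOn ((𝓡 (d + 1)).prod 𝓘(ℝ, EucModel d)) (𝓡 (d + 1)).tangent ∞
      e.toOpenPartialHomeomorph.symm e.target := e.contMDiffOn_symm
  have hcoe : ContMDiff (unitModel d) 𝓘(ℝ, EucModel d) ∞
      (fun p : M × ModelSphere d => (p.2 : EucModel d)) :=
    contMDiff_coe_sphere.comp contMDiff_snd
  have hco : ContMDiffOn (unitModel d) (𝓡 (d + 1)).tangent ∞ (fun p : M × ModelSphere d =>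
      e.toOpenPartialHomeomorph.symm (p.1, (p.2 : EucModel d))) (e.baseSet ×ˢ univ) := by
    refine hsm.comp (contMDiff_fst.prodMk hcoe).contMDiffOn ?_
    rintro ⟨x, u⟩ ⟨hx, -⟩
    exact e.mem_target.2 hx
  have hq : ContMDiffOn (unitModel d) 𝓘(ℝ, ℝ) ∞ (fun p : M × ModelSphere d => (Real.sqrt (sqLen g
      (e.toOpenPartialHomeomorph.symm (p.1, (p.2 : EucModel d)))))⁻¹)
      (e.baseSet ×ˢ univ) := by
    rintro ⟨x, u⟩ ⟨hx, -⟩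
    have h0 := sqLen_pos g (triv_symm_ne_zero u hx)
    have hr : ContMDiffAt 𝓘(ℝ, ℝ) 𝓘(ℝ, ℝ) ∞ (fun t : ℝ => (Real.sqrt t)⁻¹)
        (sqLen g (e.toOpenPartialHomeomorph.symm (x, (u : EucModel d)))) :=
      ((Real.contDiffAt_sqrt h0.ne').inv (Real.sqrt_pos.2 h0).ne').contMDiffAt
    exact ContMDiffAt.comp_contMDiffWithinAt (g := fun t : ℝ => (Real.sqrt t)⁻¹) (x, u) hr
      (((contMDiff_sqLen g).comp_contMDiffOn hco) (x, u) ⟨hx, mem_univ _⟩)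
  have hfin : ContMDiffOn (unitModel d) (𝓡 (d + 1)).tangent ∞ (fun p : M × ModelSphere d =>
      e.toOpenPartialHomeomorph.symm (p.1, (Real.sqrt (sqLen g
      (e.toOpenPartialHomeomorph.symm (p.1, (p.2 : EucModel d)))))⁻¹ • (p.2 : EucModel d)))
      (e.baseSet ×ˢ univ) := by
    refine hsm.comp (contMDiffOn_fst.prodMk (hq.smul hcoe.contMDiffOn)) ?_
    rintro ⟨x, u⟩ ⟨hx, -⟩
    exact e.mem_target.2 hx
  refine hfin.congr ?_
  rintro ⟨x, u⟩ ⟨hx, -⟩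
  exact sphereTriv_symm_coe g u hx

theorem contMDiffOn_sphereTriv_trans (g : SmoothMetric d M) (x₀ x₁ : M) :
    ContMDiffOn (unitModel d) (unitModel d) ∞
      (fun p : M × ModelSphere d => sphereTriv g x₁ ((sphereTriv g x₀).symm p))
      ((sphereTriv g x₀).symm.trans (sphereTriv g x₁)).source := by
  set e := trivializationAt (EucModel d) (TangentSpace (𝓡 (d + 1)) : M → Type _) x₁ with he
  intro p hp
  rw [OpenPartialHomeomorph.trans_source] at hp
  obtain ⟨hp0, hp1⟩ := hp
  have h1 := ((contMDiffOn_sphereTriv_symm g x₀) p hp0).mono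
    (show ((sphereTriv g x₀).symm.trans (sphereTriv g x₁)).source ⊆ (sphereTriv g x₀).target by
      rw [OpenPartialHomeomorph.trans_source]; exact inter_subset_left)
  set z := (sphereTriv g x₀).symm p with hz
  have hb : z.1.1 ∈ e.baseSet := hp1
  have hs : z.1 ∈ e.source := e.mem_source.2 hb
  have h2 : ContMDiffAt (𝓡 (d + 1)).tangent ((𝓡 (d + 1)).prod 𝓘(ℝ, EucModel d)) ∞ e z.1 :=
    (e.contMDiffOn z.1 hs).contMDiffAt (e.open_source.mem_nhds hs)
  have h3 : ContMDiffAt (𝓡 (d + 1)).tangent (𝓡 d) ∞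
      (fun w : TangentBundle (𝓡 (d + 1)) M => radialProj d (e w).2) z.1 :=
    (contMDiffAt_radialProj (triv_snd_ne_zero hb (incl_snd_ne_zero g z))).comp z.1
      (contMDiffAt_snd.comp z.1 h2)
  have h4 : ContMDiffAt (𝓡 (d + 1)).tangent (unitModel d) ∞
      (fun w : TangentBundle (𝓡 (d + 1)) M => (w.1, radialProj d (e w).2)) z.1 :=
    (contMDiffAt_proj _).prodMk h3
  exact ContMDiffAt.comp_contMDiffWithinAt
    (g := fun w : TangentBundle (𝓡 (d + 1)) M => (w.1, radialProj d (e w).2))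
    (f := fun p : M × ModelSphere d => ((sphereTriv g x₀).symm p).1) p h4 h1

/-- `SM` is a smooth manifold. -/
instance unitTangent_isManifold (g : SmoothMetric d M) :
    IsManifold (unitModel d) ∞ (UnitTangent M g) := by
  apply isManifold_of_contDiffOn
  rintro _ _ ⟨v, rfl⟩ ⟨w, rfl⟩
  set T0 := sphereTriv g (v.base g)
  set T1 := sphereTriv g (w.base g)
  set c0 := chartAt (ModelProd (EucModel d) (EuclideanSpace ℝ (Fin d))) (T0 v)
  set c1 := chartAt (ModelProd (EucModel d) (EuclideanSpace ℝ (Fin d))) (T1 w)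
  rw [← contMDiffOn_iff_contDiffOn]
  have h0 : ContMDiffOn (unitModel d) (unitModel d) ∞ c0.symm c0.target :=
    contMDiffOn_chart_symm
  have h1 : ContMDiffOn (unitModel d) (unitModel d) ∞ c1 c1.source := contMDiffOn_chart
  have hT := contMDiffOn_sphereTriv_trans g (v.base g) (w.base g)
  have hmod : ContMDiff (unitModel d) 𝓘(ℝ, EucModel d × EuclideanSpace ℝ (Fin d)) ∞
      (unitModel d) := (unitModel d).contMDiff
  have hmods : ContMDiffOn 𝓘(ℝ, EucModel d × EuclideanSpace ℝ (Fin d)) (unitModel d) ∞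
      (unitModel d).symm (range (unitModel d)) := (unitModel d).contMDiffOn_symm
  have hA : ContMDiffOn (unitModel d) (unitModel d) ∞
      (fun q => c1 (T1 (T0.symm (c0.symm q))))
      ((T0.trans c0).symm.trans (T1.trans c1)).source := by
    have hB : ContMDiffOn (unitModel d) (unitModel d) ∞
        (fun q => T1 (T0.symm (c0.symm q)))
        ((T0.trans c0).symm.trans (T1.trans c1)).source := by
      refine hT.comp (h0.mono ?_) ?_
      · intro q hq
        simp only [mfld_simps] at hq
        tauto
      · intro q hq
        simp only [mfld_simps] at hq ⊢
        tauto
    refine h1.comp hB ?_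
    intro q hq
    simp only [mfld_simps] at hq ⊢
    tauto
  refine (hmod.comp_contMDiffOn hA).comp (hmods.mono inter_subset_right) ?_
  intro q hq
  exact hq.1

/-! ### Geodesics and the geodesic flow -/

/-- The metric in the preferred chart `φ` at `x₀`, at the point with coordinates `y` and for
coordinate vectors `a`, `b`: `g_{ij}(y) aⁱ bʲ = g(dφ⁻¹ a, dφ⁻¹ b)`. -/
def chartMetric (g : SmoothMetric d M) (x₀ : M) (y a b : EucModel d) : ℝ :=
  g.inner ((extChartAt (𝓡 (d + 1)) x₀).symm y)
    (mfderiv 𝓘(ℝ, EucModel d) (𝓡 (d + 1)) (extChartAt (𝓡 (d + 1)) x₀).symm y a)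
    (mfderiv 𝓘(ℝ, EucModel d) (𝓡 (d + 1)) (extChartAt (𝓡 (d + 1)) x₀).symm y b)

/-- Christoffel symbols of the first kind in the preferred chart at `x₀`, contracted with
coordinate vectors: `g_{lm} Γᵐ_{ij} aⁱ bʲ cˡ = ½ (∂_i g_{jl} + ∂_j g_{il} - ∂_l g_{ij}) aⁱ bʲ cˡ`. -/
def christoffel (g : SmoothMetric d M) (x₀ : M) (y a b c : EucModel d) : ℝ :=
  (1 / 2) * (fderiv ℝ (fun z => chartMetric g x₀ z b c) y a
    + fderiv ℝ (fun z => chartMetric g x₀ z a c) y b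
    - fderiv ℝ (fun z => chartMetric g x₀ z a b) y c)

/-- A complete geodesic: a twice continuously differentiable curve which in every preferred chart
satisfies the geodesic equation `g_{lm} (c̈ᵐ + Γᵐ_{ij} ċⁱ ċʲ) = 0`. -/
def IsGeodesic (g : SmoothMetric d M) (γ : ℝ → M) : Prop :=
  ContMDiff 𝓘(ℝ, ℝ) (𝓡 (d + 1)) 2 γ ∧
  ∀ (x₀ : M) (t : ℝ), γ t ∈ (extChartAt (𝓡 (d + 1)) x₀).source →
    ∀ a : EucModel d,
      let c : ℝ → EucModel d := fun τ => extChartAt (𝓡 (d + 1)) x₀ (γ τ)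
      chartMetric g x₀ (c t) (deriv (deriv c) t) a
        + christoffel g x₀ (c t) (deriv c t) (deriv c t) a = 0

/-- The velocity `γ̇(t) ∈ TM` of a curve in `M`. -/
def velocity (γ : ℝ → M) (t : ℝ) : TangentBundle (𝓡 (d + 1)) M :=
  ⟨γ t, mfderiv 𝓘(ℝ, ℝ) (𝓡 (d + 1)) γ t (1 : ℝ)⟩

open Classical in
/-- The maximal geodesic `γ_v` with initial velocity `v`. On a compact manifold it is defined on
all of `ℝ`; it is unique. (The constant curve is a default value that is never needed there.) -/
def geodesic (g : SmoothMetric d M) (v : TangentBundle (𝓡 (d + 1)) M) : ℝ → M :=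
  if h : ∃ γ : ℝ → M, IsGeodesic g γ ∧ velocity γ 0 = v then h.choose else fun _ => v.1

open Classical in
/-- The geodesic flow `Φ(v, s) = γ̇_v(s)` on `SM`. The velocity of a unit speed geodesic has unit
length, so that the default value `v` is never needed on a compact manifold. -/
def geodesicFlow (g : SmoothMetric d M) (q : UnitTangent M g × ℝ) : UnitTangent M g :=
  if h : sqLen g (velocity (geodesic g (q.1.incl g)) q.2) = 1 then
    ⟨velocity (geodesic g (q.1.incl g)) q.2, h⟩
  else q.1

/-! ### Differentials -/

/-- The differential `dι|_v : T_v SM → T_v TM`. -/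
def dIncl (g : SmoothMetric d M) (v : UnitTangent M g) :
    TangentSpace (unitModel d) v →L[ℝ] TangentSpace (𝓡 (d + 1)).tangent (v.incl g) :=
  mfderiv (unitModel d) (𝓡 (d + 1)).tangent (UnitTangent.incl g) v

/-- The differential `dπ|_v : T_v SM → T_{π(v)} M`. -/
def dBase (g : SmoothMetric d M) (v : UnitTangent M g) :
    TangentSpace (unitModel d) v →L[ℝ] TangentSpace (𝓡 (d + 1)) (v.base g) :=
  mfderiv (unitModel d) (𝓡 (d + 1)) (UnitTangent.base g) v

/-- The differential `dp|_{(v,s)}` of the projection `p : SM × ℝ → SM`. -/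
def dProj (g : SmoothMetric d M) (v : UnitTangent M g) (s : ℝ) :
    TangentSpace ((unitModel d).prod 𝓘(ℝ, ℝ)) (v, s) →L[ℝ] TangentSpace (unitModel d) v :=
  mfderiv ((unitModel d).prod 𝓘(ℝ, ℝ)) (unitModel d)
    (Prod.fst : UnitTangent M g × ℝ → UnitTangent M g) (v, s)

/-- The differential `dΦ|_{(v,s)}` of the geodesic flow `Φ : SM × ℝ → SM`. -/
def dFlow (g : SmoothMetric d M) (v : UnitTangent M g) (s : ℝ) :
    TangentSpace ((unitModel d).prod 𝓘(ℝ, ℝ)) (v, s) →L[ℝ]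
      TangentSpace (unitModel d) (geodesicFlow g (v, s)) :=
  mfderiv ((unitModel d).prod 𝓘(ℝ, ℝ)) (unitModel d) (geodesicFlow g) (v, s)

/-- The differential `d_vΦ|_{(v,s)}` of the map `Φ(·, s) : SM → SM` at `v`. -/
def dvFlow (g : SmoothMetric d M) (v : UnitTangent M g) (s : ℝ) :
    TangentSpace (unitModel d) v →L[ℝ] TangentSpace (unitModel d) (geodesicFlow g (v, s)) :=
  mfderiv (unitModel d) (unitModel d) (fun w => geodesicFlow g (w, s)) v

/-- The differential `dπ_{TM}|_w : T_w TM → T_{π(w)} M`. -/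
def dBaseTM (w : TangentBundle (𝓡 (d + 1)) M) :
    TangentSpace (𝓡 (d + 1)).tangent w →L[ℝ] TangentSpace (𝓡 (d + 1)) w.1 :=
  mfderiv (𝓡 (d + 1)).tangent (𝓡 (d + 1))
    (fun u : TangentBundle (𝓡 (d + 1)) M => u.1) w

/-! ### Conjugate pairs -/

/-- `K_{(v,s)} = ker (dπ|_{Φ(v,s)} ∘ d_vΦ|_{(v,s)}) ∩ ker dπ|_v ⊆ T_v SM`. -/
def conjKernel (g : SmoothMetric d M) (q : UnitTangent M g × ℝ) :
    Submodule ℝ (TangentSpace (unitModel d) q.1) :=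
  LinearMap.ker ((dBase g (geodesicFlow g (q.1, q.2))).comp (dvFlow g q.1 q.2)).toLinearMap ⊓
    LinearMap.ker (dBase g q.1).toLinearMap

/-- `(v, s)` is a conjugate pair. -/
def IsConjugatePair (g : SmoothMetric d M) (q : UnitTangent M g × ℝ) : Prop :=
  q.2 ≠ 0 ∧ conjKernel g q ≠ ⊥

/-- `(v, s)` is a conjugate pair of order `k`. -/
def IsConjugatePairOfOrder (g : SmoothMetric d M) (k : ℕ) (q : UnitTangent M g × ℝ) : Prop :=
  IsConjugatePair g q ∧ Module.finrank ℝ (conjKernel g q) = k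

/-- The set `𝒞_{R,k}` of regular conjugate pairs of order `k`: the conjugate pairs of order `k`
having a neighbourhood in `SM × ℝ` in which all other conjugate pairs have order `k` too. -/
def regularConj (g : SmoothMetric d M) (k : ℕ) : Set (UnitTangent M g × ℝ) :=
  {q | IsConjugatePairOfOrder g k q ∧
    ∃ U ∈ 𝓝 q, ∀ q' ∈ U, IsConjugatePair g q' → IsConjugatePairOfOrder g k q'}

/-- The bundle `E_{R,k} = {((v, s), X) : (v, s) ∈ 𝒞_{R,k}, X ∈ K_{(v,s)}}`. -/
def conjBundle (g : SmoothMetric d M) (k : ℕ) :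
    Set (Σ q : UnitTangent M g × ℝ, TangentSpace (unitModel d) q.1) :=
  {z | z.1 ∈ regularConj g k ∧ z.2 ∈ conjKernel g z.1}

/-! ### The symplectic form on `TM` and the maps `F_k` -/

/-- The one-form `♭_g^* θ` on `TM`, where `θ` is the tautological one-form on `T*M`
(`θ_ξ(Z) = ξ(dπ_{T*M} Z)`) and `♭_g : TM → T*M`, `w ↦ g(w, ·)`:
it sends `X ∈ T_w TM` to `g(w, dπ_{TM} X)`. -/
def liouvilleForm (g : SmoothMetric d M) (w : TangentBundle (𝓡 (d + 1)) M) :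
    TangentSpace (𝓡 (d + 1)).tangent w →L[ℝ] ℝ :=
  (g.inner w.1 w.2).comp (dBaseTM w)

/-- The one-form `♭_g^* θ` in the natural coordinates of `TM` at `w`. -/
def liouvilleInChart (g : SmoothMetric d M) (w : TangentBundle (𝓡 (d + 1)) M)
    (y : EucModel d × EucModel d) : EucModel d × EucModel d →L[ℝ] ℝ :=
  (liouvilleForm g ((extChartAt (𝓡 (d + 1)).tangent w).symm y)).comp
    (mfderiv 𝓘(ℝ, EucModel d × EucModel d) (𝓡 (d + 1)).tangent
      (extChartAt (𝓡 (d + 1)).tangent w).symm y)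

/-- The symplectic form `ω_g = ♭_g^* ω` on `TM`, `ω = dθ` being the canonical symplectic form
(`dξ_i ∧ dxⁱ` in natural coordinates) of `T*M`. Since `♭_g^* dθ = d(♭_g^* θ)`, it is the exterior
derivative of `♭_g^* θ`, that is `dλ(X, Y) = (D_X λ)(Y) - (D_Y λ)(X)` in natural coordinates. -/
def omegaG (g : SmoothMetric d M) (w : TangentBundle (𝓡 (d + 1)) M)
    (X Y : TangentSpace (𝓡 (d + 1)).tangent w) : ℝ :=
  let ψ := extChartAt (𝓡 (d + 1)).tangent w
  let dψ := mfderiv (𝓡 (d + 1)).tangent 𝓘(ℝ, EucModel d × EucModel d) ψ w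
  fderiv ℝ (liouvilleInChart g w) (ψ w) (dψ X) (dψ Y)
    - fderiv ℝ (liouvilleInChart g w) (ψ w) (dψ Y) (dψ X)

open Classical in
/-- For `X ∈ T_w TM` such that `X ⌟ ω_g` lies in the range of the injective map `dπ_{TM}|_w^t`,
the covector `η ∈ T*_{π(w)} M` with `X ⌟ ω_g = dπ_{TM}|_w^t η` (and `0` for all other `X`). -/
def lowerOmega (g : SmoothMetric d M) (w : TangentBundle (𝓡 (d + 1)) M)
    (X : TangentSpace (𝓡 (d + 1)).tangent w) : TangentSpace (𝓡 (d + 1)) w.1 →L[ℝ] ℝ :=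
  if h : ∃ η : TangentSpace (𝓡 (d + 1)) w.1 →L[ℝ] ℝ,
    ∀ Y : TangentSpace (𝓡 (d + 1)).tangent w, omegaG g w X Y = η (dBaseTM w Y)
  then h.choose else 0

/-- The map `F_k : E_{R,k} → T*(M × M) = T*M × T*M`, `F_k((v, s), X) = (η, η̃)`, defined by
`dι|_v X ⌟ ω_g = dπ_{TM}|_v^t η` and
`(dι|_{Φ(v,s)} ∘ d_vΦ|_{(v,s)} X) ⌟ ω_g = dπ_{TM}|_{Φ(v,s)}^t η̃`.
It is given by the same formula for every `k`, and only its restriction to `E_{R,k}` is used. -/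
def conjMap (g : SmoothMetric d M)
    (z : Σ q : UnitTangent M g × ℝ, TangentSpace (unitModel d) q.1) :
    CotangentTotal d M × CotangentTotal d M :=
  (⟨z.1.1.base g, lowerOmega g (z.1.1.incl g) (dIncl g z.1.1 z.2)⟩,
   ⟨(geodesicFlow g z.1).base g, lowerOmega g ((geodesicFlow g z.1).incl g)
      (dIncl g (geodesicFlow g z.1) (dvFlow g z.1.1 z.1.2 z.2))⟩)

/-! ### The two conditions -/

/-- The covector condition `dp|_{(v,s)}^t ∘ dπ|_v^t η = dΦ|_{(v,s)}^t ∘ dπ|_{ṽ}^t η̃`, with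
`ṽ = Φ(v, s)`; the transpose of a linear map is precomposition with it. -/
def CovectorCondition (g : SmoothMetric d M) (v : UnitTangent M g) (s : ℝ)
    (η : TangentSpace (𝓡 (d + 1)) (v.base g) →L[ℝ] ℝ)
    (η' : TangentSpace (𝓡 (d + 1)) ((geodesicFlow g (v, s)).base g) →L[ℝ] ℝ) : Prop :=
  (η.comp (dBase g v)).comp (dProj g v s) =
    (η'.comp (dBase g (geodesicFlow g (v, s)))).comp (dFlow g v s)

/-- The conditions `dπ|_v^t η = d_vΦ|_{(v,s)}^t ∘ dπ|_{ṽ}^t η̃` and `η(v) = η̃(ṽ) = 0`, with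
`ṽ = Φ(v, s)`. -/
def ConjugateCovectors (g : SmoothMetric d M) (v : UnitTangent M g) (s : ℝ)
    (η : TangentSpace (𝓡 (d + 1)) (v.base g) →L[ℝ] ℝ)
    (η' : TangentSpace (𝓡 (d + 1)) ((geodesicFlow g (v, s)).base g) →L[ℝ] ℝ) : Prop :=
  η.comp (dBase g v) = (η'.comp (dBase g (geodesicFlow g (v, s)))).comp (dvFlow g v s) ∧
    η (v.vec g) = 0 ∧ η' ((geodesicFlow g (v, s)).vec g) = 0

end

/-! The equivalence of (1) and (2) comes from splitting the tangent space of `SM × ℝ`. On `(X, τ)`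
the differential of the flow is `dvFlow X + τ • flowField`, and `dBase` sends `flowField` to the
velocity `ṽ`. Evaluating (1) on `(X, 0)` gives the first equation of (2), and the remaining `τ`-term
gives `η̃(ṽ) = 0`. The equation `η(v) = 0` then follows, because the flow carries the geodesic field
at `v`, which lies over `v` itself, to the geodesic field at `ṽ`. This is `covectorCondition_iff`.

The link with the conjugate kernel is symplectic. If `X` is the vertical lift of `a`, then `ω_g(X,
·) = g(a, dπ ·)`, and `X` is tangent to `SM` exactly when `a ⊥ v`. Hence covectors that vanish on
`v` correspond to vertical vectors of `SM`. Given (2), let `X` and `X'` be the vertical vectors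
belonging to `η` and `η̃`. The flow preserves `ω_g`, so (2) says that `d_vΦ X` and `X'` have the
same `ω_g`-pairing with every `d_vΦ Y`, that is, with all of `T SM`. The flow also preserves the
Liouville form on `T SM`, which therefore vanishes on `d_vΦ X - X'`. A vector of `SM` killed by both
forms is zero (`eq_zero_of_omegaG_eq_zero`), so `d_vΦ X = X'` and `X` lies in `K`. Conversely, for
`X` in `K` both `X` and `d_vΦ X` are vertical, and invariance of `ω_g` read on all `Y` is the first
equation of (2). These two directions are `exists_conjKernel_of_conjugateCovectors` and
`exists_conjugateCovectors_of_conjKernel`; the claims on conjugate pairs and on `F_k` are read off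
from them.

Most of the work is to establish that the geodesic flow exists for all times, is of class `C²`, and
preserves the two forms. Regular dependence on initial data comes from the implicit function theorem
in a space of continuous curves. In natural coordinates geodesics are the integral curves of
`spray`, the Hamiltonian field of the kinetic energy for the form `sympl`. Its local flow preserves
`sympl`, and preserves the Liouville form on vectors tangent to energy levels. Naturality of `sympl`
and `spray` under changes of chart transports this to `TM`. Compactness of `SM` makes the time of
existence uniform; gluing gives completeness, and the group law extends regularity and invariance to
all times (`geodesicFlow_properties`). -/

noncomputable section

set_option maxSynthPendingDepth 3

/-! ### Superposition operators on spaces of continuous maps. -/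

section Nemytskii

universe u v
variable {K : Type*} [TopologicalSpace K] [CompactSpace K]
  {E : Type u} [NormedAddCommGroup E] [NormedSpace ℝ E]

/-- The superposition operator `γ ↦ F ∘ γ` on spaces of continuous maps. -/
def superposition (K : Type*) [TopologicalSpace K] {E E' : Type*} [TopologicalSpace E]
    [TopologicalSpace E'] (F : C(E, E')) (γ : C(K, E)) : C(K, E') := F.comp γ

theorem continuous_superposition {K E E' : Type*} [TopologicalSpace K] [TopologicalSpace E]
    [TopologicalSpace E'] (F : C(E, E')) :
    Continuous (superposition K F) := ContinuousMap.continuous_postcomp F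

/-- Pointwise application of a continuous family of linear maps to a continuous map. -/
def pointwiseApply (K : Type*) [TopologicalSpace K] [CompactSpace K] (E E' : Type*)
    [NormedAddCommGroup E] [NormedSpace ℝ E] [NormedAddCommGroup E'] [NormedSpace ℝ E'] :
    C(K, E →L[ℝ] E') →L[ℝ] C(K, E) →L[ℝ] C(K, E') :=
  LinearMap.mkContinuous₂
    (LinearMap.mk₂ ℝ (fun (A : C(K, E →L[ℝ] E')) (h : C(K, E)) =>
      (⟨fun τ => A τ (h τ), by fun_prop⟩ : C(K, E')))
      (by intros; ext; simp) (by intros; ext; simp) (by intros; ext; simp)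
      (by intros; ext; simp)) 1 (by
    intro A h
    rw [one_mul]
    refine (ContinuousMap.norm_le _ (by positivity)).2 fun τ => ?_
    exact (A τ).le_of_opNorm_le_of_le (A.norm_coe_le_norm τ) (h.norm_coe_le_norm τ))

@[simp] theorem pointwiseApply_apply {E' : Type*} [NormedAddCommGroup E'] [NormedSpace ℝ E']
    (A : C(K, E →L[ℝ] E')) (h : C(K, E)) (τ : K) :
    pointwiseApply K E E' A h τ = A τ (h τ) := rfl

/-- The pointwise derivative is the Fréchet derivative because the error is uniform over the compact
`K`: continuity of the superposition operator of `F'` supplies one radius `δ` for all `τ`, and the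
mean value inequality on the ball of radius `δ` does the rest. -/
theorem hasFDerivAt_superposition {E' : Type*} [NormedAddCommGroup E'] [NormedSpace ℝ E']
    (F : C(E, E')) (F' : C(E, E →L[ℝ] E')) (hF : ∀ x, HasFDerivAt F (F' x) x) (γ : C(K, E)) :
    HasFDerivAt (superposition K F) (pointwiseApply K E E' (superposition K F' γ)) γ := by
  rw [hasFDerivAt_iff_isLittleO_nhds_zero, Asymptotics.isLittleO_iff]
  intro c hc
  have hcont : ContinuousAt (superposition K F') γ :=
    (continuous_superposition (K := K) F').continuousAt
  obtain ⟨δ, hδ, H⟩ := (Metric.continuousAt_iff (α := C(K, E)) (β := C(K, E →L[ℝ] E'))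
    (f := superposition K F') (a := γ)).1 hcont c hc
  have key : ∀ τ, ∀ e ∈ Metric.ball (γ τ) δ, ‖F' e - F' (γ τ)‖ ≤ c := by
    intro τ e he
    -- The translate of `γ` by a constant passes through `e` at `τ`, so sup-norm continuity at `γ`
    -- controls `F' e - F' (γ τ)` with a `δ` independent of `τ`.
    have h1 : dist (γ + ContinuousMap.const K (e - γ τ)) γ < δ := by
      rw [dist_eq_norm, add_sub_cancel_left]
      refine lt_of_le_of_lt ?_ (mem_ball_iff_norm.1 he)
      exact (ContinuousMap.norm_le _ (norm_nonneg _)).2 fun τ => le_rfl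
    have h2 := (H h1).le
    have h3 := (ContinuousMap.dist_apply_le_dist τ).trans h2
    rw [dist_eq_norm] at h3
    simpa [superposition] using h3
  filter_upwards [Metric.ball_mem_nhds (0 : C(K, E)) hδ] with h hh
  refine (ContinuousMap.norm_le _ (by positivity)).2 fun τ => ?_
  have hτ : ‖h τ‖ < δ := (h.norm_coe_le_norm τ).trans_lt (by simpa using hh)
  have := (convex_ball (γ τ) δ).norm_image_sub_le_of_norm_hasFDerivWithin_le'
    (f := F) (f' := F') (C := c) (φ := F' (γ τ)) (x := γ τ) (y := γ τ + h τ)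
    (fun x _ => (hF x).hasFDerivWithinAt) (fun x hx => key τ x hx)
    (Metric.mem_ball_self hδ) (by simpa [mem_ball_iff_norm] using hτ)
  simp only [add_sub_cancel_left] at this
  refine le_trans ?_ (this.trans (mul_le_mul_of_nonneg_left (h.norm_coe_le_norm τ) hc.le))
  simp [superposition]

/-- The derivative is again a superposition operator, that of `fderiv ℝ F`, followed by a bounded
linear map, so induction on `n` applies. The target and its universe are left free because the
induction replaces `E'` by `E →L[ℝ] E'`. -/
theorem contDiff_superposition (n : ℕ) : ∀ {E' : Type (max u v)} [NormedAddCommGroup E']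
    [NormedSpace ℝ E'] (F : C(E, E')), ContDiff ℝ n F → ContDiff ℝ n (superposition K F) := by
  induction n with
  | zero =>
    intro E' _ _ F _
    exact contDiff_zero.2 (continuous_superposition F)
  | succ n ih =>
    intro E' _ _ F hF
    have h1 := (contDiff_succ_iff_fderiv (n := n)).1 (by exact_mod_cast hF)
    have hc : Continuous (fderiv ℝ F) := h1.2.2.continuous
    have h2 := ih (E' := E →L[ℝ] E') ⟨fderiv ℝ F, hc⟩ h1.2.2
    have hd := fun γ : C(K, E) => hasFDerivAt_superposition F ⟨fderiv ℝ F, hc⟩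
      (fun x => (h1.1 x).hasFDerivAt) γ
    have : ContDiff ℝ ((n : WithTop ℕ∞) + 1) (superposition K F) := by
      refine contDiff_succ_iff_fderiv.2 ⟨fun γ => (hd γ).differentiableAt, by simp, ?_⟩
      rw [show fderiv ℝ (superposition K F) = fun γ => pointwiseApply K E E'
        (superposition K ⟨fderiv ℝ F, hc⟩ γ) from funext fun γ => (hd γ).fderiv]
      exact (pointwiseApply K E E').contDiff.comp h2
    exact_mod_cast this

end Nemytskii

/-! ### Local flows depending regularly on the initial point. -/

section LocalFlow

variable {E : Type*} [NormedAddCommGroup E] [NormedSpace ℝ E]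

/-- The primitive `τ ↦ ∫₀^τ β` of a continuous map on the unit interval. -/
def primitiveMap [CompleteSpace E] (β : C(unitInterval, E)) : C(unitInterval, E) where
  toFun τ := ∫ s in (0 : ℝ)..τ, IccExtend (zero_le_one (α := ℝ)) β s
  continuous_toFun := by
    have h : Continuous (IccExtend (zero_le_one (α := ℝ)) β) := β.continuous.Icc_extend'
    exact (intervalIntegral.continuous_primitive (fun a b => h.intervalIntegrable a b) 0).comp
      continuous_subtype_val

/-- The primitive operator as a continuous linear map. -/
def primitiveL (E : Type*) [NormedAddCommGroup E] [NormedSpace ℝ E] [CompleteSpace E] :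
    C(unitInterval, E) →L[ℝ] C(unitInterval, E) :=
  LinearMap.mkContinuous
    { toFun := primitiveMap
      map_add' := by
        intro β β'
        ext τ
        have h : ∀ β : C(unitInterval, E), Continuous (IccExtend (zero_le_one (α := ℝ)) β) :=
          fun β => β.continuous.Icc_extend'
        exact intervalIntegral.integral_add ((h β).intervalIntegrable _ _)
          ((h β').intervalIntegrable _ _)
      map_smul' := by
        intro c β
        ext τ
        exact intervalIntegral.integral_smul _ _ } 1 (by
    intro β
    refine (ContinuousMap.norm_le _ (by positivity)).2 fun τ => ?_
    refine (intervalIntegral.norm_integral_le_of_norm_le_const (C := ‖β‖)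
      fun s _ => β.norm_coe_le_norm _).trans ?_
    have h0 := τ.2.1
    have h1 := τ.2.2
    rw [sub_zero, abs_of_nonneg h0, one_mul]
    exact mul_le_of_le_one_right (norm_nonneg _) h1)

/-- If `γ = z + t ∫ F(γ)` on the unit interval and `α` solves `α' = F(α)`, `α 0 = z`, then
`γ 1 = α t`. -/
theorem eval_one_eq_of_integral_equation [CompleteSpace E] {F : C(E, E)} {k : NNReal}
    (hF : LipschitzWith k F) {z : E} {t ε : ℝ} (ht : t ∈ Ioo (-ε) ε) {α : ℝ → E}
    (h0 : α 0 = z) (hα : ∀ s ∈ Ioo (-ε) ε, HasDerivAt α (F (α s)) s)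
    {γ : C(unitInterval, E)}
    (hγ : γ = ContinuousMap.const _ z + t • primitiveL E (superposition _ F γ)) :
    γ 1 = α t := by
  set c : ℝ → E := IccExtend (zero_le_one (α := ℝ)) γ with hc
  have hcc : Continuous c := γ.continuous.Icc_extend'
  have hc1 : ∀ s ∈ Icc (0 : ℝ) 1, c s = z + t • ∫ r in (0 : ℝ)..s, F (c r) := by
    intro s hs
    have h1 : c s = γ ⟨s, hs⟩ := IccExtend_of_mem _ _ hs
    rw [h1, hγ]
    rfl
  have hd : ∀ s ∈ Ico (0 : ℝ) 1, HasDerivWithinAt c (t • F (c s)) (Ici s) s := by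
    intro s hs
    have h2 : HasDerivAt (fun s => z + t • ∫ r in (0 : ℝ)..s, F (c r)) (t • F (c s)) s := by
      have hFc : Continuous fun r => F (c r) := F.continuous.comp hcc
      exact ((hFc.integral_hasStrictDerivAt 0 s).hasDerivAt.const_smul t).const_add z
    have h3 : HasDerivWithinAt c (t • F (c s)) (Icc s 1) s := by
      refine h2.hasDerivWithinAt.congr (fun r hr => hc1 r ⟨hs.1.trans hr.1, hr.2⟩)
        (hc1 s ⟨hs.1, hs.2.le⟩)
    exact h3.mono_of_mem_nhdsWithin (Icc_mem_nhdsGE hs.2)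
  have hmem : ∀ s ∈ Icc (0 : ℝ) 1, t * s ∈ Ioo (-ε) ε := by
    intro s hs
    rw [mem_Ioo, ← abs_lt, abs_mul, abs_of_nonneg hs.1]
    exact lt_of_le_of_lt (mul_le_of_le_one_right (abs_nonneg t) hs.2) (abs_lt.2 ht)
  have hα' : ∀ s ∈ Icc (0 : ℝ) 1, HasDerivAt (fun s => α (t * s)) (t • F (α (t * s))) s := by
    intro s hs
    have := (hα _ (hmem s hs)).scomp s ((hasDerivAt_id s).const_mul t)
    simpa [Function.comp_def] using this
  -- Time is rescaled to the unit interval: the extension of `γ` and `s ↦ α (t s)` both solve `x' =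
  -- t F(x)` from `z`, and are compared at `s = 1`.
  have := ODE_solution_unique (f := c) (g := fun s => α (t * s)) (v := fun _ x => t • F x)
    (K := ‖t‖₊ * k) (a := 0) (b := 1) (fun _ => (lipschitzWith_smul t).comp hF)
    hcc.continuousOn hd (fun s hs => (hα' s hs).continuousAt.continuousWithinAt)
    (fun s hs => (hα' s (Ico_subset_Icc_self hs)).hasDerivWithinAt)
    (by rw [hc1 0 ⟨le_rfl, zero_le_one⟩]; simp [h0])
  have h1 := this (right_mem_Icc.2 zero_le_one)
  simp only [mul_one] at h1
  rw [← h1, hc]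
  exact (IccExtend_of_mem _ _ (right_mem_Icc.2 zero_le_one)).symm

/-- The inclusion of the constant maps. -/
def constL (E : Type*) [NormedAddCommGroup E] [NormedSpace ℝ E] : E →L[ℝ] C(unitInterval, E) :=
  LinearMap.mkContinuous
    { toFun := ContinuousMap.const _, map_add' := fun _ _ => rfl, map_smul' := fun _ _ => rfl } 1
    fun z => by
      rw [one_mul]
      exact (ContinuousMap.norm_le _ (norm_nonneg _)).2 fun _ => le_rfl

/-- Solutions on `[0, t]`, rescaled to the unit interval, are the zeros of `γ - z - t ∫ F(γ)`, a
`C^n` function of `(z, t, γ)`. The implicit function theorem solves for `γ` near `t = 0`, and the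
flow is the endpoint of `γ`. The global Lipschitz bound identifies this endpoint with the
Picard–Lindelöf solution without first confining `γ` to a region. -/
theorem exists_contDiffAt_flow_of_lipschitz [CompleteSpace E] {n : ℕ} (hn : n ≠ 0) {F : E → E}
    {k : NNReal} (hF : ContDiff ℝ n F) (hk : LipschitzWith k F) (z₀ : E) :
    ∃ Z : E × ℝ → E, ContDiffAt ℝ n Z (z₀, 0) ∧ ∀ᶠ p in 𝓝 (z₀, (0 : ℝ)),
      Z (p.1, 0) = p.1 ∧ HasDerivAt (fun t => Z (p.1, t)) (F (Z p)) p.2 := by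
  have hn' : (n : WithTop ℕ∞) ≠ 0 := by exact_mod_cast hn
  set F' : C(E, E) := ⟨F, hF.continuous⟩ with hF'
  set f : (E × ℝ) × C(unitInterval, E) → C(unitInterval, E) := fun u =>
    u.2 - constL E u.1.1 - u.1.2 • primitiveL E (superposition _ F' u.2) with hf
  set u : (E × ℝ) × C(unitInterval, E) := ((z₀, 0), constL E z₀) with hu
  have hs : ContDiff ℝ n (superposition unitInterval F') := contDiff_superposition n F' hF
  have hfc : ContDiff ℝ n f := by
    have h1 : ContDiff ℝ n fun u : (E × ℝ) × C(unitInterval, E) =>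
        primitiveL E (superposition _ F' u.2) :=
      (primitiveL E).contDiff.comp (hs.comp contDiff_snd)
    have h2 : ContDiff ℝ n fun u : (E × ℝ) × C(unitInterval, E) => constL E u.1.1 :=
      (constL E).contDiff.comp (contDiff_fst.comp contDiff_fst)
    exact (contDiff_snd.sub h2).sub ((contDiff_snd.comp contDiff_fst).smul h1)
  have hfu : f u = 0 := by simp [hf, hu]
  -- At `t = 0` the integral term disappears, so the partial derivative in `γ` is the identity.
  have hinv : fderiv ℝ f u ∘L .inr ℝ (E × ℝ) C(unitInterval, E) =
      ContinuousLinearMap.id ℝ _ := by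
    have h1 : HasFDerivAt f (fderiv ℝ f u) u := (hfc.differentiable hn' u).hasFDerivAt
    have h2 := HasFDerivAt.comp (constL E z₀) (f := fun γ : C(unitInterval, E) =>
      (((z₀, 0) : E × ℝ), γ)) h1 (hasFDerivAt_prodMk_right _ _)
    have h3 : f ∘ (fun γ : C(unitInterval, E) => (((z₀, 0) : E × ℝ), γ)) =
        fun γ => γ - constL E z₀ := by
      funext γ
      simp [hf]
    rw [h3] at h2
    exact h2.unique ((hasFDerivAt_id _).sub_const _)
  have hI : (fderiv ℝ f u ∘L .inr ℝ (E × ℝ) C(unitInterval, E)).IsInvertible := by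
    rw [hinv]
    exact ⟨ContinuousLinearEquiv.refl ℝ _, rfl⟩
  set ψ := (hfc.contDiffAt (x := u)).implicitFunction hn' hI with hψ
  have hψc : ContDiffAt ℝ n ψ (z₀, 0) :=
    (hfc.contDiffAt (x := u)).contDiffAt_implicitFunction hn' hI
  have hψe : ∀ᶠ x in 𝓝 (z₀, (0 : ℝ)), f (x, ψ x) = f u :=
    (hfc.contDiffAt (x := u)).eventually_apply_implicitFunction hn' hI
  let ev : C(unitInterval, E) →L[ℝ] E := ContinuousMap.evalCLM ℝ (1 : unitInterval)
  have hZc : ContDiffAt ℝ n (fun p => ψ p 1) (z₀, 0) := ev.contDiff.contDiffAt.comp _ hψc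
  refine ⟨fun p => ψ p 1, hZc, ?_⟩
  -- Picard–Lindelöf supplies genuine solutions on a common time interval for all nearby initial
  -- points; these show that the endpoints `ψ (z, t) 1` satisfy the differential equation in `t`.
  obtain ⟨r, hr, ε, hε, H⟩ :=
    ContDiffAt.exists_forall_mem_closedBall_exists_eq_forall_mem_Ioo_hasDerivAt
    (hF.contDiffAt.of_le (by exact_mod_cast Nat.one_le_iff_ne_zero.2 hn) :
      ContDiffAt ℝ 1 F z₀) 0
  simp only [zero_sub, zero_add] at H
  rw [nhds_prod_eq] at hψe ⊢
  obtain ⟨P, hP, Q, hQ, hPQ⟩ := Filter.eventually_prod_iff.1 hψe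
  obtain ⟨δ, hδ, hQ'⟩ := Metric.eventually_nhds_iff_ball.1 hQ
  rw [Real.ball_eq_Ioo, zero_sub, zero_add] at hQ'
  have hm : min δ ε > 0 := lt_min hδ hε
  refine Filter.eventually_prod_iff.2 ⟨fun z => P z ∧ z ∈ Metric.closedBall z₀ r,
    hP.and (Metric.closedBall_mem_nhds _ hr), fun t => t ∈ Ioo (-min δ ε) (min δ ε),
    Ioo_mem_nhds (by linarith) hm, ?_⟩
  rintro z ⟨hz, hzr⟩ t ht
  obtain ⟨α, hα0, hα⟩ := H z hzr
  have key : ∀ s ∈ Ioo (-min δ ε) (min δ ε), ψ (z, s) 1 = α s := by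
    intro s hs
    have h1 := hPQ hz (hQ' s ⟨by linarith [hs.1, min_le_left δ ε],
      by linarith [hs.2, min_le_left δ ε]⟩)
    rw [hfu] at h1
    refine eval_one_eq_of_integral_equation (F := F') hk (ε := ε) (z := z)
      ⟨by linarith [hs.1, min_le_right δ ε], by linarith [hs.2, min_le_right δ ε]⟩ hα0 hα ?_
    have h2 : ψ (z, s) - constL E z - s • primitiveL E (superposition _ F' (ψ (z, s))) = 0 := h1
    rw [sub_sub, sub_eq_zero] at h2
    exact h2
  refine ⟨(key 0 ⟨by linarith, hm⟩).trans hα0, ?_⟩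
  simp only
  rw [key t ht]
  refine (hα t ⟨by linarith [ht.1, min_le_right δ ε], by linarith [ht.2, min_le_right δ ε]⟩)
    |>.congr_of_eventuallyEq ?_
  filter_upwards [Ioo_mem_nhds ht.1 ht.2] with s hs using key s hs

/-- A `C^n` vector field on an open subset of a finite-dimensional space has a local flow which is
jointly `C^n` in the initial point and time. -/
theorem exists_contDiffOn_local_flow [FiniteDimensional ℝ E] {n : ℕ} (hn : n ≠ 0) {F : E → E}
    {V : Set E} (hV : IsOpen V) (hF : ContDiffOn ℝ n F V) {z₀ : E} (hz₀ : z₀ ∈ V) :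
    ∃ (W : Set E) (ε : ℝ) (Z : E × ℝ → E), IsOpen W ∧ z₀ ∈ W ∧ 0 < ε ∧
      ContDiffOn ℝ n Z (W ×ˢ Ioo (-ε) ε) ∧ ∀ z ∈ W, Z (z, 0) = z ∧ ∀ t ∈ Ioo (-ε) ε,
        Z (z, t) ∈ V ∧ HasDerivAt (fun s => Z (z, s)) (F (Z (z, t))) t := by
  have : CompleteSpace E := FiniteDimensional.complete ℝ E
  have hn' : (n : WithTop ℕ∞) ≠ 0 := by exact_mod_cast hn
  obtain ⟨ρ, hρ, hρV⟩ := Metric.nhds_basis_closedBall.mem_iff.1 (hV.mem_nhds hz₀)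
  -- The cut-off field has compact support, hence is globally Lipschitz. It equals `F` on the ball
  -- of radius `ρ / 2`, where the flow stays for points near `z₀` and small times.
  let χ : ContDiffBump z₀ := ⟨ρ / 2, ρ, by positivity, by linarith⟩
  set F' : E → E := fun x => χ x • F x with hF'
  have hF'c : ContDiff ℝ n F' := by
    refine contDiff_iff_contDiffAt.2 fun x => ?_
    by_cases hx : x ∈ V
    · exact χ.contDiffAt.smul (hF.contDiffAt (hV.mem_nhds hx))
    · have h1 : x ∈ (Metric.closedBall z₀ ρ)ᶜ := fun h => hx (hρV h)
      refine contDiffAt_const (c := (0 : E)) |>.congr_of_eventuallyEq ?_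
      filter_upwards [Metric.isClosed_closedBall.isOpen_compl.mem_nhds h1] with y hy
      have : χ y = 0 := χ.zero_of_le_dist (le_of_lt (by simpa using hy))
      simp [hF', this]
  have hcs : HasCompactSupport F' := χ.hasCompactSupport.smul_right
  obtain ⟨k, hk⟩ := hF'c.lipschitzWith_of_hasCompactSupport hcs hn'
  obtain ⟨Z, hZc, hZ⟩ := exists_contDiffAt_flow_of_lipschitz hn hF'c hk z₀
  have hZ0 : Z (z₀, 0) = z₀ := hZ.self_of_nhds.1
  have hZb : ∀ᶠ p in 𝓝 (z₀, (0 : ℝ)), Z p ∈ Metric.ball z₀ (ρ / 2) := by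
    refine hZc.continuousAt.eventually ?_
    rw [hZ0]
    exact Metric.ball_mem_nhds _ (by positivity)
  have hZn : ∀ᶠ p in 𝓝 (z₀, (0 : ℝ)), ContDiffAt ℝ n Z p := hZc.eventually (by simp)
  have hall := (hZ.and (hZb.and hZn))
  rw [nhds_prod_eq] at hall
  obtain ⟨P, hP, Q, hQ, hPQ⟩ := Filter.eventually_prod_iff.1 hall
  obtain ⟨W, hWP, hW, hzW⟩ := eventually_nhds_iff.1 hP
  obtain ⟨ε, hε, hQ'⟩ := Metric.eventually_nhds_iff_ball.1 hQ
  rw [Real.ball_eq_Ioo, zero_sub, zero_add] at hQ'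
  refine ⟨W, ε, Z, hW, hzW, hε, ?_, ?_⟩
  · rintro ⟨z, t⟩ ⟨hz, ht⟩
    exact (hPQ (hWP z hz) (hQ' t ht)).2.2.contDiffWithinAt
  · intro z hz
    refine ⟨(hPQ (hWP z hz) (hQ' 0 ⟨by linarith, hε⟩)).1.1, fun t ht => ?_⟩
    obtain ⟨⟨-, h1⟩, h2, -⟩ := hPQ (hWP z hz) (hQ' t ht)
    refine ⟨hρV (Metric.closedBall_subset_closedBall (by linarith)
      (Metric.ball_subset_closedBall h2)), ?_⟩
    have h3 : χ (Z (z, t)) = 1 := χ.one_of_mem_closedBall (Metric.ball_subset_closedBall h2)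
    simpa [hF', h3] using h1

end LocalFlow

/-! ### Metrics on a vector space: kinetic energy, symplectic form and geodesic field. -/

section EuclideanMetric

variable {E : Type*} [NormedAddCommGroup E] [NormedSpace ℝ E]

/-- The Legendre transform `(y, u) ↦ G_y(u, ·)` of a metric on a vector space. -/
def momentum (G : E → E →L[ℝ] E →L[ℝ] ℝ) (z : E × E) : E →L[ℝ] ℝ := G z.1 z.2

/-- The kinetic energy `½ G_y(u, u)`. -/
def kinetic (G : E → E →L[ℝ] E →L[ℝ] ℝ) (z : E × E) : ℝ := (1 / 2) * G z.1 z.2 z.2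

/-- The exterior derivative of the one-form `(y, u) ↦ G_y(u, dy)`. -/
def sympl (G : E → E →L[ℝ] E →L[ℝ] ℝ) (z X Y : E × E) : ℝ :=
  fderiv ℝ (momentum G) z X Y.1 - fderiv ℝ (momentum G) z Y X.1

/-- The derivative of the kinetic energy with respect to the position. -/
def force (G : E → E →L[ℝ] E →L[ℝ] ℝ) (z : E × E) : E →L[ℝ] ℝ :=
  (1 / 2 : ℝ) • ((fderiv ℝ G z.1).flip z.2).flip z.2

theorem force_apply (G : E → E →L[ℝ] E →L[ℝ] ℝ) (z : E × E) (b : E) :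
    force G z b = (1 / 2) * fderiv ℝ G z.1 b z.2 z.2 := rfl

/-- The geodesic vector field `(y, u) ↦ (u, a)`, where
`G_y(a, ·) = ½ ∂G_y(u, u) - (∂_u G_y)(u, ·)`. -/
def spray (G : E → E →L[ℝ] E →L[ℝ] ℝ) (z : E × E) : E × E :=
  (z.2, (G z.1).inverse (force G z - fderiv ℝ G z.1 z.2 z.2))

theorem hasFDerivAt_momentum {G : E → E →L[ℝ] E →L[ℝ] ℝ} {z : E × E}
    (hG : DifferentiableAt ℝ G z.1) :
    HasFDerivAt (momentum G) ((G z.1).comp (.snd ℝ E E) +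
      ((fderiv ℝ G z.1).comp (.fst ℝ E E)).flip z.2) z :=
  HasFDerivAt.clm_apply (hG.hasFDerivAt.comp z hasFDerivAt_fst) hasFDerivAt_snd

theorem fderiv_momentum_apply {G : E → E →L[ℝ] E →L[ℝ] ℝ} {z : E × E}
    (hG : DifferentiableAt ℝ G z.1) (X : E × E) (b : E) :
    fderiv ℝ (momentum G) z X b = G z.1 X.2 b + fderiv ℝ G z.1 X.1 z.2 b := by
  rw [(hasFDerivAt_momentum hG).fderiv]
  rfl

theorem hasFDerivAt_kinetic {G : E → E →L[ℝ] E →L[ℝ] ℝ} {z : E × E}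
    (hG : DifferentiableAt ℝ G z.1) (hsymm : ∀ a b, G z.1 a b = G z.1 b a) :
    HasFDerivAt (kinetic G) ((force G z).comp (.fst ℝ E E) +
      (momentum G z).comp (.snd ℝ E E)) z := by
  have h := ((hasFDerivAt_momentum hG).clm_apply (hasFDerivAt_snd (p := z))).const_mul (1 / 2 : ℝ)
  refine h.congr_fderiv ?_
  ext X
  · simp [momentum, force_apply]
  · simp only [momentum, ContinuousLinearMap.comp_apply, ContinuousLinearMap.inr_apply,
      add_apply, smul_apply, ContinuousLinearMap.flip_apply,
      ContinuousLinearMap.coe_snd', ContinuousLinearMap.coe_fst', map_zero,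
      zero_apply, smul_eq_mul, hsymm X z.2]
    ring

theorem fderiv_kinetic_apply {G : E → E →L[ℝ] E →L[ℝ] ℝ} {z : E × E}
    (hG : DifferentiableAt ℝ G z.1) (hsymm : ∀ a b, G z.1 a b = G z.1 b a) (X : E × E) :
    fderiv ℝ (kinetic G) z X = force G z X.1 + momentum G z X.2 := by
  rw [(hasFDerivAt_kinetic hG hsymm).fderiv]
  rfl

/-- `(u, a)` is the value of the geodesic vector field iff `ω((u, a), ·) = -dH`. -/
theorem sympl_add_fderiv_kinetic {G : E → E →L[ℝ] E →L[ℝ] ℝ} {z : E × E}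
    (hG : DifferentiableAt ℝ G z.1) (hsymm : ∀ a b, G z.1 a b = G z.1 b a) (a : E) (Y : E × E) :
    sympl G z (z.2, a) Y + fderiv ℝ (kinetic G) z Y =
      G z.1 a Y.1 + fderiv ℝ G z.1 z.2 z.2 Y.1 - force G z Y.1 := by
  rw [sympl, fderiv_momentum_apply hG, fderiv_momentum_apply hG, fderiv_kinetic_apply hG hsymm,
    momentum, force_apply, hsymm z.2 Y.2]
  ring

/-- Definiteness gives injectivity, and a finite-dimensional space and its dual have equal
dimension. -/
theorem isInvertible_of_posDef [FiniteDimensional ℝ E] {B : E →L[ℝ] E →L[ℝ] ℝ}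
    (hB : ∀ a, a ≠ 0 → 0 < B a a) : B.IsInvertible := by
  have hinj : LinearMap.ker (B : E →ₗ[ℝ] E →L[ℝ] ℝ) = ⊥ := by
    refine LinearMap.ker_eq_bot'.2 fun a ha => ?_
    by_contra h
    have h1 := hB a h
    have h2 : B a = 0 := ha
    simp [h2] at h1
  have hfr : Module.finrank ℝ E = Module.finrank ℝ (E →L[ℝ] ℝ) := by
    rw [← (LinearMap.toContinuousLinearMap : (E →ₗ[ℝ] ℝ) ≃ₗ[ℝ] (E →L[ℝ] ℝ)).finrank_eq]
    exact (Subspace.dual_finrank_eq (K := ℝ) (V := E)).symm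
  let e : E ≃ₗ[ℝ] (E →L[ℝ] ℝ) := LinearEquiv.ofBijective (B : E →ₗ[ℝ] E →L[ℝ] ℝ)
    ⟨LinearMap.ker_eq_bot.1 hinj, (LinearMap.injective_iff_surjective_of_finrank_eq_finrank hfr).1
      (LinearMap.ker_eq_bot.1 hinj)⟩
  exact ⟨e.toContinuousLinearEquiv, by ext; rfl⟩

theorem metric_spray_snd {G : E → E →L[ℝ] E →L[ℝ] ℝ} {z : E × E}
    (hinv : (G z.1).IsInvertible) :
    G z.1 (spray G z).2 = force G z - fderiv ℝ G z.1 z.2 z.2 :=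
  hinv.self_apply_inverse _

/-- The implicit form of the definition of `spray`, tested on vectors `b`; it is the form taken by
the geodesic equation with Christoffel symbols of the first kind. -/
theorem eq_spray_iff {G : E → E →L[ℝ] E →L[ℝ] ℝ} {z : E × E}
    (hinv : (G z.1).IsInvertible) (a : E) :
    a = (spray G z).2 ↔ ∀ b, G z.1 a b + fderiv ℝ G z.1 z.2 z.2 b - force G z b = 0 := by
  have h1 : a = (spray G z).2 ↔ G z.1 a = G z.1 (spray G z).2 := by
    obtain ⟨e, he⟩ := hinv
    rw [← he]
    exact e.injective.eq_iff.symm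
  rw [h1, metric_spray_snd hinv, ContinuousLinearMap.ext_iff]
  refine forall_congr' fun b => ?_
  rw [sub_apply]
  constructor <;> intro h <;> linarith

/-- The only nonlinear ingredient beyond products is operator inversion, which is smooth at
invertible operators. -/
theorem contDiffOn_spray [FiniteDimensional ℝ E] {G : E → E →L[ℝ] E →L[ℝ] ℝ} {U : Set E}
    (hU : IsOpen U) (hG : ContDiffOn ℝ ∞ G U) (hpos : ∀ y ∈ U, ∀ a, a ≠ 0 → 0 < G y a a) :
    ContDiffOn ℝ ∞ (spray G) (U ×ˢ univ) := by
  have : CompleteSpace E := FiniteDimensional.complete ℝ E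
  have hfst : ContDiffOn ℝ ∞ (fun z : E × E => G z.1) (U ×ˢ univ) :=
    hG.comp contDiffOn_fst fun z hz => hz.1
  have hder : ContDiffOn ℝ ∞ (fun z : E × E => fderiv ℝ G z.1) (U ×ˢ univ) :=
    (hG.fderiv_of_isOpen hU (by simp)).comp contDiffOn_fst fun z hz => hz.1
  have hquad : ∀ {f h : E × E → E}, ContDiffOn ℝ ∞ f (U ×ˢ univ) → ContDiffOn ℝ ∞ h (U ×ˢ univ) →
      ContDiffOn ℝ ∞ (fun z => fderiv ℝ G z.1 (f z) (h z)) (U ×ˢ univ) :=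
    fun hf hh => (hder.clm_apply hf).clm_apply hh
  have hforce : ContDiffOn ℝ ∞ (force G) (U ×ˢ univ) := by
    refine contDiffOn_clm_apply.2 fun b => ?_
    simp only [force_apply]
    exact contDiffOn_const.mul ((hquad contDiffOn_const contDiffOn_snd).clm_apply contDiffOn_snd)
  intro z hz
  obtain ⟨e, he⟩ := isInvertible_of_posDef (hpos z.1 hz.1)
  have hinv : ContDiffWithinAt ℝ ∞ (fun z : E × E => (G z.1).inverse) (U ×ˢ univ) z := by
    refine ContDiffAt.comp_contDiffWithinAt z (g := ContinuousLinearMap.inverse) ?_ (hfst z hz)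
    rw [← he]
    exact contDiffAt_map_inverse e
  exact contDiffWithinAt_snd.prodMk (hinv.clm_apply
    ((hforce z hz).sub (hquad contDiffOn_snd contDiffOn_snd z hz)))

end EuclideanMetric

/-! ### Naturality under changes of coordinates. -/

section ChangeOfCoordinates

variable {E : Type*} [NormedAddCommGroup E] [NormedSpace ℝ E]

/-- The map `(y, u) ↦ (φ y, Dφ_y u)` on `E × E` induced by `φ`. -/
def tangentLift (φ : E → E) (z : E × E) : E × E := (φ z.1, fderiv ℝ φ z.1 z.2)

variable {φ : E → E} {z : E × E} {G₀ G₁ : E → E →L[ℝ] E →L[ℝ] ℝ}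

theorem hasFDerivAt_tangentLift (hφ : ContDiffAt ℝ 2 φ z.1) :
    HasFDerivAt (tangentLift φ) (((fderiv ℝ φ z.1).comp (.fst ℝ E E)).prod
      ((fderiv ℝ φ z.1).comp (.snd ℝ E E) +
        ((fderiv ℝ (fderiv ℝ φ) z.1).comp (.fst ℝ E E)).flip z.2)) z := by
  have h1 : HasFDerivAt φ (fderiv ℝ φ z.1) z.1 := (hφ.differentiableAt (by simp)).hasFDerivAt
  have h2 : HasFDerivAt (fderiv ℝ φ) (fderiv ℝ (fderiv ℝ φ) z.1) z.1 :=
    ((hφ.fderiv_right (m := 1) (by norm_num)).differentiableAt (by simp)).hasFDerivAt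
  exact (h1.comp z hasFDerivAt_fst).prodMk
    ((h2.comp z hasFDerivAt_fst).clm_apply hasFDerivAt_snd)

theorem fderiv_tangentLift_fst (hφ : ContDiffAt ℝ 2 φ z.1) (X : E × E) :
    (fderiv ℝ (tangentLift φ) z X).1 = fderiv ℝ φ z.1 X.1 := by
  rw [(hasFDerivAt_tangentLift hφ).fderiv]
  rfl

/-- The Liouville forms correspond under the lift. Differentiating this identity produces one extra
term containing the second derivative of `φ`, which is symmetric in `X.1` and `Y.1` and so cancels
in the antisymmetrisation. -/
theorem sympl_tangentLift (hφ : ContDiffAt ℝ 2 φ z.1) (hG₀ : DifferentiableAt ℝ G₀ z.1)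
    (hG₁ : DifferentiableAt ℝ G₁ (φ z.1))
    (hG : ∀ᶠ y in 𝓝 z.1, ∀ a b, G₀ y a b = G₁ (φ y) (fderiv ℝ φ y a) (fderiv ℝ φ y b))
    (X Y : E × E) :
    sympl G₁ (tangentLift φ z) (fderiv ℝ (tangentLift φ) z X) (fderiv ℝ (tangentLift φ) z Y) =
      sympl G₀ z X Y := by
  have hT := hasFDerivAt_tangentLift hφ
  have h2 : HasFDerivAt (fderiv ℝ φ) (fderiv ℝ (fderiv ℝ φ) z.1) z.1 :=
    ((hφ.fderiv_right (m := 1) (by norm_num)).differentiableAt (by simp)).hasFDerivAt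
  have hP₁ : HasFDerivAt (momentum G₁) (fderiv ℝ (momentum G₁) (tangentLift φ z))
      (tangentLift φ z) :=
    (hasFDerivAt_momentum (z := tangentLift φ z) hG₁).differentiableAt.hasFDerivAt
  have key : ∀ (X : E × E) (a : E), fderiv ℝ (momentum G₀) z X a =
      fderiv ℝ (momentum G₁) (tangentLift φ z) (fderiv ℝ (tangentLift φ) z X) (fderiv ℝ φ z.1 a) +
        momentum G₁ (tangentLift φ z) (fderiv ℝ (fderiv ℝ φ) z.1 X.1 a) := by
    intro X a
    have h3 : HasFDerivAt (fun z => momentum G₀ z a) _ z :=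
      ((hasFDerivAt_momentum hG₀).differentiableAt.hasFDerivAt).clm_apply (hasFDerivAt_const a z)
    have h4 : HasFDerivAt (fun z : E × E => momentum G₁ (tangentLift φ z) (fderiv ℝ φ z.1 a)) _ z :=
      (hP₁.comp z hT).clm_apply ((h2.comp z hasFDerivAt_fst).clm_apply (hasFDerivAt_const a z))
    have h5 : (fun z : E × E => momentum G₁ (tangentLift φ z) (fderiv ℝ φ z.1 a)) =ᶠ[𝓝 z]
        fun z => momentum G₀ z a := by
      filter_upwards [continuous_fst.continuousAt.eventually hG] with w hw
      exact (hw _ _).symm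
    have h6 := congrArg (fun A => A X) (h3.unique (h4.congr_of_eventuallyEq h5.symm))
    rw [hT.fderiv]
    simp only [add_apply, ContinuousLinearMap.comp_apply,
      zero_apply, map_zero, ContinuousLinearMap.flip_apply,
      zero_add] at h6
    rw [h6]
    simp only [ContinuousLinearMap.coe_fst', Function.comp_def]
    rw [add_comm]
  have hs : IsSymmSndFDerivAt ℝ φ z.1 := hφ.isSymmSndFDerivAt (by simp)
  rw [sympl, sympl, key, key, fderiv_tangentLift_fst hφ, fderiv_tangentLift_fst hφ, hs X.1 Y.1]
  ring

theorem kinetic_tangentLift (hG : ∀ a b, G₀ z.1 a b = G₁ (φ z.1) (fderiv ℝ φ z.1 a)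
    (fderiv ℝ φ z.1 b)) : kinetic G₁ (tangentLift φ z) = kinetic G₀ z := by
  simp only [kinetic, tangentLift, hG]

/-- The geodesic field is characterised by `ω(S, ·) = -dH` together with the first component `u`.
Both `ω` and `H` are natural, hence so is the field. -/
theorem spray_tangentLift (hφ : ContDiffAt ℝ 2 φ z.1) (hsurj : Function.Surjective (fderiv ℝ φ z.1))
    (hG₀ : DifferentiableAt ℝ G₀ z.1) (hG₁ : DifferentiableAt ℝ G₁ (φ z.1))
    (hsymm₀ : ∀ a b, G₀ z.1 a b = G₀ z.1 b a)
    (hsymm₁ : ∀ a b, G₁ (φ z.1) a b = G₁ (φ z.1) b a)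
    (hinv₀ : (G₀ z.1).IsInvertible) (hinv₁ : (G₁ (φ z.1)).IsInvertible)
    (hG : ∀ᶠ y in 𝓝 z.1, ∀ a b, G₀ y a b = G₁ (φ y) (fderiv ℝ φ y a) (fderiv ℝ φ y b)) :
    fderiv ℝ (tangentLift φ) z (spray G₀ z) = spray G₁ (tangentLift φ z) := by
  have hT := hasFDerivAt_tangentLift hφ
  have h1 : (fderiv ℝ (tangentLift φ) z (spray G₀ z)).1 = (tangentLift φ z).2 :=
    fderiv_tangentLift_fst hφ _
  refine Prod.ext h1 ?_
  refine (eq_spray_iff (z := tangentLift φ z) hinv₁ _).2 fun b => ?_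
  -- By `sympl_add_fderiv_kinetic` the defect `ω(S, Y) + dH(Y)` depends only on `Y.1`, so
  -- pushforwards of vectors `(b, 0)` are enough to test the acceleration.
  obtain ⟨b, rfl⟩ := hsurj b
  have h2 := sympl_add_fderiv_kinetic (z := tangentLift φ z) hG₁ hsymm₁
    (fderiv ℝ (tangentLift φ) z (spray G₀ z)).2 (fderiv ℝ (tangentLift φ) z (b, 0))
  rw [← h1, Prod.mk.eta, sympl_tangentLift hφ hG₀ hG₁ hG, fderiv_tangentLift_fst hφ] at h2
  have h3 : fderiv ℝ (kinetic G₁) (tangentLift φ z) (fderiv ℝ (tangentLift φ) z (b, 0)) =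
      fderiv ℝ (kinetic G₀) z (b, 0) := by
    have h4 := (hasFDerivAt_kinetic (z := tangentLift φ z) hG₁ hsymm₁)
      |>.differentiableAt.hasFDerivAt.comp z hT.differentiableAt.hasFDerivAt
    have h5 : kinetic G₁ ∘ tangentLift φ =ᶠ[𝓝 z] kinetic G₀ := by
      filter_upwards [continuous_fst.continuousAt.eventually hG] with w hw
      exact kinetic_tangentLift hw
    have h6 := h4.unique
      ((hasFDerivAt_kinetic hG₀ hsymm₀).differentiableAt.hasFDerivAt.congr_of_eventuallyEq h5)
    exact congrArg (fun A => A (b, 0)) h6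
  rw [h3] at h2
  have h7 := sympl_add_fderiv_kinetic hG₀ hsymm₀ (spray G₀ z).2 (b, 0)
  have h8 := (eq_spray_iff hinv₀ _).1 rfl b
  rw [h8] at h7
  have h9 : sympl G₀ z (spray G₀ z) (b, 0) + fderiv ℝ (kinetic G₀) z (b, 0) = 0 := h7
  rw [h9] at h2
  rw [← h1]
  exact h2.symm

end ChangeOfCoordinates

/-! ### Exchange of time and space derivatives. -/

section Variations

variable {A B : Type*} [NormedAddCommGroup A] [NormedSpace ℝ A]
  [NormedAddCommGroup B] [NormedSpace ℝ B]

/-- The time derivative of the spatial derivative is the spatial derivative of the time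
derivative. -/
theorem hasDerivAt_fderiv_of_hasDerivAt {f h : A × ℝ → B} {z : A} {t : ℝ}
    (hf : ContDiffAt ℝ 2 f (z, t))
    (hfh : ∀ᶠ q in 𝓝 (z, t), HasDerivAt (fun s => f (q.1, s)) (h q) q.2) (X : A) :
    HasDerivAt (fun s => fderiv ℝ f (z, s) (X, 0)) (fderiv ℝ h (z, t) (X, 0)) t := by
  have h1 : HasFDerivAt (fderiv ℝ f) (fderiv ℝ (fderiv ℝ f) (z, t)) (z, t) :=
    ((hf.fderiv_right (m := 1) (by norm_num)).differentiableAt (by simp)).hasFDerivAt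
  have hpath : ∀ s : ℝ, HasDerivAt (fun s : ℝ => (z, s)) ((0 : A), (1 : ℝ)) s := fun s =>
    (hasDerivAt_const s z).prodMk (hasDerivAt_id s)
  have h2 : HasDerivAt (fun s => fderiv ℝ f (z, s) (X, 0))
      (fderiv ℝ (fderiv ℝ f) (z, t) (0, 1) (X, 0)) t := by
    have := (h1.comp_hasDerivAt t (hpath t)).clm_apply (hasDerivAt_const t ((X, 0) : A × ℝ))
    simpa using this
  have hdiff : ∀ᶠ q in 𝓝 (z, t), DifferentiableAt ℝ f q :=
    (hf.eventually (by simp)).mono fun q hq => hq.differentiableAt (by simp)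
  -- Near the point, `h` is the time component of the derivative of `f`. The claim therefore reduces
  -- to symmetry of the second derivative.
  have h3 : h =ᶠ[𝓝 (z, t)] fun q => fderiv ℝ f q (0, 1) := by
    filter_upwards [hfh, hdiff] with q hq hqd
    have h4 : HasDerivAt (fun s => f (q.1, s)) (fderiv ℝ f q (0, 1)) q.2 :=
      HasFDerivAt.comp_hasDerivAt (l := f) q.2 hqd.hasFDerivAt
        ((hasDerivAt_const q.2 q.1).prodMk (hasDerivAt_id q.2))
    exact hq.unique h4
  have h5 : fderiv ℝ h (z, t) (X, 0) = fderiv ℝ (fderiv ℝ f) (z, t) (X, 0) (0, 1) := by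
    rw [h3.fderiv_eq, (h1.clm_apply (hasFDerivAt_const ((0 : A), (1 : ℝ)) (z, t))).fderiv]
    simp
  have hs : IsSymmSndFDerivAt ℝ f (z, t) := hf.isSymmSndFDerivAt (by simp)
  rw [h5, hs (X, 0) (0, 1)]
  exact h2

theorem eq_of_hasDerivAt_zero_on_Ioo {f : ℝ → B} {ε : ℝ}
    (hf : ∀ t ∈ Ioo (-ε) ε, HasDerivAt f 0 t) {t : ℝ} (ht : t ∈ Ioo (-ε) ε) : f t = f 0 := by
  have hε : 0 < ε := by linarith [ht.1, ht.2]
  exact isOpen_Ioo.is_const_of_deriv_eq_zero isPreconnected_Ioo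
    (fun s hs => (hf s hs).differentiableAt.differentiableWithinAt)
    (fun s hs => (hf s hs).deriv) ht ⟨by linarith, hε⟩

end Variations

/-! ### The local geodesic flow in coordinates and its invariant forms. -/

section GeodesicFlowInCoordinates

variable {E : Type*} [NormedAddCommGroup E] [NormedSpace ℝ E]

/-- `Z : W × (-ε, ε) → U × E` is a local flow of the geodesic vector field of `G`. -/
structure IsLocalSprayFlow (G : E → E →L[ℝ] E →L[ℝ] ℝ) (U : Set E) (W : Set (E × E)) (ε : ℝ)
    (Z : (E × E) × ℝ → E × E) : Prop where
  isOpen_base : IsOpen U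
  contDiffOn_metric : ContDiffOn ℝ ∞ G U
  symm : ∀ y ∈ U, ∀ a b, G y a b = G y b a
  pos : ∀ y ∈ U, ∀ a, a ≠ 0 → 0 < G y a a
  isOpen_source : IsOpen W
  eps_pos : 0 < ε
  contDiffOn : ContDiffOn ℝ 2 Z (W ×ˢ Ioo (-ε) ε)
  map_zero : ∀ z ∈ W, Z (z, 0) = z
  mem : ∀ z ∈ W, ∀ t ∈ Ioo (-ε) ε, (Z (z, t)).1 ∈ U
  hasDerivAt : ∀ z ∈ W, ∀ t ∈ Ioo (-ε) ε,
    HasDerivAt (fun s => Z (z, s)) (spray G (Z (z, t))) t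

/-- Class `C²` is taken because the linearised equation along the flow uses its mixed second
derivatives. -/
theorem exists_isLocalSprayFlow [FiniteDimensional ℝ E] {G : E → E →L[ℝ] E →L[ℝ] ℝ} {U : Set E}
    (hU : IsOpen U) (hG : ContDiffOn ℝ ∞ G U) (hsymm : ∀ y ∈ U, ∀ a b, G y a b = G y b a)
    (hpos : ∀ y ∈ U, ∀ a, a ≠ 0 → 0 < G y a a) {z₀ : E × E} (hz₀ : z₀.1 ∈ U) :
    ∃ W ε Z, z₀ ∈ W ∧ IsLocalSprayFlow G U W ε Z := by
  obtain ⟨W, ε, Z, hW, hzW, hε, hZ, h⟩ := exists_contDiffOn_local_flow two_ne_zero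
    (hU.prod isOpen_univ) ((contDiffOn_spray hU hG hpos).of_le (by norm_cast))
    (z₀ := z₀) ⟨hz₀, mem_univ _⟩
  exact ⟨W, ε, Z, hzW, hU, hG, hsymm, hpos, hW, hε, hZ, fun z hz => (h z hz).1,
    fun z hz t ht => ((h z hz).2 t ht).1.1, fun z hz t ht => ((h z hz).2 t ht).2⟩

namespace IsLocalSprayFlow

variable {G : E → E →L[ℝ] E →L[ℝ] ℝ} {U : Set E} {W : Set (E × E)} {ε : ℝ}
  {Z : (E × E) × ℝ → E × E} {z : E × E} {t : ℝ}

theorem differentiableAt_metric (h : IsLocalSprayFlow G U W ε Z) {y : E} (hy : y ∈ U) :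
    DifferentiableAt ℝ G y :=
  (h.contDiffOn_metric.contDiffAt (h.isOpen_base.mem_nhds hy)).differentiableAt (by simp)

theorem eventually_mem (h : IsLocalSprayFlow G U W ε Z) (hz : z ∈ W) (ht : t ∈ Ioo (-ε) ε) :
    ∀ᶠ q in 𝓝 (z, t), q ∈ W ×ˢ Ioo (-ε) ε :=
  (h.isOpen_source.prod isOpen_Ioo).mem_nhds ⟨hz, ht⟩

theorem contDiffAt (h : IsLocalSprayFlow G U W ε Z) (hz : z ∈ W) (ht : t ∈ Ioo (-ε) ε) :
    ContDiffAt ℝ 2 Z (z, t) :=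
  h.contDiffOn.contDiffAt (h.eventually_mem hz ht)

/-- The differential of the flow with respect to the initial point. -/
def variation (Z : (E × E) × ℝ → E × E) (z : E × E) (t : ℝ) (X : E × E) : E × E :=
  fderiv ℝ Z (z, t) (X, 0)

theorem hasFDerivAt_space (h : IsLocalSprayFlow G U W ε Z) (hz : z ∈ W) (ht : t ∈ Ioo (-ε) ε) :
    HasFDerivAt (fun z => Z (z, t)) ((fderiv ℝ Z (z, t)).comp (.inl ℝ (E × E) ℝ)) z :=
  (((h.contDiffAt hz ht).differentiableAt (by simp)).hasFDerivAt).comp z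
    (hasFDerivAt_prodMk_left z t)

theorem variation_zero (h : IsLocalSprayFlow G U W ε Z) (hz : z ∈ W) (X : E × E) :
    variation Z z 0 X = X := by
  have h1 := h.hasFDerivAt_space hz ⟨by linarith [h.eps_pos], h.eps_pos⟩
  have h2 : (fun z => Z (z, (0 : ℝ))) =ᶠ[𝓝 z] id := by
    filter_upwards [h.isOpen_source.mem_nhds hz] with w hw using h.map_zero w hw
  exact congrArg (fun A => A X) (h1.unique ((hasFDerivAt_id z).congr_of_eventuallyEq h2))

theorem hasDerivAt_variation_fst (h : IsLocalSprayFlow G U W ε Z) (hz : z ∈ W)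
    (ht : t ∈ Ioo (-ε) ε) (X : E × E) :
    HasDerivAt (fun s => (variation Z z s X).1) (variation Z z t X).2 t := by
  have hd : ∀ s ∈ Ioo (-ε) ε, HasFDerivAt Z (fderiv ℝ Z (z, s)) (z, s) := fun s hs =>
    ((h.contDiffAt hz hs).differentiableAt (by simp)).hasFDerivAt
  have h1 := hasDerivAt_fderiv_of_hasDerivAt (f := fun q => (Z q).1) (h := fun q => (Z q).2)
    (contDiffAt_fst.comp _ (h.contDiffAt hz ht)) (by
      filter_upwards [h.eventually_mem hz ht] with q hq
      exact (ContinuousLinearMap.fst ℝ E E).hasFDerivAt.comp_hasDerivAt _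
        (h.hasDerivAt q.1 hq.1 q.2 hq.2)) X
  have h2 : fderiv ℝ (fun q => (Z q).2) (z, t) (X, 0) = (variation Z z t X).2 := by
    rw [(hd t ht).snd.fderiv]
    rfl
  rw [h2] at h1
  refine h1.congr_of_eventuallyEq ?_
  filter_upwards [isOpen_Ioo.mem_nhds ht] with s hs
  rw [(hd s hs).fst.fderiv]
  rfl

/-- This is the Euler–Lagrange equation `ṗ = ∂L/∂y` for `L = kinetic G`, with `p = momentum G` and
`∂L/∂y = force G`. -/
theorem fderiv_momentum_spray [FiniteDimensional ℝ E] (h : IsLocalSprayFlow G U W ε Z)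
    (hz : z.1 ∈ U) : fderiv ℝ (momentum G) z (spray G z) = force G z := by
  ext b
  rw [fderiv_momentum_apply (h.differentiableAt_metric hz),
    metric_spray_snd (isInvertible_of_posDef (h.pos _ hz))]
  simp [spray]

theorem contDiffAt_momentum (h : IsLocalSprayFlow G U W ε Z) (hz : z.1 ∈ U) :
    ContDiffAt ℝ ∞ (momentum G) z :=
  ((h.contDiffOn_metric.contDiffAt (h.isOpen_base.mem_nhds hz)).comp z
    contDiffAt_fst).clm_apply contDiffAt_snd

theorem contDiffAt_kinetic (h : IsLocalSprayFlow G U W ε Z) (hz : z.1 ∈ U) :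
    ContDiffAt ℝ ∞ (kinetic G) z :=
  contDiffAt_const.mul ((h.contDiffAt_momentum hz).clm_apply contDiffAt_snd)

theorem fderiv_kinetic_inl (h : IsLocalSprayFlow G U W ε Z) (hz : z.1 ∈ U) :
    (fderiv ℝ (kinetic G) z).comp (.inl ℝ E E) = force G z := by
  ext b
  have := fderiv_kinetic_apply (h.differentiableAt_metric hz) (h.symm _ hz) (b, 0)
  simpa using this

theorem fderiv_kinetic_inr (h : IsLocalSprayFlow G U W ε Z) (hz : z.1 ∈ U) :
    (fderiv ℝ (kinetic G) z).comp (.inr ℝ E E) = momentum G z := by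
  ext b
  have := fderiv_kinetic_apply (h.differentiableAt_metric hz) (h.symm _ hz) (0, b)
  simpa using this

theorem eventually_base_mem (h : IsLocalSprayFlow G U W ε Z) (hz : z.1 ∈ U) :
    ∀ᶠ w in 𝓝 z, w.1 ∈ U :=
  continuous_fst.continuousAt.eventually (h.isOpen_base.mem_nhds hz)

/-- Conservation of energy. The time derivative is `force(u) + G(u, a)` with `G(a, ·) = force -
∂_uG(u, ·)`; since `force(u) = ½ ∂_uG(u, u)`, everything cancels. -/
theorem kinetic_const [FiniteDimensional ℝ E] (h : IsLocalSprayFlow G U W ε Z) (hz : z ∈ W)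
    (ht : t ∈ Ioo (-ε) ε) : kinetic G (Z (z, t)) = kinetic G z := by
  have h1 : ∀ t ∈ Ioo (-ε) ε, HasDerivAt (fun s => kinetic G (Z (z, s))) 0 t := by
    intro t ht
    have hU := h.mem z hz t ht
    have h2 := (((h.contDiffAt_kinetic hU).differentiableAt (by simp)).hasFDerivAt).comp_hasDerivAt
      t (h.hasDerivAt z hz t ht)
    refine h2.congr_deriv ?_
    rw [fderiv_kinetic_apply (h.differentiableAt_metric hU) (h.symm _ hU), momentum,
      h.symm _ hU _ (spray G (Z (z, t))).2, metric_spray_snd (isInvertible_of_posDef (h.pos _ hU)),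
      sub_apply, force_apply]
    simp only [spray, force_apply]
    ring
  rw [eq_of_hasDerivAt_zero_on_Ioo h1 ht, h.map_zero z hz]

/-- The linearisation of `ṗ = ∂L/∂y` along a variation: its right-hand side is the position part of
the Hessian of the kinetic energy. Together with `fderiv_momentum_eq`, which gives the velocity
part, it makes the Hessian appear whole in the derivative of `sympl`. -/
theorem hasDerivAt_momentum_variation [FiniteDimensional ℝ E] (h : IsLocalSprayFlow G U W ε Z)
    (hz : z ∈ W) (ht : t ∈ Ioo (-ε) ε) (X : E × E) :
    HasDerivAt (fun s => fderiv ℝ (momentum G) (Z (z, s)) (variation Z z s X))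
      ((fderiv ℝ (fderiv ℝ (kinetic G)) (Z (z, t)) (variation Z z t X)).comp (.inl ℝ E E)) t := by
  have hd : ∀ s ∈ Ioo (-ε) ε, HasFDerivAt Z (fderiv ℝ Z (z, s)) (z, s) := fun s hs =>
    ((h.contDiffAt hz hs).differentiableAt (by simp)).hasFDerivAt
  have hm : ∀ w : E × E, w.1 ∈ U → HasFDerivAt (momentum G) (fderiv ℝ (momentum G) w) w :=
    fun w hw => ((h.contDiffAt_momentum hw).differentiableAt (by simp)).hasFDerivAt
  have h1 := hasDerivAt_fderiv_of_hasDerivAt (f := fun q => momentum G (Z q))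
    (h := fun q => force G (Z q))
    (((h.contDiffAt_momentum (h.mem z hz t ht)).of_le (by norm_cast)).comp (z, t)
      (h.contDiffAt hz ht)) (by
      filter_upwards [h.eventually_mem hz ht] with q hq
      have hU := h.mem q.1 hq.1 q.2 hq.2
      rw [← h.fderiv_momentum_spray hU]
      exact (hm _ hU).comp_hasDerivAt _ (h.hasDerivAt q.1 hq.1 q.2 hq.2)) X
  have hU := h.mem z hz t ht
  have h2 : HasFDerivAt (force G) (((ContinuousLinearMap.compL ℝ E (E × E) ℝ).flip
      (.inl ℝ E E)).comp (fderiv ℝ (fderiv ℝ (kinetic G)) (Z (z, t)))) (Z (z, t)) := by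
    have h3 : HasFDerivAt (fderiv ℝ (kinetic G)) (fderiv ℝ (fderiv ℝ (kinetic G)) (Z (z, t)))
        (Z (z, t)) := (((h.contDiffAt_kinetic hU).fderiv_right (m := 1)
          (by norm_cast)).differentiableAt (by simp)).hasFDerivAt
    have h4 := ((ContinuousLinearMap.compL ℝ E (E × E) ℝ).flip
      (.inl ℝ E E)).hasFDerivAt.comp (Z (z, t)) h3
    refine h4.congr_of_eventuallyEq ?_
    filter_upwards [h.eventually_base_mem hU] with w hw
    exact (h.fderiv_kinetic_inl hw).symm
  have h5 := (h2.comp (z, t) (hd t ht)).fderiv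
  rw [show (fun q => force G (Z q)) = force G ∘ Z from rfl, h5] at h1
  refine h1.congr_of_eventuallyEq ?_
  filter_upwards [isOpen_Ioo.mem_nhds ht] with s hs
  change _ = fderiv ℝ (momentum G ∘ Z) (z, s) (X, 0)
  rw [((hm _ (h.mem z hz s hs)).comp (z, s) (hd s hs)).fderiv]
  rfl

theorem fderiv_momentum_eq (h : IsLocalSprayFlow G U W ε Z) (hz : z.1 ∈ U) (X : E × E) (b : E) :
    fderiv ℝ (momentum G) z X b = fderiv ℝ (fderiv ℝ (kinetic G)) z X (0, b) := by
  have h3 : HasFDerivAt (fderiv ℝ (kinetic G)) (fderiv ℝ (fderiv ℝ (kinetic G)) z) z :=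
    (((h.contDiffAt_kinetic hz).fderiv_right (m := 1)
      (by norm_cast)).differentiableAt (by simp)).hasFDerivAt
  have h4 := ((ContinuousLinearMap.compL ℝ E (E × E) ℝ).flip
    (.inr ℝ E E)).hasFDerivAt.comp z h3
  have h5 : HasFDerivAt (momentum G) _ z := h4.congr_of_eventuallyEq (by
    filter_upwards [h.eventually_base_mem hz] with w hw
    exact (h.fderiv_kinetic_inr hw).symm)
  rw [h5.fderiv]
  rfl

/-- The geodesic flow preserves the symplectic form. -/
theorem sympl_variation [FiniteDimensional ℝ E] (h : IsLocalSprayFlow G U W ε Z)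
    (hz : z ∈ W) (ht : t ∈ Ioo (-ε) ε) (X Y : E × E) :
    sympl G (Z (z, t)) (variation Z z t X) (variation Z z t Y) = sympl G z X Y := by
  have h1 : ∀ t ∈ Ioo (-ε) ε, HasDerivAt
      (fun t => sympl G (Z (z, t)) (variation Z z t X) (variation Z z t Y)) 0 t := by
    intro t ht
    have hU := h.mem z hz t ht
    have h2 := ((h.hasDerivAt_momentum_variation hz ht X).clm_apply
      (h.hasDerivAt_variation_fst hz ht Y)).sub ((h.hasDerivAt_momentum_variation hz ht Y).clm_apply
      (h.hasDerivAt_variation_fst hz ht X))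
    -- The position and velocity parts add up to `D²L(X, Y) - D²L(Y, X)`, which vanishes by symmetry
    -- of the Hessian.
    refine h2.congr_deriv ?_
    rw [h.fderiv_momentum_eq hU, h.fderiv_momentum_eq hU]
    have hs : IsSymmSndFDerivAt ℝ (kinetic G) (Z (z, t)) :=
      (h.contDiffAt_kinetic hU).isSymmSndFDerivAt (by simp; norm_cast)
    have h3 : ∀ X Y : E × E, fderiv ℝ (fderiv ℝ (kinetic G)) (Z (z, t)) X (Y.1, 0) +
        fderiv ℝ (fderiv ℝ (kinetic G)) (Z (z, t)) X (0, Y.2) =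
        fderiv ℝ (fderiv ℝ (kinetic G)) (Z (z, t)) X Y := by
      intro X Y
      rw [← map_add]
      simp
    simp only [ContinuousLinearMap.comp_apply, ContinuousLinearMap.inl_apply, h3]
    rw [hs (variation Z z t X) (variation Z z t Y), sub_self]
  have := eq_of_hasDerivAt_zero_on_Ioo h1 ht
  simp only [h.variation_zero hz, h.map_zero z hz] at this
  exact this

/-- The geodesic flow preserves the Liouville form on vectors tangent to the energy levels. -/
theorem momentum_variation [FiniteDimensional ℝ E] (h : IsLocalSprayFlow G U W ε Z)
    (hz : z ∈ W) (ht : t ∈ Ioo (-ε) ε) {X : E × E} (hX : fderiv ℝ (kinetic G) z X = 0) :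
    momentum G (Z (z, t)) (variation Z z t X).1 = momentum G z X.1 := by
  have h1 : ∀ t ∈ Ioo (-ε) ε, HasDerivAt
      (fun t => momentum G (Z (z, t)) (variation Z z t X).1) 0 t := by
    intro t ht
    have hU := h.mem z hz t ht
    have hm : HasFDerivAt (momentum G) (fderiv ℝ (momentum G) (Z (z, t))) (Z (z, t)) :=
      ((h.contDiffAt_momentum hU).differentiableAt (by simp)).hasFDerivAt
    have h0 : HasDerivAt (fun s => momentum G (Z (z, s)))
        (fderiv ℝ (momentum G) (Z (z, t)) (spray G (Z (z, t)))) t :=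
      HasFDerivAt.comp_hasDerivAt (l := momentum G) (f := fun s => Z (z, s)) t hm
        (h.hasDerivAt z hz t ht)
    have h2 := h0.clm_apply (h.hasDerivAt_variation_fst hz ht X)
    -- Conservation of energy keeps the variation tangent to energy levels. The derivative of
    -- `p(X.1)` in time is `force(X.1) + p(X.2)`, which is the differential of the kinetic energy on
    -- the variation.
    have h3 : fderiv ℝ (kinetic G) (Z (z, t)) (variation Z z t X) = 0 := by
      have h4 := (((h.contDiffAt_kinetic hU).differentiableAt
        (by simp)).hasFDerivAt).comp z (h.hasFDerivAt_space hz ht)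
      have h5 : HasFDerivAt (kinetic G) (fderiv ℝ (kinetic G) z) z := by
        have hz0 : z.1 ∈ U := by
          have := h.mem z hz 0 ⟨by linarith [h.eps_pos], h.eps_pos⟩
          rwa [h.map_zero z hz] at this
        exact ((h.contDiffAt_kinetic hz0).differentiableAt (by simp)).hasFDerivAt
      have h6 : kinetic G ∘ (fun z => Z (z, t)) =ᶠ[𝓝 z] kinetic G := by
        filter_upwards [h.isOpen_source.mem_nhds hz] with w hw using h.kinetic_const hw ht
      rw [← hX, ← h4.unique (h5.congr_of_eventuallyEq h6)]
      rfl
    rw [fderiv_kinetic_apply (h.differentiableAt_metric hU) (h.symm _ hU)] at h3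
    rw [h.fderiv_momentum_spray hU, h3] at h2
    exact h2
  have := eq_of_hasDerivAt_zero_on_Ioo h1 ht
  simp only [h.variation_zero hz, h.map_zero z hz] at this
  exact this

end IsLocalSprayFlow

end GeodesicFlowInCoordinates

/-! ### Natural charts of the tangent bundle and the metric in coordinates. -/

section Manifold

variable {d : ℕ} {M : Type*} [TopologicalSpace M] [ChartedSpace (EucModel d) M]
  [IsManifold (𝓡 (d + 1)) ∞ M]

theorem mem_extChartAt_tangent_source {w₀ w : TangentBundle (𝓡 (d + 1)) M} :
    w ∈ (extChartAt (𝓡 (d + 1)).tangent w₀).source ↔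
      w.1 ∈ (extChartAt (𝓡 (d + 1)) w₀.1).source := by
  rw [extChartAt_source, extChartAt_source, TangentBundle.mem_chart_source_iff]

theorem mem_extChartAt_tangent_target {w₀ : TangentBundle (𝓡 (d + 1)) M}
    {z : EucModel d × EucModel d} :
    z ∈ (extChartAt (𝓡 (d + 1)).tangent w₀).target ↔
      z.1 ∈ (extChartAt (𝓡 (d + 1)) w₀.1).target := by
  rw [extChartAt_target, extChartAt_target]
  simp only [ModelWithCorners.range_eq_univ, inter_univ, mem_preimage]
  exact TangentBundle.mem_chart_target_iff _ _

theorem extChartAt_tangent_apply {w₀ w : TangentBundle (𝓡 (d + 1)) M}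
    (hw : w.1 ∈ (extChartAt (𝓡 (d + 1)) w₀.1).source) :
    extChartAt (𝓡 (d + 1)).tangent w₀ w = (extChartAt (𝓡 (d + 1)) w₀.1 w.1,
      mfderiv (𝓡 (d + 1)) 𝓘(ℝ, EucModel d) (extChartAt (𝓡 (d + 1)) w₀.1) w.1 w.2) := by
  rw [extChartAt_source] at hw
  rw [← TangentBundle.continuousLinearMapAt_trivializationAt hw]
  refine Prod.ext rfl ?_
  exact (congrFun (Trivialization.coe_linearMapAt_of_mem (R := ℝ)
    (trivializationAt (EucModel d) (TangentSpace (𝓡 (d + 1)) : M → Type _) w₀.1) hw) w.2).symm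

theorem extChartAt_tangent_symm_apply {w₀ : TangentBundle (𝓡 (d + 1)) M}
    {z : EucModel d × EucModel d} (hz : z.1 ∈ (extChartAt (𝓡 (d + 1)) w₀.1).target) :
    (extChartAt (𝓡 (d + 1)).tangent w₀).symm z = ⟨(extChartAt (𝓡 (d + 1)) w₀.1).symm z.1,
      mfderiv 𝓘(ℝ, EucModel d) (𝓡 (d + 1)) (extChartAt (𝓡 (d + 1)) w₀.1).symm z.1 z.2⟩ := by
  have h1 := mem_extChartAt_tangent_target.2 hz
  have h2 := (extChartAt (𝓡 (d + 1)) w₀.1).map_target hz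
  refine (extChartAt (𝓡 (d + 1)).tangent w₀).injOn
    ((extChartAt (𝓡 (d + 1)).tangent w₀).map_target h1) (mem_extChartAt_tangent_source.2 h2) ?_
  rw [(extChartAt (𝓡 (d + 1)).tangent w₀).right_inv h1, extChartAt_tangent_apply h2]
  have h3 := mfderiv_extChartAt_comp_mfderivWithin_extChartAt_symm (I := 𝓡 (d + 1)) hz
  rw [ModelWithCorners.range_eq_univ, mfderivWithin_univ] at h3
  refine Prod.ext ((extChartAt (𝓡 (d + 1)) w₀.1).right_inv hz).symm ?_
  exact (congrArg (fun A => A z.2) h3).symm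

/-- The pullback of a bilinear form under a linear map from a finite-dimensional space. -/
def pullbackForm {E T : Type*} [NormedAddCommGroup E] [NormedSpace ℝ E] [FiniteDimensional ℝ E]
    [AddCommGroup T] [Module ℝ T] [TopologicalSpace T] [IsTopologicalAddGroup T]
    [ContinuousSMul ℝ T] (B : T →L[ℝ] T →L[ℝ] ℝ) (A : E →L[ℝ] T) : E →L[ℝ] E →L[ℝ] ℝ :=
  LinearMap.toContinuousLinearMap (LinearMap.toContinuousLinearMap.toLinearMap ∘ₗ
    LinearMap.mk₂ ℝ (fun a b => B (A a) (A b)) (by intros; simp) (by intros; simp)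
      (by intros; simp) (by intros; simp))

/-- The metric in the preferred chart at `x₀`, as a family of continuous bilinear forms. -/
def coordMetric (g : SmoothMetric d M) (x₀ : M) (y : EucModel d) :
    EucModel d →L[ℝ] EucModel d →L[ℝ] ℝ :=
  pullbackForm (g.inner ((extChartAt (𝓡 (d + 1)) x₀).symm y))
    (mfderiv 𝓘(ℝ, EucModel d) (𝓡 (d + 1)) (extChartAt (𝓡 (d + 1)) x₀).symm y)

theorem coordMetric_apply (g : SmoothMetric d M) (x₀ : M) (y a b : EucModel d) :
    coordMetric g x₀ y a b = chartMetric g x₀ y a b := rfl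

theorem coordMetric_symm (g : SmoothMetric d M) (x₀ : M) (y a b : EucModel d) :
    coordMetric g x₀ y a b = coordMetric g x₀ y b a := g.symm _ _ _

theorem mfderiv_symm_injective {x₀ : M} {y : EucModel d}
    (hy : y ∈ (extChartAt (𝓡 (d + 1)) x₀).target) : Function.Injective
      (mfderiv 𝓘(ℝ, EucModel d) (𝓡 (d + 1)) (extChartAt (𝓡 (d + 1)) x₀).symm y) := by
  have h3 := mfderiv_extChartAt_comp_mfderivWithin_extChartAt_symm (I := 𝓡 (d + 1)) hy
  rw [ModelWithCorners.range_eq_univ, mfderivWithin_univ] at h3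
  intro a b hab
  have ha := congrArg (fun A => A a) h3
  have hb := congrArg (fun A => A b) h3
  simp only [ContinuousLinearMap.comp_apply] at ha hb
  rw [hab] at ha
  exact ha.symm.trans hb

theorem coordMetric_pos (g : SmoothMetric d M) {x₀ : M} {y : EucModel d}
    (hy : y ∈ (extChartAt (𝓡 (d + 1)) x₀).target) {a : EucModel d} (ha : a ≠ 0) :
    0 < coordMetric g x₀ y a a :=
  g.pos _ _ ((map_ne_zero_iff _ (mfderiv_symm_injective hy)).2 ha)

theorem sqLen_extChartAt_symm (g : SmoothMetric d M) {w₀ : TangentBundle (𝓡 (d + 1)) M}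
    {z : EucModel d × EucModel d} (hz : z.1 ∈ (extChartAt (𝓡 (d + 1)) w₀.1).target) :
    sqLen g ((extChartAt (𝓡 (d + 1)).tangent w₀).symm z) = coordMetric g w₀.1 z.1 z.2 z.2 := by
  rw [extChartAt_tangent_symm_apply hz]
  rfl

/-- Smoothness of the quadratic form is that of `sqLen` in a natural chart of `TM`; polarisation
passes to the bilinear form. -/
theorem contDiffOn_coordMetric (g : SmoothMetric d M) (x₀ : M) :
    ContDiffOn ℝ ∞ (coordMetric g x₀) (extChartAt (𝓡 (d + 1)) x₀).target := by
  set w₀ : TangentBundle (𝓡 (d + 1)) M := ⟨x₀, 0⟩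
  have h1 : ContDiffOn ℝ ∞ (sqLen g ∘ (extChartAt (𝓡 (d + 1)).tangent w₀).symm)
      (extChartAt (𝓡 (d + 1)).tangent w₀).target := by
    rw [← contMDiffOn_iff_contDiffOn]
    exact (contMDiff_sqLen g).comp_contMDiffOn (contMDiffOn_extChartAt_symm w₀)
  have hq : ∀ a : EucModel d, ContDiffOn ℝ ∞ (fun y => coordMetric g x₀ y a a)
      (extChartAt (𝓡 (d + 1)) x₀).target := by
    intro a
    have h2 : ContDiffOn ℝ ∞ (fun y : EucModel d => (y, a)) (extChartAt (𝓡 (d + 1)) x₀).target :=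
      contDiffOn_id.prodMk contDiffOn_const
    refine (h1.comp h2 fun y hy => mem_extChartAt_tangent_target.2 hy).congr fun y hy => ?_
    exact (sqLen_extChartAt_symm (w₀ := w₀) (z := (y, a)) g hy).symm
  refine contDiffOn_clm_apply.2 fun a => contDiffOn_clm_apply.2 fun b => ?_
  have h3 : (fun y => coordMetric g x₀ y a b) = fun y => (1 / 2 : ℝ) *
      (coordMetric g x₀ y (a + b) (a + b) - coordMetric g x₀ y a a - coordMetric g x₀ y b b) := by
    funext y
    simp only [map_add, add_apply, coordMetric_symm g x₀ y b a]
    ring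
  rw [h3]
  exact contDiffOn_const.mul (((hq (a + b)).sub (hq a)).sub (hq b))

/-- The change of coordinates between two preferred charts. -/
def transition (x₀ x₁ : M) : EucModel d → EucModel d :=
  extChartAt (𝓡 (d + 1)) x₁ ∘ (extChartAt (𝓡 (d + 1)) x₀).symm

theorem contMDiffAt_symm {x₀ : M} {y : EucModel d}
    (hy : y ∈ (extChartAt (𝓡 (d + 1)) x₀).target) :
    ContMDiffAt 𝓘(ℝ, EucModel d) (𝓡 (d + 1)) ∞ (extChartAt (𝓡 (d + 1)) x₀).symm y :=
  (contMDiffOn_extChartAt_symm x₀).contMDiffAt ((isOpen_extChartAt_target x₀).mem_nhds hy)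

theorem contMDiffAt_chart {x₀ x : M} (hx : x ∈ (extChartAt (𝓡 (d + 1)) x₀).source) :
    ContMDiffAt (𝓡 (d + 1)) 𝓘(ℝ, EucModel d) ∞ (extChartAt (𝓡 (d + 1)) x₀) x :=
  contMDiffAt_extChartAt' (by rwa [extChartAt_source] at hx)

theorem contDiffAt_transition {x₀ x₁ : M} {y : EucModel d}
    (hy : y ∈ (extChartAt (𝓡 (d + 1)) x₀).target)
    (hy' : (extChartAt (𝓡 (d + 1)) x₀).symm y ∈ (extChartAt (𝓡 (d + 1)) x₁).source) :
    ContDiffAt ℝ ∞ (transition x₀ x₁) y :=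
  ((contMDiffAt_chart hy').comp y (contMDiffAt_symm hy)).contDiffAt

theorem fderiv_transition {x₀ x₁ : M} {y : EucModel d}
    (hy : y ∈ (extChartAt (𝓡 (d + 1)) x₀).target)
    (hy' : (extChartAt (𝓡 (d + 1)) x₀).symm y ∈ (extChartAt (𝓡 (d + 1)) x₁).source)
    (a : EucModel d) :
    fderiv ℝ (transition x₀ x₁) y a = mfderiv (𝓡 (d + 1)) 𝓘(ℝ, EucModel d)
      (extChartAt (𝓡 (d + 1)) x₁) ((extChartAt (𝓡 (d + 1)) x₀).symm y)
        (mfderiv 𝓘(ℝ, EucModel d) (𝓡 (d + 1)) (extChartAt (𝓡 (d + 1)) x₀).symm y a) := by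
  rw [← mfderiv_eq_fderiv, transition, mfderiv_comp y
    ((contMDiffAt_chart hy').mdifferentiableAt (by simp))
    ((contMDiffAt_symm hy).mdifferentiableAt (by simp))]
  rfl

theorem tangentLift_transition {w₀ w₁ : TangentBundle (𝓡 (d + 1)) M}
    {z : EucModel d × EucModel d} (hz : z.1 ∈ (extChartAt (𝓡 (d + 1)) w₀.1).target)
    (hz' : (extChartAt (𝓡 (d + 1)) w₀.1).symm z.1 ∈ (extChartAt (𝓡 (d + 1)) w₁.1).source) :
    tangentLift (transition w₀.1 w₁.1) z = extChartAt (𝓡 (d + 1)).tangent w₁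
      ((extChartAt (𝓡 (d + 1)).tangent w₀).symm z) := by
  rw [extChartAt_tangent_symm_apply hz, extChartAt_tangent_apply hz', tangentLift,
    fderiv_transition hz hz']
  rfl

/-- Both sides compute the squared length of the same tangent vector when `a = b`; polarisation
gives the general case. -/
theorem coordMetric_transition (g : SmoothMetric d M) {x₀ x₁ : M} {y : EucModel d}
    (hy : y ∈ (extChartAt (𝓡 (d + 1)) x₀).target)
    (hy' : (extChartAt (𝓡 (d + 1)) x₀).symm y ∈ (extChartAt (𝓡 (d + 1)) x₁).source)
    (a b : EucModel d) : coordMetric g x₀ y a b = coordMetric g x₁ (transition x₀ x₁ y)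
      (fderiv ℝ (transition x₀ x₁) y a) (fderiv ℝ (transition x₀ x₁) y b) := by
  set w₀ : TangentBundle (𝓡 (d + 1)) M := ⟨x₀, 0⟩
  set w₁ : TangentBundle (𝓡 (d + 1)) M := ⟨x₁, 0⟩
  have hq : ∀ a, coordMetric g x₀ y a a = coordMetric g x₁ (transition x₀ x₁ y)
      (fderiv ℝ (transition x₀ x₁) y a) (fderiv ℝ (transition x₀ x₁) y a) := by
    intro a
    have h1 := sqLen_extChartAt_symm (w₀ := w₀) (z := (y, a)) g hy
    have h2 := sqLen_extChartAt_symm (w₀ := w₁) (z := tangentLift (transition x₀ x₁) (y, a)) g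
      ((extChartAt (𝓡 (d + 1)) x₁).map_source hy')
    rw [tangentLift_transition (w₀ := w₀) (w₁ := w₁) (z := (y, a)) hy hy',
      (extChartAt (𝓡 (d + 1)).tangent w₁).left_inv (mem_extChartAt_tangent_source.2 hy'), h1,
      ← tangentLift_transition (w₀ := w₀) (w₁ := w₁) (z := (y, a)) hy hy'] at h2
    exact h2
  have h1 := hq (a + b)
  simp only [map_add, add_apply] at h1
  rw [← hq a, ← hq b, coordMetric_symm g x₀ y b a, coordMetric_symm g x₁ _ (fderiv ℝ _ y b)] at h1
  linarith

/-- The reverse transition is a local right inverse, so the chain rule gives a right inverse of the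
differential. -/
theorem surjective_fderiv_transition {x₀ x₁ : M} {y : EucModel d}
    (hy : y ∈ (extChartAt (𝓡 (d + 1)) x₀).target)
    (hy' : (extChartAt (𝓡 (d + 1)) x₀).symm y ∈ (extChartAt (𝓡 (d + 1)) x₁).source) :
    Function.Surjective (fderiv ℝ (transition x₀ x₁) y) := by
  set p := (extChartAt (𝓡 (d + 1)) x₀).symm y with hp
  have hpy : extChartAt (𝓡 (d + 1)) x₀ p = y := (extChartAt (𝓡 (d + 1)) x₀).right_inv hy
  have hps : p ∈ (extChartAt (𝓡 (d + 1)) x₀).source := (extChartAt (𝓡 (d + 1)) x₀).map_target hy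
  set y₁ := extChartAt (𝓡 (d + 1)) x₁ p with hy₁
  have hy₁t : y₁ ∈ (extChartAt (𝓡 (d + 1)) x₁).target := (extChartAt (𝓡 (d + 1)) x₁).map_source hy'
  have hy₁p : (extChartAt (𝓡 (d + 1)) x₁).symm y₁ = p := (extChartAt (𝓡 (d + 1)) x₁).left_inv hy'
  have h1 : HasFDerivAt (transition x₀ x₁) (fderiv ℝ (transition x₀ x₁) y)
      (transition x₁ x₀ y₁) := by
    have : transition x₁ x₀ y₁ = y := by simp only [transition, Function.comp, hy₁p, hpy]
    rw [this]
    exact ((contDiffAt_transition hy hy').differentiableAt (by simp)).hasFDerivAt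
  have h2 : HasFDerivAt (transition x₁ x₀) (fderiv ℝ (transition x₁ x₀) y₁) y₁ :=
    ((contDiffAt_transition hy₁t (by rwa [hy₁p])).differentiableAt (by simp)).hasFDerivAt
  have h3 : transition x₀ x₁ ∘ transition x₁ x₀ =ᶠ[𝓝 y₁] id := by
    have hc : ContinuousAt (extChartAt (𝓡 (d + 1)) x₁).symm y₁ :=
      (contMDiffAt_symm hy₁t).continuousAt
    have hm : (extChartAt (𝓡 (d + 1)) x₀).source ∈ 𝓝 ((extChartAt (𝓡 (d + 1)) x₁).symm y₁) := by
      rw [hy₁p]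
      exact (isOpen_extChartAt_source x₀).mem_nhds hps
    filter_upwards [hc.eventually hm, (isOpen_extChartAt_target x₁).mem_nhds hy₁t] with u hu hu'
    simp only [transition, Function.comp, id]
    rw [(extChartAt (𝓡 (d + 1)) x₀).left_inv hu, (extChartAt (𝓡 (d + 1)) x₁).right_inv hu']
  have h4 := (h1.comp y₁ h2).unique ((hasFDerivAt_id y₁).congr_of_eventuallyEq h3)
  intro b
  exact ⟨fderiv ℝ (transition x₁ x₀) y₁ b, congrArg (fun A => A b) h4⟩

theorem eventually_transition {x₀ x₁ : M} {y : EucModel d}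
    (hy : y ∈ (extChartAt (𝓡 (d + 1)) x₀).target)
    (hy' : (extChartAt (𝓡 (d + 1)) x₀).symm y ∈ (extChartAt (𝓡 (d + 1)) x₁).source) :
    ∀ᶠ u in 𝓝 y, u ∈ (extChartAt (𝓡 (d + 1)) x₀).target ∧
      (extChartAt (𝓡 (d + 1)) x₀).symm u ∈ (extChartAt (𝓡 (d + 1)) x₁).source :=
  Filter.Eventually.and ((isOpen_extChartAt_target x₀).mem_nhds hy)
    ((contMDiffAt_symm hy).continuousAt.eventually ((isOpen_extChartAt_source x₁).mem_nhds hy'))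

theorem differentiableAt_coordMetric (g : SmoothMetric d M) {x₀ : M} {y : EucModel d}
    (hy : y ∈ (extChartAt (𝓡 (d + 1)) x₀).target) : DifferentiableAt ℝ (coordMetric g x₀) y :=
  ((contDiffOn_coordMetric g x₀).contDiffAt
    ((isOpen_extChartAt_target x₀).mem_nhds hy)).differentiableAt (by simp)

theorem isInvertible_coordMetric (g : SmoothMetric d M) {x₀ : M} {y : EucModel d}
    (hy : y ∈ (extChartAt (𝓡 (d + 1)) x₀).target) : (coordMetric g x₀ y).IsInvertible :=
  isInvertible_of_posDef fun _ ha => coordMetric_pos g hy ha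

theorem spray_transition (g : SmoothMetric d M) {x₀ x₁ : M} {z : EucModel d × EucModel d}
    (hz : z.1 ∈ (extChartAt (𝓡 (d + 1)) x₀).target)
    (hz' : (extChartAt (𝓡 (d + 1)) x₀).symm z.1 ∈ (extChartAt (𝓡 (d + 1)) x₁).source) :
    fderiv ℝ (tangentLift (transition x₀ x₁)) z (spray (coordMetric g x₀) z) =
      spray (coordMetric g x₁) (tangentLift (transition x₀ x₁) z) := by
  have ht : transition x₀ x₁ z.1 ∈ (extChartAt (𝓡 (d + 1)) x₁).target :=
    (extChartAt (𝓡 (d + 1)) x₁).map_source hz'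
  refine spray_tangentLift ((contDiffAt_transition hz hz').of_le (by norm_cast))
    (surjective_fderiv_transition hz hz') (differentiableAt_coordMetric g hz)
    (differentiableAt_coordMetric g ht) (coordMetric_symm g _ _) (coordMetric_symm g _ _)
    (isInvertible_coordMetric g hz) (isInvertible_coordMetric g ht) ?_
  filter_upwards [eventually_transition hz hz'] with u hu a b
  exact coordMetric_transition g hu.1 hu.2 a b

theorem sympl_transition (g : SmoothMetric d M) {x₀ x₁ : M} {z : EucModel d × EucModel d}
    (hz : z.1 ∈ (extChartAt (𝓡 (d + 1)) x₀).target)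
    (hz' : (extChartAt (𝓡 (d + 1)) x₀).symm z.1 ∈ (extChartAt (𝓡 (d + 1)) x₁).source)
    (X Y : EucModel d × EucModel d) :
    sympl (coordMetric g x₁) (tangentLift (transition x₀ x₁) z)
      (fderiv ℝ (tangentLift (transition x₀ x₁)) z X)
      (fderiv ℝ (tangentLift (transition x₀ x₁)) z Y) = sympl (coordMetric g x₀) z X Y := by
  have ht : transition x₀ x₁ z.1 ∈ (extChartAt (𝓡 (d + 1)) x₁).target :=
    (extChartAt (𝓡 (d + 1)) x₁).map_source hz'
  refine sympl_tangentLift ((contDiffAt_transition hz hz').of_le (by norm_cast))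
    (differentiableAt_coordMetric g hz) (differentiableAt_coordMetric g ht) ?_ X Y
  filter_upwards [eventually_transition hz hz'] with u hu a b
  exact coordMetric_transition g hu.1 hu.2 a b

/-! ### Coordinates of tangent vectors of the tangent bundle -/

/-- The natural coordinates on `TM` over the preferred chart at `x₀`. -/
def tangentCoord (x₀ : M) (w : TangentBundle (𝓡 (d + 1)) M) : EucModel d × EucModel d :=
  extChartAt (𝓡 (d + 1)).tangent (⟨x₀, 0⟩ : TangentBundle (𝓡 (d + 1)) M) w

/-- The differential of the natural coordinates on `TM`. -/
def dTangentCoord (x₀ : M) (w : TangentBundle (𝓡 (d + 1)) M) :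
    TangentSpace (𝓡 (d + 1)).tangent w →L[ℝ] EucModel d × EucModel d :=
  mfderiv (𝓡 (d + 1)).tangent 𝓘(ℝ, EucModel d × EucModel d) (tangentCoord x₀) w

theorem tangentCoord_mem {x₀ : M} {w : TangentBundle (𝓡 (d + 1)) M}
    (hw : w.1 ∈ (extChartAt (𝓡 (d + 1)) x₀).source) :
    (tangentCoord x₀ w).1 ∈ (extChartAt (𝓡 (d + 1)) x₀).target :=
  (extChartAt (𝓡 (d + 1)) x₀).map_source hw

theorem tangentCoord_eq {x₀ : M} {w : TangentBundle (𝓡 (d + 1)) M}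
    (hw : w.1 ∈ (extChartAt (𝓡 (d + 1)) x₀).source) :
    tangentCoord x₀ w = (extChartAt (𝓡 (d + 1)) x₀ w.1,
      mfderiv (𝓡 (d + 1)) 𝓘(ℝ, EucModel d) (extChartAt (𝓡 (d + 1)) x₀) w.1 w.2) :=
  extChartAt_tangent_apply (w₀ := ⟨x₀, 0⟩) hw

theorem contMDiffAt_tangentCoord {x₀ : M} {w : TangentBundle (𝓡 (d + 1)) M}
    (hw : w.1 ∈ (extChartAt (𝓡 (d + 1)) x₀).source) :
    ContMDiffAt (𝓡 (d + 1)).tangent 𝓘(ℝ, EucModel d × EucModel d) ∞ (tangentCoord x₀) w := by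
  refine contMDiffAt_extChartAt' ?_
  rw [← extChartAt_source (𝓡 (d + 1)).tangent]
  exact mem_extChartAt_tangent_source.2 hw

theorem contMDiffAt_tangentCoord_symm {x₀ : M} {z : EucModel d × EucModel d}
    (hz : z.1 ∈ (extChartAt (𝓡 (d + 1)) x₀).target) :
    ContMDiffAt 𝓘(ℝ, EucModel d × EucModel d) (𝓡 (d + 1)).tangent ∞
      (extChartAt (𝓡 (d + 1)).tangent (⟨x₀, 0⟩ : TangentBundle (𝓡 (d + 1)) M)).symm z :=
  (contMDiffOn_extChartAt_symm _).contMDiffAt ((isOpen_extChartAt_target _).mem_nhds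
    (mem_extChartAt_tangent_target.2 hz))

theorem tangentCoord_transition {x₀ x₁ : M} {w : TangentBundle (𝓡 (d + 1)) M}
    (hw : w.1 ∈ (extChartAt (𝓡 (d + 1)) x₀).source)
    (hw' : w.1 ∈ (extChartAt (𝓡 (d + 1)) x₁).source) :
    tangentCoord x₁ w = tangentLift (transition x₀ x₁) (tangentCoord x₀ w) := by
  have h0 : (extChartAt (𝓡 (d + 1)) x₀).symm (tangentCoord x₀ w).1 = w.1 :=
    (extChartAt (𝓡 (d + 1)) x₀).left_inv hw
  rw [tangentLift_transition (w₀ := ⟨x₀, 0⟩) (w₁ := ⟨x₁, 0⟩) (tangentCoord_mem hw)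
    (by simp only; rwa [h0])]
  rw [tangentCoord, tangentCoord, PartialEquiv.left_inv]
  exact mem_extChartAt_tangent_source.2 hw

theorem eventually_base_source {x₀ : M} {w : TangentBundle (𝓡 (d + 1)) M}
    (hw : w.1 ∈ (extChartAt (𝓡 (d + 1)) x₀).source) :
    ∀ᶠ u : TangentBundle (𝓡 (d + 1)) M in 𝓝 w, u.1 ∈ (extChartAt (𝓡 (d + 1)) x₀).source :=
  ((FiberBundle.continuous_proj (EucModel d) (TangentSpace (𝓡 (d + 1)) : M → Type _)).continuousAt
    (x := w)).eventually ((isOpen_extChartAt_source x₀).mem_nhds hw)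

theorem hasMFDerivAt_tangentCoord {x₀ : M} {w : TangentBundle (𝓡 (d + 1)) M}
    (hw : w.1 ∈ (extChartAt (𝓡 (d + 1)) x₀).source) :
    HasMFDerivAt (𝓡 (d + 1)).tangent 𝓘(ℝ, EucModel d × EucModel d) (tangentCoord x₀) w
      (dTangentCoord x₀ w) :=
  ((contMDiffAt_tangentCoord hw).mdifferentiableAt (by simp)).hasMFDerivAt

theorem dTangentCoord_transition {x₀ x₁ : M} {w : TangentBundle (𝓡 (d + 1)) M}
    (hw : w.1 ∈ (extChartAt (𝓡 (d + 1)) x₀).source)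
    (hw' : w.1 ∈ (extChartAt (𝓡 (d + 1)) x₁).source)
    (X : TangentSpace (𝓡 (d + 1)).tangent w) :
    dTangentCoord x₁ w X =
      fderiv ℝ (tangentLift (transition x₀ x₁)) (tangentCoord x₀ w) (dTangentCoord x₀ w X) := by
  have h0 : (extChartAt (𝓡 (d + 1)) x₀).symm (tangentCoord x₀ w).1 = w.1 :=
    (extChartAt (𝓡 (d + 1)) x₀).left_inv hw
  have h1 : HasFDerivAt (tangentLift (transition x₀ x₁))
      (fderiv ℝ (tangentLift (transition x₀ x₁)) (tangentCoord x₀ w)) (tangentCoord x₀ w) :=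
    (hasFDerivAt_tangentLift ((contDiffAt_transition (tangentCoord_mem hw)
      (by rwa [h0])).of_le (by norm_cast))).differentiableAt.hasFDerivAt
  have h2 := h1.hasMFDerivAt.comp w (hasMFDerivAt_tangentCoord hw)
  have h3 : tangentCoord x₁ =ᶠ[𝓝 w] tangentLift (transition x₀ x₁) ∘ tangentCoord x₀ := by
    filter_upwards [eventually_base_source hw, eventually_base_source hw'] with u hu hu'
    exact tangentCoord_transition hu hu'
  have h4 := hasMFDerivAt_unique (hasMFDerivAt_tangentCoord hw') (h2.congr_of_eventuallyEq h3)
  exact congrArg (fun A => A X) h4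

theorem bijective_dTangentCoord {x₀ : M} {w : TangentBundle (𝓡 (d + 1)) M}
    (hw : w.1 ∈ (extChartAt (𝓡 (d + 1)) x₀).source) :
    Function.Bijective (dTangentCoord x₀ w) := by
  obtain ⟨e, he⟩ := isInvertible_mfderiv_extChartAt (I := (𝓡 (d + 1)).tangent)
    (x := (⟨x₀, 0⟩ : TangentBundle (𝓡 (d + 1)) M)) (mem_extChartAt_tangent_source.2 hw)
  have h : Function.Bijective (mfderiv (𝓡 (d + 1)).tangent 𝓘(ℝ, EucModel d × EucModel d)
      (extChartAt (𝓡 (d + 1)).tangent (⟨x₀, 0⟩ : TangentBundle (𝓡 (d + 1)) M)) w) := by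
    rw [← he]
    exact e.bijective
  exact h

theorem dTangentCoord_fst {x₀ : M} {w : TangentBundle (𝓡 (d + 1)) M}
    (hw : w.1 ∈ (extChartAt (𝓡 (d + 1)) x₀).source) (X : TangentSpace (𝓡 (d + 1)).tangent w) :
    (dTangentCoord x₀ w X).1 =
      mfderiv (𝓡 (d + 1)) 𝓘(ℝ, EucModel d) (extChartAt (𝓡 (d + 1)) x₀) w.1 (dBaseTM w X) := by
  have h1 := (hasFDerivAt_fst (𝕜 := ℝ) (p := tangentCoord x₀ w)).hasMFDerivAt.comp w
    (hasMFDerivAt_tangentCoord hw)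
  have hb : MDifferentiableAt (𝓡 (d + 1)).tangent (𝓡 (d + 1))
      (fun u : TangentBundle (𝓡 (d + 1)) M => u.1) w :=
    (contMDiffAt_proj (n := ∞) _).mdifferentiableAt (by simp)
  have h2 := ((contMDiffAt_chart hw).mdifferentiableAt (by simp)).hasMFDerivAt.comp w
    hb.hasMFDerivAt
  exact congrArg (fun A => A X) (hasMFDerivAt_unique h1 h2)

theorem tangentCoord_left_inv {x₀ : M} {w : TangentBundle (𝓡 (d + 1)) M}
    (hw : w.1 ∈ (extChartAt (𝓡 (d + 1)) x₀).source) :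
    (extChartAt (𝓡 (d + 1)).tangent (⟨x₀, 0⟩ : TangentBundle (𝓡 (d + 1)) M)).symm
      (tangentCoord x₀ w) = w :=
  PartialEquiv.left_inv _ (mem_extChartAt_tangent_source.2 hw)

theorem tangentCoord_right_inv {x₀ : M} {z : EucModel d × EucModel d}
    (hz : z.1 ∈ (extChartAt (𝓡 (d + 1)) x₀).target) : tangentCoord x₀
      ((extChartAt (𝓡 (d + 1)).tangent (⟨x₀, 0⟩ : TangentBundle (𝓡 (d + 1)) M)).symm z) = z :=
  PartialEquiv.right_inv _ (mem_extChartAt_tangent_target.2 hz)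

theorem sqLen_eq_kinetic (g : SmoothMetric d M) {x₀ : M} {w : TangentBundle (𝓡 (d + 1)) M}
    (hw : w.1 ∈ (extChartAt (𝓡 (d + 1)) x₀).source) :
    sqLen g w = 2 * kinetic (coordMetric g x₀) (tangentCoord x₀ w) := by
  have h := sqLen_extChartAt_symm (w₀ := ⟨x₀, 0⟩) g (tangentCoord_mem hw)
  rw [tangentCoord_left_inv hw] at h
  rw [h, kinetic]
  ring

/-- The Liouville form in natural coordinates is `(y, u) ↦ G_y(u, dy)`. -/
theorem liouvilleInChart_apply (g : SmoothMetric d M) (w : TangentBundle (𝓡 (d + 1)) M)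
    {z : EucModel d × EucModel d} (hz : z.1 ∈ (extChartAt (𝓡 (d + 1)) w.1).target) :
    liouvilleInChart g w z =
      (momentum (coordMetric g w.1) z).comp (.fst ℝ (EucModel d) (EucModel d)) := by
  refine ContinuousLinearMap.ext fun X => ?_
  set ψ := extChartAt (𝓡 (d + 1)).tangent w with hψ
  have hs : MDifferentiableAt 𝓘(ℝ, EucModel d × EucModel d) (𝓡 (d + 1)).tangent ψ.symm z :=
    (contMDiffAt_tangentCoord_symm hz).mdifferentiableAt (by simp)
  have hb : MDifferentiableAt (𝓡 (d + 1)).tangent (𝓡 (d + 1))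
      (fun u : TangentBundle (𝓡 (d + 1)) M => u.1) (ψ.symm z) :=
    (contMDiffAt_proj (n := ∞) _).mdifferentiableAt (by simp)
  have h1 := hb.hasMFDerivAt.comp z hs.hasMFDerivAt
  have h2 := ((contMDiffAt_symm hz).mdifferentiableAt (by simp)).hasMFDerivAt.comp z
    (hasFDerivAt_fst (𝕜 := ℝ) (p := z)).hasMFDerivAt
  have h3 : (dBaseTM (ψ.symm z)) (mfderiv 𝓘(ℝ, EucModel d × EucModel d) (𝓡 (d + 1)).tangent
      ψ.symm z X) = mfderiv 𝓘(ℝ, EucModel d) (𝓡 (d + 1)) (extChartAt (𝓡 (d + 1)) w.1).symm z.1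
        X.1 := congrArg (fun A => A X) (hasMFDerivAt_unique h1 h2)
  have h4 : (ψ.symm z).2 = mfderiv 𝓘(ℝ, EucModel d) (𝓡 (d + 1))
      (extChartAt (𝓡 (d + 1)) w.1).symm z.1 z.2 := by
    have := extChartAt_tangent_symm_apply (w₀ := w) hz
    exact eq_of_heq (Bundle.TotalSpace.mk.inj this).2
  change g.inner (ψ.symm z).1 (ψ.symm z).2 (dBaseTM (ψ.symm z) (mfderiv
    𝓘(ℝ, EucModel d × EucModel d) (𝓡 (d + 1)).tangent ψ.symm z X)) = _
  rw [h3, h4]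
  rfl

/-- The chart of `TM` used by `omegaG` is the one at `w` itself, where the Liouville form is `G_y(u,
dy)` on a whole neighbourhood and may therefore be differentiated. -/
theorem omegaG_eq_sympl_self (g : SmoothMetric d M) (w : TangentBundle (𝓡 (d + 1)) M)
    (X Y : TangentSpace (𝓡 (d + 1)).tangent w) :
    omegaG g w X Y = sympl (coordMetric g w.1) (tangentCoord w.1 w)
      (dTangentCoord w.1 w X) (dTangentCoord w.1 w Y) := by
  have hw : w.1 ∈ (extChartAt (𝓡 (d + 1)) w.1).source := mem_extChartAt_source _
  have hz : (tangentCoord w.1 w).1 ∈ (extChartAt (𝓡 (d + 1)) w.1).target := tangentCoord_mem hw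
  have h1 : liouvilleInChart g w =ᶠ[𝓝 (tangentCoord w.1 w)] fun z =>
      (momentum (coordMetric g w.1) z).comp (.fst ℝ (EucModel d) (EucModel d)) := by
    filter_upwards [continuous_fst.continuousAt.eventually
      ((isOpen_extChartAt_target w.1).mem_nhds hz)] with z hz
    exact liouvilleInChart_apply g w hz
  have h2 : ∀ X Y : EucModel d × EucModel d,
      fderiv ℝ (liouvilleInChart g w) (tangentCoord w.1 w) X Y =
        fderiv ℝ (momentum (coordMetric g w.1)) (tangentCoord w.1 w) X Y.1 := by
    intro X Y
    have h3 : HasFDerivAt (momentum (coordMetric g w.1))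
        (fderiv ℝ (momentum (coordMetric g w.1)) (tangentCoord w.1 w)) (tangentCoord w.1 w) :=
      (hasFDerivAt_momentum (differentiableAt_coordMetric g hz)).differentiableAt.hasFDerivAt
    have h4 := ((ContinuousLinearMap.compL ℝ (EucModel d × EucModel d) (EucModel d) ℝ).flip
      (.fst ℝ (EucModel d) (EucModel d))).hasFDerivAt.comp (tangentCoord w.1 w) h3
    have h5 := h4.congr_of_eventuallyEq h1
    rw [h5.fderiv]
    rfl
  change fderiv ℝ (liouvilleInChart g w) (tangentCoord w.1 w) (dTangentCoord w.1 w X)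
    (dTangentCoord w.1 w Y) - fderiv ℝ (liouvilleInChart g w) (tangentCoord w.1 w)
      (dTangentCoord w.1 w Y) (dTangentCoord w.1 w X) = _
  rw [h2, h2]
  rfl

/-- The symplectic form in the natural coordinates over any preferred chart. -/
theorem omegaG_eq_sympl (g : SmoothMetric d M) {x₀ : M} {w : TangentBundle (𝓡 (d + 1)) M}
    (hw : w.1 ∈ (extChartAt (𝓡 (d + 1)) x₀).source) (X Y : TangentSpace (𝓡 (d + 1)).tangent w) :
    omegaG g w X Y = sympl (coordMetric g x₀) (tangentCoord x₀ w)
      (dTangentCoord x₀ w X) (dTangentCoord x₀ w Y) := by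
  have hw' : w.1 ∈ (extChartAt (𝓡 (d + 1)) w.1).source := mem_extChartAt_source _
  have h0 : (extChartAt (𝓡 (d + 1)) x₀).symm (tangentCoord x₀ w).1 = w.1 :=
    (extChartAt (𝓡 (d + 1)) x₀).left_inv hw
  rw [omegaG_eq_sympl_self, tangentCoord_transition hw hw', dTangentCoord_transition hw hw',
    dTangentCoord_transition hw hw', sympl_transition g (tangentCoord_mem hw) (by rwa [h0])]

/-! ### Geodesics in coordinates -/

/-- The germ at `t` of the curve `γ` is a geodesic at `t`. -/
def IsGeodesicAt (g : SmoothMetric d M) (γ : ℝ → M) (t : ℝ) : Prop :=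
  ContMDiffAt 𝓘(ℝ, ℝ) (𝓡 (d + 1)) 2 γ t ∧
  ∀ x₀ : M, γ t ∈ (extChartAt (𝓡 (d + 1)) x₀).source →
    ∀ a : EucModel d,
      let c : ℝ → EucModel d := fun τ => extChartAt (𝓡 (d + 1)) x₀ (γ τ)
      chartMetric g x₀ (c t) (deriv (deriv c) t) a
        + christoffel g x₀ (c t) (deriv c t) (deriv c t) a = 0

theorem isGeodesic_iff {g : SmoothMetric d M} {γ : ℝ → M} :
    IsGeodesic g γ ↔ ∀ t, IsGeodesicAt g γ t :=
  ⟨fun h t => ⟨h.1 t, fun x₀ => h.2 x₀ t⟩, fun h => ⟨fun t => (h t).1, fun x₀ t => (h t).2 x₀⟩⟩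

theorem velocity_congr {γ γ' : ℝ → M} {t : ℝ} (h : γ =ᶠ[𝓝 t] γ') :
    velocity (d := d) γ t = velocity γ' t := by
  have h0 : γ t = γ' t := h.self_of_nhds
  have h1 : (mfderiv 𝓘(ℝ, ℝ) (𝓡 (d + 1)) γ t : ℝ →L[ℝ] EucModel d) =
      mfderiv 𝓘(ℝ, ℝ) (𝓡 (d + 1)) γ' t := h.mfderiv_eq
  -- The two velocities live in tangent spaces at different expressions for the base point;
  -- comparing their components in the model space avoids a transport.
  have key : ∀ (p q : M) (a b : EucModel d), p = q → a = b →
      (⟨p, a⟩ : TangentBundle (𝓡 (d + 1)) M) = ⟨q, b⟩ := by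
    rintro p _ a _ rfl rfl
    rfl
  exact key _ _ _ _ h0 (congrArg (fun A : ℝ →L[ℝ] EucModel d => A 1) h1)

theorem IsGeodesicAt.congr {g : SmoothMetric d M} {γ γ' : ℝ → M} {t : ℝ}
    (hγ : IsGeodesicAt g γ t) (h : γ =ᶠ[𝓝 t] γ') : IsGeodesicAt g γ' t := by
  have h0 : γ t = γ' t := h.self_of_nhds
  refine ⟨hγ.1.congr_of_eventuallyEq h.symm, fun x₀ hx a => ?_⟩
  have h1 := hγ.2 x₀ (by rwa [h0]) a
  have hc : (fun τ => extChartAt (𝓡 (d + 1)) x₀ (γ τ)) =ᶠ[𝓝 t]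
      fun τ => extChartAt (𝓡 (d + 1)) x₀ (γ' τ) := h.fun_comp _
  simp only at h1 ⊢
  rw [hc.deriv.deriv_eq, hc.deriv_eq, h0] at h1
  exact h1

theorem tangentCoord_velocity {x₀ : M} {γ : ℝ → M} {t : ℝ}
    (hγ : MDifferentiableAt 𝓘(ℝ, ℝ) (𝓡 (d + 1)) γ t)
    (ht : γ t ∈ (extChartAt (𝓡 (d + 1)) x₀).source) :
    tangentCoord x₀ (velocity γ t) = (extChartAt (𝓡 (d + 1)) x₀ (γ t),
      deriv (fun τ => extChartAt (𝓡 (d + 1)) x₀ (γ τ)) t) := by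
  rw [tangentCoord_eq (w := velocity γ t) ht]
  refine Prod.ext rfl ?_
  rw [← fderiv_apply_one_eq_deriv, ← mfderiv_eq_fderiv]
  exact (congrArg (fun A => A (1 : ℝ)) (mfderiv_comp t
    ((contMDiffAt_chart ht).mdifferentiableAt (by simp)) hγ)).symm

theorem eventually_curve_source {x₀ : M} {γ : ℝ → M} {t : ℝ} (hγ : ContinuousAt γ t)
    (ht : γ t ∈ (extChartAt (𝓡 (d + 1)) x₀).source) :
    ∀ᶠ s in 𝓝 t, γ s ∈ (extChartAt (𝓡 (d + 1)) x₀).source :=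
  hγ.eventually ((isOpen_extChartAt_source x₀).mem_nhds ht)

theorem tangentCoord_velocity_eventuallyEq {x₀ : M} {γ : ℝ → M} {t : ℝ}
    (hγ : ContMDiffAt 𝓘(ℝ, ℝ) (𝓡 (d + 1)) 2 γ t)
    (ht : γ t ∈ (extChartAt (𝓡 (d + 1)) x₀).source) :
    (fun s => tangentCoord x₀ (velocity γ s)) =ᶠ[𝓝 t] fun s => (extChartAt (𝓡 (d + 1)) x₀ (γ s),
      deriv (fun τ => extChartAt (𝓡 (d + 1)) x₀ (γ τ)) s) := by
  have h1 : ∀ᶠ s in 𝓝 t, ContMDiffAt 𝓘(ℝ, ℝ) (𝓡 (d + 1)) 2 γ s :=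
    (contMDiffAt_iff_contMDiffAt_nhds (by simp)).1 hγ
  filter_upwards [h1, eventually_curve_source hγ.continuousAt ht] with s hs hs'
  exact tangentCoord_velocity (hs.mdifferentiableAt (by simp)) hs'

theorem hasDerivAt_tangentCoord_velocity {x₀ : M} {γ : ℝ → M} {t : ℝ}
    (hγ : ContMDiffAt 𝓘(ℝ, ℝ) (𝓡 (d + 1)) 2 γ t)
    (ht : γ t ∈ (extChartAt (𝓡 (d + 1)) x₀).source) :
    HasDerivAt (fun s => tangentCoord x₀ (velocity γ s))
      (deriv (fun τ => extChartAt (𝓡 (d + 1)) x₀ (γ τ)) t,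
        deriv (deriv (fun τ => extChartAt (𝓡 (d + 1)) x₀ (γ τ))) t) t := by
  have hc : ContDiffAt ℝ 2 (fun τ => extChartAt (𝓡 (d + 1)) x₀ (γ τ)) t :=
    (((contMDiffAt_chart ht).of_le (by norm_cast)).comp t hγ).contDiffAt
  have hc1 : ContDiffAt ℝ 1 (deriv (fun τ => extChartAt (𝓡 (d + 1)) x₀ (γ τ))) t :=
    (hc.fderiv_right (m := 1) (by norm_num)).clm_apply contDiffAt_const
  refine (HasDerivAt.prodMk (hc.differentiableAt (by simp)).hasDerivAt
    (hc1.differentiableAt (by simp)).hasDerivAt).congr_of_eventuallyEq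
      (tangentCoord_velocity_eventuallyEq hγ ht)

/-- With equal lower arguments the first two Christoffel terms coincide, which leaves exactly the
combination occurring in `eq_spray_iff`. -/
theorem christoffel_self (g : SmoothMetric d M) {x₀ : M} {z : EucModel d × EucModel d}
    (hz : z.1 ∈ (extChartAt (𝓡 (d + 1)) x₀).target) (b : EucModel d) :
    christoffel g x₀ z.1 z.2 z.2 b =
      fderiv ℝ (coordMetric g x₀) z.1 z.2 z.2 b - force (coordMetric g x₀) z b := by
  have h1 : ∀ a b c : EucModel d, fderiv ℝ (fun y => chartMetric g x₀ y b c) z.1 a =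
      fderiv ℝ (coordMetric g x₀) z.1 a b c := by
    intro a b c
    have h2 := ((differentiableAt_coordMetric g hz).hasFDerivAt.clm_apply
      (hasFDerivAt_const b z.1)).clm_apply (hasFDerivAt_const c z.1)
    have h3 : HasFDerivAt (fun y => chartMetric g x₀ y b c) _ z.1 := h2
    rw [h3.fderiv]
    simp
  rw [christoffel, h1, h1, force_apply]
  ring

/-- A curve is a geodesic at `t` iff in some preferred chart its velocity follows the geodesic
vector field. -/
theorem isGeodesicAt_iff {g : SmoothMetric d M} {x₀ : M} {γ : ℝ → M} {t : ℝ}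
    (hγ : ContMDiffAt 𝓘(ℝ, ℝ) (𝓡 (d + 1)) 2 γ t)
    (ht : γ t ∈ (extChartAt (𝓡 (d + 1)) x₀).source) :
    IsGeodesicAt g γ t ↔ HasDerivAt (fun s => tangentCoord x₀ (velocity γ s))
      (spray (coordMetric g x₀) (tangentCoord x₀ (velocity γ t))) t := by
  -- Chart by chart, the second-order equation is the velocity component of the first-order system;
  -- the position component holds automatically.
  have key : ∀ x₁, γ t ∈ (extChartAt (𝓡 (d + 1)) x₁).source →
      ((∀ a : EucModel d, let c : ℝ → EucModel d := fun τ => extChartAt (𝓡 (d + 1)) x₁ (γ τ)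
        chartMetric g x₁ (c t) (deriv (deriv c) t) a
        + christoffel g x₁ (c t) (deriv c t) (deriv c t) a = 0) ↔
      HasDerivAt (fun s => tangentCoord x₁ (velocity γ s))
        (spray (coordMetric g x₁) (tangentCoord x₁ (velocity γ t))) t) := by
    intro x₁ hx
    have h1 := hasDerivAt_tangentCoord_velocity hγ hx
    have h2 := tangentCoord_velocity (hγ.mdifferentiableAt (by simp)) hx
    have hz : extChartAt (𝓡 (d + 1)) x₁ (γ t) ∈ (extChartAt (𝓡 (d + 1)) x₁).target :=
      (extChartAt (𝓡 (d + 1)) x₁).map_source hx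
    have h3 := eq_spray_iff (z := (extChartAt (𝓡 (d + 1)) x₁ (γ t),
      deriv (fun τ => extChartAt (𝓡 (d + 1)) x₁ (γ τ)) t)) (isInvertible_coordMetric g hz)
      (deriv (deriv (fun τ => extChartAt (𝓡 (d + 1)) x₁ (γ τ))) t)
    have h4 := christoffel_self g (z := (extChartAt (𝓡 (d + 1)) x₁ (γ t),
      deriv (fun τ => extChartAt (𝓡 (d + 1)) x₁ (γ τ)) t)) hz
    rw [h2]
    trans deriv (deriv (fun τ => extChartAt (𝓡 (d + 1)) x₁ (γ τ))) t = (spray (coordMetric g x₁)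
      (extChartAt (𝓡 (d + 1)) x₁ (γ t), deriv (fun τ => extChartAt (𝓡 (d + 1)) x₁ (γ τ)) t)).2
    · rw [h3]
      refine forall_congr' fun a => ?_
      simp only [h4, ← coordMetric_apply]
      rw [add_sub_assoc]
    · refine ⟨fun h => h1.congr_deriv (Prod.ext rfl h), fun h => ?_⟩
      exact congrArg Prod.snd (h1.unique h)
  constructor
  · intro h
    exact (key x₀ ht).1 (h.2 x₀ ht)
  · intro h
    -- The remaining charts follow by pushing the integral curve forward, since the geodesic field
    -- is natural under transitions.
    refine ⟨hγ, fun x₁ hx => (key x₁ hx).2 ?_⟩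
    have hz : (tangentCoord x₀ (velocity γ t)).1 ∈ (extChartAt (𝓡 (d + 1)) x₀).target :=
      tangentCoord_mem (w := velocity γ t) ht
    have h0 : (extChartAt (𝓡 (d + 1)) x₀).symm (tangentCoord x₀ (velocity γ t)).1 = γ t :=
      (extChartAt (𝓡 (d + 1)) x₀).left_inv ht
    have h1 : HasFDerivAt (tangentLift (transition x₀ x₁)) (fderiv ℝ
        (tangentLift (transition x₀ x₁)) (tangentCoord x₀ (velocity γ t)))
        (tangentCoord x₀ (velocity γ t)) :=
      (hasFDerivAt_tangentLift ((contDiffAt_transition hz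
        (by rwa [h0])).of_le (by norm_cast))).differentiableAt.hasFDerivAt
    have h2 := HasFDerivAt.comp_hasDerivAt (l := tangentLift (transition x₀ x₁))
      (f := fun s => tangentCoord x₀ (velocity γ s)) t h1 h
    rw [spray_transition g hz (by rwa [h0]), ← tangentCoord_transition (w := velocity γ t) ht hx]
      at h2
    refine h2.congr_of_eventuallyEq ?_
    filter_upwards [eventually_curve_source hγ.continuousAt ht,
      eventually_curve_source hγ.continuousAt hx] with s hs hs'
    exact tangentCoord_transition (w := velocity γ s) hs hs'

theorem tangentCoord_injOn {x₀ : M} {w w' : TangentBundle (𝓡 (d + 1)) M}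
    (hw : w.1 ∈ (extChartAt (𝓡 (d + 1)) x₀).source)
    (hw' : w'.1 ∈ (extChartAt (𝓡 (d + 1)) x₀).source)
    (h : tangentCoord x₀ w = tangentCoord x₀ w') : w = w' := by
  rw [← tangentCoord_left_inv hw, h, tangentCoord_left_inv hw']

theorem contDiffAt_spray_coordMetric (g : SmoothMetric d M) {x₀ : M} {z : EucModel d × EucModel d}
    (hz : z.1 ∈ (extChartAt (𝓡 (d + 1)) x₀).target) :
    ContDiffAt ℝ ∞ (spray (coordMetric g x₀)) z :=
  (contDiffOn_spray (isOpen_extChartAt_target x₀) (contDiffOn_coordMetric g x₀)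
    fun _ hy _ ha => coordMetric_pos g hy ha).contDiffAt
      (((isOpen_extChartAt_target x₀).prod isOpen_univ).mem_nhds ⟨hz, mem_univ _⟩)

theorem continuousAt_tangentCoord_velocity {x₀ : M} {γ : ℝ → M} {t : ℝ}
    (hγ : ContMDiffAt 𝓘(ℝ, ℝ) (𝓡 (d + 1)) 2 γ t)
    (ht : γ t ∈ (extChartAt (𝓡 (d + 1)) x₀).source) :
    ContinuousAt (fun s => tangentCoord x₀ (velocity (d := d) γ s)) t :=
  (hasDerivAt_tangentCoord_velocity hγ ht).continuousAt

/-- Local uniqueness of geodesics. -/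
theorem eventuallyEq_of_velocity_eq {g : SmoothMetric d M} {γ γ' : ℝ → M} {t : ℝ}
    (hγ : ∀ᶠ s in 𝓝 t, IsGeodesicAt g γ s) (hγ' : ∀ᶠ s in 𝓝 t, IsGeodesicAt g γ' s)
    (h : velocity (d := d) γ t = velocity γ' t) : γ =ᶠ[𝓝 t] γ' := by
  have h0 : γ t = γ' t := congrArg (fun w : TangentBundle (𝓡 (d + 1)) M => w.1) h
  set x₀ := γ t with hx₀
  have hx : γ t ∈ (extChartAt (𝓡 (d + 1)) x₀).source := mem_extChartAt_source _
  have hx' : γ' t ∈ (extChartAt (𝓡 (d + 1)) x₀).source := h0 ▸ hx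
  have hc := hγ.self_of_nhds.1
  have hc' := hγ'.self_of_nhds.1
  have hz : (tangentCoord x₀ (velocity (d := d) γ t)).1 ∈ (extChartAt (𝓡 (d + 1)) x₀).target :=
    tangentCoord_mem (w := velocity γ t) hx
  -- A `C¹` field is Lipschitz near the common initial velocity, so uniqueness for ordinary
  -- differential equations applies in the chart.
  obtain ⟨K, S, hS, hK⟩ := ((contDiffAt_spray_coordMetric g hz).of_le
    (by norm_cast : (1 : WithTop ℕ∞) ≤ ∞)).exists_lipschitzOnWith
  have hz' : ∀ᶠ s in 𝓝 t, tangentCoord x₀ (velocity (d := d) γ s) ∈ S :=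
    (continuousAt_tangentCoord_velocity hc hx).eventually hS
  have hz'' : ∀ᶠ s in 𝓝 t, tangentCoord x₀ (velocity (d := d) γ' s) ∈ S :=
    (continuousAt_tangentCoord_velocity hc' hx').eventually (by rw [h] at hS; exact hS)
  have hs := eventually_curve_source hc.continuousAt hx
  have hs' := eventually_curve_source hc'.continuousAt hx'
  have key := ODE_solution_unique_of_eventually (v := fun _ => spray (coordMetric g x₀))
    (s := fun _ => S) (K := K) (t₀ := t) (f := fun s => tangentCoord x₀ (velocity (d := d) γ s))
    (g := fun s => tangentCoord x₀ (velocity (d := d) γ' s))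
    (Filter.Eventually.of_forall fun _ => hK)
    (by
      filter_upwards [hγ, hs, hz'] with s h1 h2 h3
      exact ⟨(isGeodesicAt_iff h1.1 h2).1 h1, h3⟩)
    (by
      filter_upwards [hγ', hs', hz''] with s h1 h2 h3
      exact ⟨(isGeodesicAt_iff h1.1 h2).1 h1, h3⟩) (by simp only [h])
  filter_upwards [key, hs, hs'] with s h1 h2 h3
  exact congrArg (fun w : TangentBundle (𝓡 (d + 1)) M => w.1)
    (tangentCoord_injOn (w := velocity γ s) (w' := velocity γ' s) h2 h3 h1)

/-- Uniqueness of geodesics on an open interval. -/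
theorem eqOn_velocity_of_isGeodesicAt [T2Space M] {g : SmoothMetric d M} {γ γ' : ℝ → M}
    {J : Set ℝ} (hJ : IsOpen J) (hJc : IsPreconnected J) (hγ : ∀ t ∈ J, IsGeodesicAt g γ t)
    (hγ' : ∀ t ∈ J, IsGeodesicAt g γ' t) {t₀ : ℝ} (ht₀ : t₀ ∈ J)
    (h : velocity (d := d) γ t₀ = velocity γ' t₀) {t : ℝ} (ht : t ∈ J) :
    velocity (d := d) γ t = velocity γ' t := by
  have hev : ∀ t ∈ J, ∀ᶠ s in 𝓝 t, IsGeodesicAt g γ s := fun t ht =>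
    Filter.mem_of_superset (hJ.mem_nhds ht) hγ
  have hev' : ∀ t ∈ J, ∀ᶠ s in 𝓝 t, IsGeodesicAt g γ' s := fun t ht =>
    Filter.mem_of_superset (hJ.mem_nhds ht) hγ'
  have hsub : J ⊆ {t | γ =ᶠ[𝓝 t] γ'} := by
    -- Connectedness argument: the set where the germs agree is open. At a limit point in `J` the
    -- base points agree because `M` is Hausdorff, the velocities agree by continuity, and local
    -- uniqueness makes the germs agree.
    refine hJc.subset_of_closure_inter_subset isOpen_setOfPred_eventually_nhds
      ⟨t₀, ht₀, eventuallyEq_of_velocity_eq (hev t₀ ht₀) (hev' t₀ ht₀) h⟩ ?_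
    rintro t ⟨htc, ht⟩
    have hfr : ∃ᶠ s in 𝓝 t, γ =ᶠ[𝓝 s] γ' := mem_closure_iff_frequently.1 htc
    have hc := (hγ t ht).1
    have hc' := (hγ' t ht).1
    have h0 : γ t = γ' t := by
      by_contra hne
      have := ((hc.continuousAt.prodMk hc'.continuousAt).eventually
        ((isClosed_diagonal (X := M)).isOpen_compl.mem_nhds
          (show (γ t, γ' t) ∈ (diagonal M)ᶜ from hne)))
      obtain ⟨s, hs, hs'⟩ := (hfr.and_eventually this).exists
      exact hs' hs.self_of_nhds
    have hx : γ t ∈ (extChartAt (𝓡 (d + 1)) (γ t)).source := mem_extChartAt_source _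
    have hx' : γ' t ∈ (extChartAt (𝓡 (d + 1)) (γ t)).source := h0 ▸ hx
    have hv : tangentCoord (γ t) (velocity (d := d) γ t) =
        tangentCoord (γ t) (velocity (d := d) γ' t) := by
      by_contra hne
      have := (((continuousAt_tangentCoord_velocity hc hx).prodMk
        (continuousAt_tangentCoord_velocity hc' hx')).eventually
        (isClosed_diagonal.isOpen_compl.mem_nhds
          (show (tangentCoord (γ t) (velocity (d := d) γ t),
            tangentCoord (γ t) (velocity (d := d) γ' t)) ∈
            (diagonal (EucModel d × EucModel d))ᶜ from hne)))
      obtain ⟨s, hs, hs'⟩ := (hfr.and_eventually this).exists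
      exact hs' (by simp only [mem_diagonal_iff]; rw [velocity_congr hs])
    exact eventuallyEq_of_velocity_eq (hev t ht) (hev' t ht)
      (tangentCoord_injOn (w := velocity γ t) (w' := velocity γ' t) hx hx' hv)
  exact velocity_congr (hsub ht)

theorem hasMFDerivAt_add_const (r t : ℝ) : HasMFDerivAt 𝓘(ℝ, ℝ) 𝓘(ℝ, ℝ) (fun s : ℝ => s + r) t
    (ContinuousLinearMap.id ℝ ℝ) :=
  ((hasFDerivAt_id t).add_const r).hasMFDerivAt

theorem velocity_comp_add {γ : ℝ → M} {r t : ℝ}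
    (hγ : MDifferentiableAt 𝓘(ℝ, ℝ) (𝓡 (d + 1)) γ (t + r)) :
    velocity (d := d) (fun s => γ (s + r)) t = velocity γ (t + r) := by
  have h1 := (hγ.hasMFDerivAt.comp t (hasMFDerivAt_add_const r t)).mfderiv
  have h2 : mfderiv 𝓘(ℝ, ℝ) (𝓡 (d + 1)) (fun s => γ (s + r)) t (1 : ℝ) =
      mfderiv 𝓘(ℝ, ℝ) (𝓡 (d + 1)) γ (t + r) (1 : ℝ) := congrArg (fun A => A (1 : ℝ)) h1
  exact congrArg (fun a : TangentSpace (𝓡 (d + 1)) (γ (t + r)) =>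
    (⟨γ (t + r), a⟩ : TangentBundle (𝓡 (d + 1)) M)) h2

theorem IsGeodesicAt.comp_add {g : SmoothMetric d M} {γ : ℝ → M} {r t : ℝ}
    (h : IsGeodesicAt g γ (t + r)) : IsGeodesicAt g (fun s => γ (s + r)) t := by
  refine ⟨h.1.comp t (f := fun s : ℝ => s + r)
    (contDiff_id.add contDiff_const).contMDiff.contMDiffAt,
    fun x₀ hx a => ?_⟩
  have h1 := h.2 x₀ hx a
  simp only at h1 ⊢
  have h2 : ∀ s, deriv (fun τ => extChartAt (𝓡 (d + 1)) x₀ (γ (τ + r))) s =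
      deriv (fun τ => extChartAt (𝓡 (d + 1)) x₀ (γ τ)) (s + r) := fun s =>
    deriv_comp_add_const (fun τ => extChartAt (𝓡 (d + 1)) x₀ (γ τ)) r s
  have h3 : deriv (deriv (fun τ => extChartAt (𝓡 (d + 1)) x₀ (γ (τ + r)))) t =
      deriv (deriv (fun τ => extChartAt (𝓡 (d + 1)) x₀ (γ τ))) (t + r) := by
    rw [funext h2]
    exact deriv_comp_add_const (deriv fun τ => extChartAt (𝓡 (d + 1)) x₀ (γ τ)) r t
  rw [h2, h3]
  exact h1

theorem IsGeodesicAt.mdifferentiableAt {g : SmoothMetric d M} {γ : ℝ → M} {t : ℝ}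
    (h : IsGeodesicAt g γ t) : MDifferentiableAt 𝓘(ℝ, ℝ) (𝓡 (d + 1)) γ t :=
  h.1.mdifferentiableAt (by simp)

/-- Solutions of the geodesic equation in a chart give geodesics. -/
theorem isGeodesicAt_of_hasDerivAt {g : SmoothMetric d M} {x₀ : M} {z : ℝ → EucModel d × EucModel d}
    {t : ℝ} (hz : ContDiffAt ℝ 2 z t) (hzt : (z t).1 ∈ (extChartAt (𝓡 (d + 1)) x₀).target)
    (hd : ∀ᶠ s in 𝓝 t, HasDerivAt z (spray (coordMetric g x₀) (z s)) s) :
    IsGeodesicAt g (fun s => (extChartAt (𝓡 (d + 1)) x₀).symm (z s).1) t ∧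
      velocity (fun s => (extChartAt (𝓡 (d + 1)) x₀).symm (z s).1) t =
        (extChartAt (𝓡 (d + 1)).tangent (⟨x₀, 0⟩ : TangentBundle (𝓡 (d + 1)) M)).symm (z t) := by
  have hev : ∀ᶠ s in 𝓝 t, (z s).1 ∈ (extChartAt (𝓡 (d + 1)) x₀).target :=
    (continuousAt_fst.comp hz.continuousAt).eventually
      ((isOpen_extChartAt_target x₀).mem_nhds hzt)
  have hv : ∀ᶠ s in 𝓝 t, velocity (fun s => (extChartAt (𝓡 (d + 1)) x₀).symm (z s).1) s =
      (extChartAt (𝓡 (d + 1)).tangent (⟨x₀, 0⟩ : TangentBundle (𝓡 (d + 1)) M)).symm (z s) := by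
    filter_upwards [hd, hev] with s hs hs'
    rw [extChartAt_tangent_symm_apply (w₀ := ⟨x₀, 0⟩) hs']
    have h1 : HasDerivAt (fun s => (z s).1) (z s).2 s :=
      (ContinuousLinearMap.fst ℝ (EucModel d) (EucModel d)).hasFDerivAt.comp_hasDerivAt s hs
    have h2 := (((contMDiffAt_symm hs').mdifferentiableAt (by simp)).hasMFDerivAt.comp s
      h1.hasFDerivAt.hasMFDerivAt).mfderiv
    have h3 : mfderiv 𝓘(ℝ, ℝ) (𝓡 (d + 1))
        (fun s => (extChartAt (𝓡 (d + 1)) x₀).symm (z s).1) s (1 : ℝ) =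
        mfderiv 𝓘(ℝ, EucModel d) (𝓡 (d + 1)) (extChartAt (𝓡 (d + 1)) x₀).symm (z s).1
          ((1 : ℝ) • (z s).2) := congrArg (fun A => A (1 : ℝ)) h2
    rw [one_smul] at h3
    exact congrArg (fun a : TangentSpace (𝓡 (d + 1)) ((extChartAt (𝓡 (d + 1)) x₀).symm (z s).1) =>
      (⟨_, a⟩ : TangentBundle (𝓡 (d + 1)) M)) h3
  have hγ : ContMDiffAt 𝓘(ℝ, ℝ) (𝓡 (d + 1)) 2
      (fun s => (extChartAt (𝓡 (d + 1)) x₀).symm (z s).1) t :=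
    ContMDiffAt.comp t (g := (extChartAt (𝓡 (d + 1)) x₀).symm) (f := fun s => (z s).1)
      ((contMDiffAt_symm hzt).of_le (by norm_cast)) (contDiffAt_fst.comp t hz).contMDiffAt
  refine ⟨(isGeodesicAt_iff hγ ((extChartAt (𝓡 (d + 1)) x₀).map_target hzt)).2 ?_,
    hv.self_of_nhds⟩
  rw [hv.self_of_nhds, tangentCoord_right_inv hzt]
  refine hd.self_of_nhds.congr_of_eventuallyEq ?_
  filter_upwards [hv, hev] with s hs hs'
  rw [hs, tangentCoord_right_inv hs']

/-! ### Metric, Liouville form and local geodesic flow on the tangent bundle. -/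

theorem inner_eq_coordMetric (g : SmoothMetric d M) {x₀ p : M}
    (hp : p ∈ (extChartAt (𝓡 (d + 1)) x₀).source) (a b : TangentSpace (𝓡 (d + 1)) p) :
    g.inner p a b = coordMetric g x₀ (extChartAt (𝓡 (d + 1)) x₀ p)
      (mfderiv (𝓡 (d + 1)) 𝓘(ℝ, EucModel d) (extChartAt (𝓡 (d + 1)) x₀) p a)
      (mfderiv (𝓡 (d + 1)) 𝓘(ℝ, EucModel d) (extChartAt (𝓡 (d + 1)) x₀) p b) := by
  let A : TangentSpace (𝓡 (d + 1)) p →L[ℝ] EucModel d :=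
    mfderiv (𝓡 (d + 1)) 𝓘(ℝ, EucModel d) (extChartAt (𝓡 (d + 1)) x₀) p
  change g.inner p a b = coordMetric g x₀ (extChartAt (𝓡 (d + 1)) x₀ p) (A a) (A b)
  have hq : ∀ a : TangentSpace (𝓡 (d + 1)) p,
      g.inner p a a = coordMetric g x₀ (extChartAt (𝓡 (d + 1)) x₀ p) (A a) (A a) := by
    intro a
    have h := sqLen_eq_kinetic g (x₀ := x₀) (w := ⟨p, a⟩) hp
    rw [tangentCoord_eq (w := ⟨p, a⟩) hp] at h
    change g.inner p a a = 2 * (1 / 2 * coordMetric g x₀ (extChartAt (𝓡 (d + 1)) x₀ p) (A a) (A a))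
      at h
    rw [h]
    ring
  have h1 := hq (a + b)
  have h2 := g.symm p a b
  have h3 := coordMetric_symm g x₀ (extChartAt (𝓡 (d + 1)) x₀ p) (A a) (A b)
  simp only [map_add, add_apply] at h1
  rw [hq a, hq b] at h1
  linarith

theorem liouvilleForm_eq_momentum (g : SmoothMetric d M) {x₀ : M}
    {w : TangentBundle (𝓡 (d + 1)) M} (hw : w.1 ∈ (extChartAt (𝓡 (d + 1)) x₀).source)
    (X : TangentSpace (𝓡 (d + 1)).tangent w) : liouvilleForm g w X =
      momentum (coordMetric g x₀) (tangentCoord x₀ w) (dTangentCoord x₀ w X).1 := by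
  rw [dTangentCoord_fst hw, tangentCoord_eq hw]
  exact inner_eq_coordMetric g hw _ _

/-- The differential of the squared length. -/
def dSqLen (g : SmoothMetric d M) (w : TangentBundle (𝓡 (d + 1)) M) :
    TangentSpace (𝓡 (d + 1)).tangent w →L[ℝ] ℝ :=
  mfderiv (𝓡 (d + 1)).tangent 𝓘(ℝ, ℝ) (sqLen g) w

theorem dSqLen_apply (g : SmoothMetric d M) {x₀ : M} {w : TangentBundle (𝓡 (d + 1)) M}
    (hw : w.1 ∈ (extChartAt (𝓡 (d + 1)) x₀).source) (X : TangentSpace (𝓡 (d + 1)).tangent w) :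
    dSqLen g w X =
      2 * fderiv ℝ (kinetic (coordMetric g x₀)) (tangentCoord x₀ w) (dTangentCoord x₀ w X) := by
  have h1 : HasFDerivAt (fun z => 2 * kinetic (coordMetric g x₀) z)
      ((2 : ℝ) • fderiv ℝ (kinetic (coordMetric g x₀)) (tangentCoord x₀ w)) (tangentCoord x₀ w) :=
    (hasFDerivAt_kinetic (differentiableAt_coordMetric g
      (tangentCoord_mem hw)) (coordMetric_symm g x₀ _)).differentiableAt.hasFDerivAt.const_mul 2
  have h2 := h1.hasMFDerivAt.comp w (hasMFDerivAt_tangentCoord hw)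
  have h3 : sqLen g =ᶠ[𝓝 w] (fun z => 2 * kinetic (coordMetric g x₀) z) ∘ tangentCoord x₀ := by
    filter_upwards [eventually_base_source hw] with u hu using sqLen_eq_kinetic g hu
  have h4 := (h2.congr_of_eventuallyEq h3).mfderiv
  exact congrArg (fun A => A X) h4

/-- The local geodesic flow on `TM`. -/
theorem exists_local_geodesicFlow (g : SmoothMetric d M) (w₀ : TangentBundle (𝓡 (d + 1)) M) :
    ∃ W ∈ 𝓝 w₀, ∃ ε > 0, ∃ Θ : TangentBundle (𝓡 (d + 1)) M × ℝ → TangentBundle (𝓡 (d + 1)) M,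
      IsOpen W ∧ (∀ w ∈ W, Θ (w, 0) = w) ∧ ∀ w ∈ W, ∀ t ∈ Ioo (-ε) ε,
        ContMDiffAt ((𝓡 (d + 1)).tangent.prod 𝓘(ℝ, ℝ)) (𝓡 (d + 1)).tangent 2 Θ (w, t) ∧
        IsGeodesicAt g (fun s => (Θ (w, s)).1) t ∧
        velocity (d := d) (fun s => (Θ (w, s)).1) t = Θ (w, t) ∧
        sqLen g (Θ (w, t)) = sqLen g w ∧
        (∀ X Y : TangentSpace (𝓡 (d + 1)).tangent w, omegaG g (Θ (w, t))
          (mfderiv (𝓡 (d + 1)).tangent (𝓡 (d + 1)).tangent (fun u => Θ (u, t)) w X)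
          (mfderiv (𝓡 (d + 1)).tangent (𝓡 (d + 1)).tangent (fun u => Θ (u, t)) w Y) =
            omegaG g w X Y) ∧
        ∀ X : TangentSpace (𝓡 (d + 1)).tangent w,
          dSqLen g w X = 0 →
          liouvilleForm g (Θ (w, t))
            (mfderiv (𝓡 (d + 1)).tangent (𝓡 (d + 1)).tangent (fun u => Θ (u, t)) w X) =
              liouvilleForm g w X := by
  set x₀ := w₀.1 with hx₀
  have hw₀ : w₀.1 ∈ (extChartAt (𝓡 (d + 1)) x₀).source := mem_extChartAt_source _
  obtain ⟨W, ε, Z, hzW, h⟩ := exists_isLocalSprayFlow (isOpen_extChartAt_target x₀)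
    (contDiffOn_coordMetric g x₀) (fun y _ => coordMetric_symm g x₀ y)
    (fun _ hy _ ha => coordMetric_pos g hy ha) (tangentCoord_mem hw₀)
  set ψ := (extChartAt (𝓡 (d + 1)).tangent (⟨x₀, 0⟩ : TangentBundle (𝓡 (d + 1)) M)).symm with hψ
  have hopen : IsOpen ((extChartAt (𝓡 (d + 1)).tangent
      (⟨x₀, 0⟩ : TangentBundle (𝓡 (d + 1)) M)).source ∩ tangentCoord x₀ ⁻¹' W) :=
    (continuousOn_extChartAt _).isOpen_inter_preimage (isOpen_extChartAt_source _) h.isOpen_source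
  refine ⟨_, hopen.mem_nhds ⟨mem_extChartAt_tangent_source.2 hw₀, hzW⟩, ε, h.eps_pos,
    fun q => ψ (Z (tangentCoord x₀ q.1, q.2)), hopen, ?_, ?_⟩
  · rintro w ⟨hw, hwW⟩
    simp only
    rw [h.map_zero _ hwW]
    exact tangentCoord_left_inv (mem_extChartAt_tangent_source.1 hw)
  · rintro w ⟨hw, hwW⟩ t ht
    have hw' : w.1 ∈ (extChartAt (𝓡 (d + 1)) x₀).source := mem_extChartAt_tangent_source.1 hw
    have hzt : (Z (tangentCoord x₀ w, t)).1 ∈ (extChartAt (𝓡 (d + 1)) x₀).target :=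
      h.mem _ hwW t ht
    have hθ : (ψ (Z (tangentCoord x₀ w, t))).1 ∈ (extChartAt (𝓡 (d + 1)) x₀).source := by
      have := (extChartAt (𝓡 (d + 1)).tangent
        (⟨x₀, 0⟩ : TangentBundle (𝓡 (d + 1)) M)).map_target
          (mem_extChartAt_tangent_target.2 hzt)
      exact mem_extChartAt_tangent_source.1 this
    have hθc : tangentCoord x₀ (ψ (Z (tangentCoord x₀ w, t))) = Z (tangentCoord x₀ w, t) :=
      tangentCoord_right_inv hzt
    have hZc : ContDiffAt ℝ 2 (fun s => Z (tangentCoord x₀ w, s)) t :=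
      (h.contDiffAt hwW ht).comp t (contDiffAt_const.prodMk contDiffAt_id)
    have hgeo := isGeodesicAt_of_hasDerivAt (g := g) (x₀ := x₀) hZc hzt (by
      filter_upwards [isOpen_Ioo.mem_nhds ht] with s hs using h.hasDerivAt _ hwW s hs)
    have hbase : (fun s => (extChartAt (𝓡 (d + 1)) x₀).symm (Z (tangentCoord x₀ w, s)).1) =ᶠ[𝓝 t]
        fun s => (ψ (Z (tangentCoord x₀ w, s))).1 := by
      filter_upwards [isOpen_Ioo.mem_nhds ht] with s hs
      rw [hψ, extChartAt_tangent_symm_apply (w₀ := ⟨x₀, 0⟩) (h.mem _ hwW s hs)]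
    have hsm : ContMDiffAt ((𝓡 (d + 1)).tangent.prod 𝓘(ℝ, ℝ)) (𝓡 (d + 1)).tangent 2
        (fun q : TangentBundle (𝓡 (d + 1)) M × ℝ => ψ (Z (tangentCoord x₀ q.1, q.2))) (w, t) := by
      have h1 : ContMDiffAt ((𝓡 (d + 1)).tangent.prod 𝓘(ℝ, ℝ)) 𝓘(ℝ, (EucModel d × EucModel d) × ℝ)
          2 (fun q : TangentBundle (𝓡 (d + 1)) M × ℝ => (tangentCoord x₀ q.1, q.2)) (w, t) :=
        ContMDiffAt.prodMk_space ((((contMDiffAt_tangentCoord hw').of_le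
          (by norm_cast))).comp (w, t)
          contMDiffAt_fst) contMDiffAt_snd
      exact ContMDiffAt.comp (w, t) (g := ψ) ((contMDiffAt_tangentCoord_symm hzt).of_le
        (by norm_cast)) (ContMDiffAt.comp (w, t) (g := Z) (h.contDiffAt hwW ht).contMDiffAt h1)
    have hsp : MDifferentiableAt (𝓡 (d + 1)).tangent (𝓡 (d + 1)).tangent
        (fun u => ψ (Z (tangentCoord x₀ u, t))) w :=
      (hsm.comp w (f := fun u : TangentBundle (𝓡 (d + 1)) M => (u, t))
        (contMDiffAt_id.prodMk contMDiffAt_const)).mdifferentiableAt (by simp)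
    -- In natural coordinates the differential of the local flow is the coordinate variation, so
    -- both invariance statements reduce to those for `Z`.
    have hD : ∀ X : TangentSpace (𝓡 (d + 1)).tangent w,
        dTangentCoord x₀ (ψ (Z (tangentCoord x₀ w, t))) (mfderiv (𝓡 (d + 1)).tangent
          (𝓡 (d + 1)).tangent (fun u => ψ (Z (tangentCoord x₀ u, t))) w X) =
        IsLocalSprayFlow.variation Z (tangentCoord x₀ w) t (dTangentCoord x₀ w X) := by
      intro X
      have h1 := (hasMFDerivAt_tangentCoord hθ).comp w hsp.hasMFDerivAt
      have h2 := (h.hasFDerivAt_space hwW ht).hasMFDerivAt.comp w (hasMFDerivAt_tangentCoord hw')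
      have h3 : tangentCoord x₀ ∘ (fun u => ψ (Z (tangentCoord x₀ u, t))) =ᶠ[𝓝 w]
          (fun z => Z (z, t)) ∘ tangentCoord x₀ := by
        filter_upwards [hopen.mem_nhds ⟨hw, hwW⟩] with u hu
        exact tangentCoord_right_inv (h.mem _ hu.2 t ht)
      exact congrArg (fun A => A X) (hasMFDerivAt_unique h1 (h2.congr_of_eventuallyEq h3))
    refine ⟨hsm, hgeo.1.congr hbase, (velocity_congr hbase).symm.trans hgeo.2, ?_, ?_, ?_⟩
    · rw [sqLen_eq_kinetic g hθ, sqLen_eq_kinetic g hw']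
      rw [hθc, h.kinetic_const hwW ht]
    · intro X Y
      rw [omegaG_eq_sympl g hθ, omegaG_eq_sympl g hw', hD, hD]
      rw [hθc, h.sympl_variation hwW ht]
    · intro X hX
      rw [dSqLen_apply g hw'] at hX
      rw [liouvilleForm_eq_momentum g hθ, liouvilleForm_eq_momentum g hw', hD]
      rw [hθc, h.momentum_variation hwW ht (by linarith)]

/-! ### The unit sphere bundle as a submanifold of the tangent bundle. -/

theorem mem_sphereTriv_source (g : SmoothMetric d M) (v : UnitTangent M g) :
    v ∈ (sphereTriv g (v.base g)).source :=
  FiberBundle.mem_baseSet_trivializationAt' (F := EucModel d)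
    (E := (TangentSpace (𝓡 (d + 1)) : M → Type _)) (v.base g)

/-- The chart of `SM` at `v` is the trivialisation followed by a product chart; undoing the latter
recovers the trivialisation. -/
theorem contMDiffAt_sphereTriv (g : SmoothMetric d M) (v : UnitTangent M g) :
    ContMDiffAt (unitModel d) (unitModel d) ∞ (sphereTriv g (v.base g)) v := by
  set T := sphereTriv g (v.base g) with hT
  set c := chartAt (ModelProd (EucModel d) (EuclideanSpace ℝ (Fin d))) (T v) with hc
  have hv := mem_sphereTriv_source g v
  have h1 : ContMDiffAt (unitModel d) (unitModel d) ∞ (T.trans c) v :=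
    (contMDiffOn_chart (I := unitModel d) (x := v)).contMDiffAt (chart_source_mem_nhds _ v)
  have h2 : ContMDiffAt (unitModel d) (unitModel d) ∞ c.symm (c (T v)) :=
    (contMDiffOn_chart_symm (I := unitModel d) (x := T v)).contMDiffAt
      (chart_target_mem_nhds _ (T v))
  refine (h2.comp v h1).congr_of_eventuallyEq ?_
  filter_upwards [T.open_source.mem_nhds hv,
    (T.continuousAt hv).eventually (chart_source_mem_nhds
      (ModelProd (EucModel d) (EuclideanSpace ℝ (Fin d))) (T v))] with u hu hu'
  exact (c.left_inv hu').symm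

theorem contMDiffAt_sphereTriv_symm (g : SmoothMetric d M) (v : UnitTangent M g) :
    ContMDiffAt (unitModel d) (unitModel d) ∞ (sphereTriv g (v.base g)).symm
      (sphereTriv g (v.base g) v) := by
  set T := sphereTriv g (v.base g) with hT
  set c := chartAt (ModelProd (EucModel d) (EuclideanSpace ℝ (Fin d))) (T v) with hc
  have hv := mem_sphereTriv_source g v
  have h1 : ContMDiffAt (unitModel d) (unitModel d) ∞ (T.trans c).symm (c (T v)) :=
    (contMDiffOn_chart_symm (I := unitModel d) (x := v)).contMDiffAt (chart_target_mem_nhds _ v)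
  have h2 : ContMDiffAt (unitModel d) (unitModel d) ∞ c (T v) :=
    (contMDiffOn_chart (I := unitModel d) (x := T v)).contMDiffAt
      (chart_source_mem_nhds _ (T v))
  refine (h1.comp (T v) h2).congr_of_eventuallyEq ?_
  filter_upwards [chart_source_mem_nhds (ModelProd (EucModel d) (EuclideanSpace ℝ (Fin d)))
    (T v)] with u hu
  exact congrArg T.symm (c.left_inv hu).symm

theorem contMDiff_incl (g : SmoothMetric d M) :
    ContMDiff (unitModel d) (𝓡 (d + 1)).tangent ∞ (UnitTangent.incl g) := by
  intro v
  set T := sphereTriv g (v.base g) with hT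
  have hv := mem_sphereTriv_source g v
  have h1 := (contMDiffOn_sphereTriv_symm g (v.base g)).contMDiffAt
    (T.open_target.mem_nhds (T.map_source hv))
  refine (h1.comp v (contMDiffAt_sphereTriv g v)).congr_of_eventuallyEq ?_
  filter_upwards [T.open_source.mem_nhds hv] with u hu
  exact congrArg (UnitTangent.incl g) (T.left_inv hu).symm

/-- Near each of its points, `SM` is a smooth retract of `TM`. -/
theorem exists_retraction (g : SmoothMetric d M) (v : UnitTangent M g) :
    ∃ r : TangentBundle (𝓡 (d + 1)) M → UnitTangent M g,
      ContMDiffAt (𝓡 (d + 1)).tangent (unitModel d) ∞ r (v.incl g) ∧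
        ∀ᶠ u in 𝓝 v, r (u.incl g) = u := by
  set e := trivializationAt (EucModel d) (TangentSpace (𝓡 (d + 1)) : M → Type _) (v.base g) with he
  set T := sphereTriv g (v.base g) with hT
  have hv := mem_sphereTriv_source g v
  have hb : v.1.1 ∈ e.baseSet := hv
  have hs : v.1 ∈ e.source := e.mem_source.2 hb
  have h2 : ContMDiffAt (𝓡 (d + 1)).tangent ((𝓡 (d + 1)).prod 𝓘(ℝ, EucModel d)) ∞ e v.1 :=
    (e.contMDiffOn v.1 hs).contMDiffAt (e.open_source.mem_nhds hs)
  have h3 : ContMDiffAt (𝓡 (d + 1)).tangent (𝓡 d) ∞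
      (fun w : TangentBundle (𝓡 (d + 1)) M => radialProj d (e w).2) v.1 :=
    (contMDiffAt_radialProj (triv_snd_ne_zero hb (incl_snd_ne_zero g v))).comp v.1
      (contMDiffAt_snd.comp v.1 h2)
  have h4 : ContMDiffAt (𝓡 (d + 1)).tangent (unitModel d) ∞
      (fun w : TangentBundle (𝓡 (d + 1)) M => (w.1, radialProj d (e w).2)) v.1 :=
    (contMDiffAt_proj _).prodMk h3
  refine ⟨fun w => T.symm (w.1, radialProj d (e w).2), ?_, ?_⟩
  · exact ContMDiffAt.comp (g := T.symm) v.1 (contMDiffAt_sphereTriv_symm g v) h4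
  · filter_upwards [T.open_source.mem_nhds hv] with u hu
    exact T.left_inv hu

theorem continuousAt_of_incl {g : SmoothMetric d M} {N : Type*} [TopologicalSpace N]
    {f : N → UnitTangent M g} {x : N} (hf : ContinuousAt (fun y => (f y).incl g) x) :
    ContinuousAt f x :=
  (Topology.IsInducing.subtypeVal (t := {v : TangentBundle (𝓡 (d + 1)) M |
    sqLen g v = 1})).continuousAt_iff.2 hf

/-- Regularity of a map into `SM` can be tested in `TM`: locally the map is its composite with the
inclusion, followed by the smooth retraction. -/
theorem contMDiffAt_of_incl {g : SmoothMetric d M} {F H N : Type*} [NormedAddCommGroup F]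
    [NormedSpace ℝ F] [TopologicalSpace H] {J : ModelWithCorners ℝ F H} [TopologicalSpace N]
    [ChartedSpace H N] {f : N → UnitTangent M g} {x : N}
    (hf : ContMDiffAt J (𝓡 (d + 1)).tangent 2 (fun y => (f y).incl g) x) :
    ContMDiffAt J (unitModel d) 2 f x := by
  obtain ⟨r, hr, hr'⟩ := exists_retraction g (f x)
  refine (ContMDiffAt.comp x (g := r) (hr.of_le (by norm_cast)) hf).congr_of_eventuallyEq ?_
  filter_upwards [(continuousAt_of_incl hf.continuousAt).eventually hr'] with y hy
  exact hy.symm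

theorem hasMFDerivAt_incl (g : SmoothMetric d M) (v : UnitTangent M g) :
    HasMFDerivAt (unitModel d) (𝓡 (d + 1)).tangent (UnitTangent.incl g) v (dIncl g v) :=
  ((contMDiff_incl g v).mdifferentiableAt (by simp)).hasMFDerivAt

theorem dIncl_injective (g : SmoothMetric d M) (v : UnitTangent M g) :
    Function.Injective (dIncl g v) := by
  obtain ⟨r, hr, hr'⟩ := exists_retraction g v
  have h1 := (hr.mdifferentiableAt (by simp)).hasMFDerivAt.comp v (hasMFDerivAt_incl g v)
  have h2 := hasMFDerivAt_unique h1 ((hasMFDerivAt_id v).congr_of_eventuallyEq hr')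
  exact Function.LeftInverse.injective (g := mfderiv (𝓡 (d + 1)).tangent (unitModel d) r (v.incl g))
    fun X => congrArg (fun A => A X) h2

theorem hasMFDerivAt_baseTM (w : TangentBundle (𝓡 (d + 1)) M) :
    HasMFDerivAt (𝓡 (d + 1)).tangent (𝓡 (d + 1)) (fun u : TangentBundle (𝓡 (d + 1)) M => u.1) w
      (dBaseTM w) :=
  ((contMDiffAt_proj (n := ∞) _).mdifferentiableAt (by simp)).hasMFDerivAt

theorem dBaseTM_dIncl (g : SmoothMetric d M) (v : UnitTangent M g)
    (X : TangentSpace (unitModel d) v) : dBaseTM (v.incl g) (dIncl g v X) = dBase g v X :=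
  (congrArg (fun A => A X)
    ((hasMFDerivAt_baseTM (v.incl g)).comp v (hasMFDerivAt_incl g v)).mfderiv).symm

theorem hasMFDerivAt_base (g : SmoothMetric d M) (v : UnitTangent M g) :
    HasMFDerivAt (unitModel d) (𝓡 (d + 1)) (UnitTangent.base g) v (dBase g v) :=
  ((hasMFDerivAt_baseTM (v.incl g)).comp v
    (hasMFDerivAt_incl g v)).mdifferentiableAt.hasMFDerivAt

theorem hasMFDerivAt_sqLen (g : SmoothMetric d M) (w : TangentBundle (𝓡 (d + 1)) M) :
    HasMFDerivAt (𝓡 (d + 1)).tangent 𝓘(ℝ, ℝ) (sqLen g) w (dSqLen g w) :=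
  ((contMDiff_sqLen g w).mdifferentiableAt (by simp)).hasMFDerivAt

theorem dSqLen_dIncl (g : SmoothMetric d M) (v : UnitTangent M g)
    (X : TangentSpace (unitModel d) v) : dSqLen g (v.incl g) (dIncl g v X) = 0 := by
  have h1 := (hasMFDerivAt_sqLen g (v.incl g)).comp v (hasMFDerivAt_incl g v)
  have h2 : sqLen g ∘ UnitTangent.incl g = fun _ => (1 : ℝ) := funext fun u => u.2
  rw [h2] at h1
  have h3 := hasMFDerivAt_unique h1 (hasMFDerivAt_const (1 : ℝ) v)
  exact congrArg (fun A => A X) h3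

/-- The squared length is quadratic on fibres, so its derivative along the radial vertical vector is
twice the squared length. -/
theorem dSqLen_ne_zero (g : SmoothMetric d M) {w : TangentBundle (𝓡 (d + 1)) M}
    (hw : w.2 ≠ 0) : dSqLen g w ≠ 0 := by
  intro h0
  have hs : w.1 ∈ (extChartAt (𝓡 (d + 1)) w.1).source := mem_extChartAt_source _
  obtain ⟨X, hX⟩ := (bijective_dTangentCoord hs).2 ((0 : EucModel d), (tangentCoord w.1 w).2)
  have h1 := dSqLen_apply g hs X
  rw [h0, hX, fderiv_kinetic_apply (differentiableAt_coordMetric g (tangentCoord_mem hs))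
    (coordMetric_symm g _ _)] at h1
  have h2 := sqLen_eq_kinetic g hs
  have h3 := sqLen_pos g hw
  rw [h2, kinetic] at h3
  have h4 : (0 : ℝ) = 2 * momentum (coordMetric g w.1) (tangentCoord w.1 w)
      (tangentCoord w.1 w).2 := by
    simpa using h1
  rw [momentum] at h4
  linarith

/-- The image of `dIncl` lies in the kernel of the nonzero functional `dSqLen`, and both have
dimension `2d + 1`. -/
theorem exists_dIncl_eq (g : SmoothMetric d M) (v : UnitTangent M g)
    {Y : TangentSpace (𝓡 (d + 1)).tangent (v.incl g)} (hY : dSqLen g (v.incl g) Y = 0) :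
    ∃ X, dIncl g v X = Y := by
  let A : (EucModel d × EuclideanSpace ℝ (Fin d)) →ₗ[ℝ] (EucModel d × EucModel d) :=
    (dIncl g v).toLinearMap
  let L : (EucModel d × EucModel d) →ₗ[ℝ] ℝ := (dSqLen g (v.incl g)).toLinearMap
  have hA : Function.Injective A := dIncl_injective g v
  have hL : L ≠ 0 := by
    intro h
    exact dSqLen_ne_zero g (incl_snd_ne_zero g v)
      (ContinuousLinearMap.ext fun X => LinearMap.congr_fun h X)
  have hle : LinearMap.range A ≤ LinearMap.ker L := by
    rintro _ ⟨X, rfl⟩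
    exact dSqLen_dIncl g v X
  have h1 : Module.finrank ℝ (LinearMap.range A) = (d + 1) + d := by
    rw [LinearMap.finrank_range_of_inj hA]
    simp
  have h2 : Module.finrank ℝ (LinearMap.range L) = 1 := by
    rw [LinearMap.range_eq_top.2 (LinearMap.surjective hL)]
    simp
  have h3 := L.finrank_range_add_finrank_ker
  have h4 : Module.finrank ℝ (EucModel d × EucModel d) = (d + 1) + (d + 1) := by simp
  have heq := Submodule.eq_of_le_of_finrank_eq hle (by omega)
  have : (Y : EucModel d × EucModel d) ∈ LinearMap.ker L := hY
  rw [← heq] at this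
  exact this

/-! ### Compactness of the sphere bundle and geodesic completeness. -/

/-- Finitely many compact sets, each inside a trivialising domain, cover `M`; over each of them `SM`
is the image of a compact product with the sphere. -/
instance compactSpace_unitTangent [T2Space M] [CompactSpace M] (g : SmoothMetric d M) :
    CompactSpace (UnitTangent M g) := by
  have hK : ∀ x₀ : M, ∃ K ∈ 𝓝 x₀, IsCompact K ∧
      K ⊆ (trivializationAt (EucModel d) (TangentSpace (𝓡 (d + 1)) : M → Type _) x₀).baseSet := by
    intro x₀
    obtain ⟨K, hK, hsub, hc⟩ := local_compact_nhds ((trivializationAt (EucModel d)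
      (TangentSpace (𝓡 (d + 1)) : M → Type _) x₀).open_baseSet.mem_nhds
        (FiberBundle.mem_baseSet_trivializationAt' x₀))
    exact ⟨K, hK, hc, hsub⟩
  choose K hKn hKc hKs using hK
  obtain ⟨t, ht⟩ := CompactSpace.elim_nhds_subcover K hKn
  refine ⟨?_⟩
  have h1 : IsCompact (⋃ x₀ ∈ t, (sphereTriv g x₀).symm '' (K x₀ ×ˢ univ)) := by
    refine t.isCompact_biUnion fun x₀ _ => ((hKc x₀).prod isCompact_univ).image_of_continuousOn ?_
    exact (sphereTriv g x₀).continuousOn_symm.mono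
      (prod_mono (hKs x₀) Subset.rfl : _ ⊆ _ ×ˢ univ)
  refine h1.of_isClosed_subset isClosed_univ fun v _ => ?_
  have hv : v.base g ∈ ⋃ x ∈ t, K x := by rw [ht]; exact mem_univ _
  obtain ⟨x₀, hx₀, hvx⟩ := mem_iUnion₂.1 hv
  refine mem_iUnion₂.2 ⟨x₀, hx₀, sphereTriv g x₀ v, ⟨hvx, mem_univ _⟩, ?_⟩
  exact (sphereTriv g x₀).left_inv (hKs x₀ hvx)

theorem UnitTangent.ext_incl {g : SmoothMetric d M} {v v' : UnitTangent M g}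
    (h : v.incl g = v'.incl g) : v = v' := Subtype.ext h

/-- Unit speed geodesics exist for a uniform time. -/
theorem exists_uniform_geodesic [T2Space M] [CompactSpace M] (g : SmoothMetric d M) :
    ∃ ε > 0, ∀ v : UnitTangent M g, ∃ γ : ℝ → M, velocity γ 0 = v.incl g ∧
      ∀ t ∈ Ioo (-ε) ε, IsGeodesicAt g γ t ∧ sqLen g (velocity γ t) = 1 := by
  have key : ∃ ε > 0, ∀ v ∈ (univ : Set (UnitTangent M g)), ∃ γ : ℝ → M,
      velocity γ 0 = v.incl g ∧
        ∀ t ∈ Ioo (-ε) ε, IsGeodesicAt g γ t ∧ sqLen g (velocity γ t) = 1 := by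
    -- Having a common existence time passes to subsets and to unions of two sets, and holds near
    -- each point, so compactness gives it on all of `SM`.
    refine isCompact_univ.induction_on (p := fun S => ∃ ε > 0, ∀ v ∈ S, ∃ γ : ℝ → M,
      velocity γ 0 = UnitTangent.incl g v ∧
        ∀ t ∈ Ioo (-ε) ε, IsGeodesicAt g γ t ∧ sqLen g (velocity γ t) = 1)
      ⟨1, one_pos, fun v hv => hv.elim⟩ ?_ ?_ ?_
    · rintro S S' hS ⟨ε, hε, h⟩
      exact ⟨ε, hε, fun v hv => h v (hS hv)⟩
    · rintro S S' ⟨ε, hε, h⟩ ⟨ε', hε', h'⟩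
      refine ⟨min ε ε', lt_min hε hε', fun v hv => ?_⟩
      rcases hv with hv | hv
      · obtain ⟨γ, h0, h1⟩ := h v hv
        exact ⟨γ, h0, fun t ht => h1 t ⟨by linarith [ht.1, min_le_left ε ε'],
          ht.2.trans_le (min_le_left _ _)⟩⟩
      · obtain ⟨γ, h0, h1⟩ := h' v hv
        exact ⟨γ, h0, fun t ht => h1 t ⟨by linarith [ht.1, min_le_right ε ε'],
          ht.2.trans_le (min_le_right _ _)⟩⟩
    · intro v₀ _
      obtain ⟨W, hW, ε, hε, Θ, -, h0, h⟩ := exists_local_geodesicFlow g (v₀.incl g)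
      refine ⟨UnitTangent.incl g ⁻¹' W, mem_nhdsWithin_of_mem_nhds
        ((contMDiff_incl g).continuous.continuousAt hW), ε, hε, fun v hv => ?_⟩
      refine ⟨fun s => (Θ (v.incl g, s)).1, ?_, fun t ht => ?_⟩
      · rw [(h _ hv 0 ⟨by linarith, hε⟩).2.2.1, h0 _ hv]
      · obtain ⟨-, h1, h2, h3, -⟩ := h _ hv t ht
        exact ⟨h1, by rw [h2, h3]; exact v.2⟩
  obtain ⟨ε, hε, h⟩ := key
  exact ⟨ε, hε, fun v => h v (mem_univ v)⟩

/-- Geodesic completeness: unit speed geodesics are defined for all times. -/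
theorem exists_isGeodesic [T2Space M] [CompactSpace M] (g : SmoothMetric d M)
    (v : UnitTangent M g) : ∃ γ : ℝ → M, IsGeodesic g γ ∧ velocity γ 0 = v.incl g ∧
      ∀ t, sqLen g (velocity γ t) = 1 := by
  obtain ⟨ε, hε, h⟩ := exists_uniform_geodesic g
  choose c hc0 hc using h
  -- Steps have half the guaranteed length, so that consecutive pieces overlap and the glued curve
  -- is a geodesic at the junctions too.
  obtain ⟨δ, hδ, hδε⟩ : ∃ δ : ℝ, 0 < δ ∧ ε = 2 * δ := ⟨ε / 2, by linarith, by ring⟩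
  have hshift : ∀ (v v' : UnitTangent M g) (r : ℝ), |r| ≤ δ →
      velocity (c v) r = v'.incl g → ∀ s, |s| ≤ δ → |s + r| ≤ δ →
        velocity (d := d) (c v') s = velocity (c v) (s + r) := by
    intro v v' r hr hv s hs hsr
    rw [abs_le] at hr hs hsr
    have hmem : ∀ {t}, t ∈ Ioo (-ε) ε ∩ Ioo (-ε - r) (ε - r) → t + r ∈ Ioo (-ε) ε := by
      rintro t ⟨-, h1, h2⟩
      constructor <;> linarith
    have hd : ∀ t, t ∈ Ioo (-ε) ε ∩ Ioo (-ε - r) (ε - r) →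
        velocity (d := d) (fun s => c v (s + r)) t = velocity (c v) (t + r) := fun t ht =>
      velocity_comp_add (hc v _ (hmem ht)).1.mdifferentiableAt
    have h0 : (0 : ℝ) ∈ Ioo (-ε) ε ∩ Ioo (-ε - r) (ε - r) := by
      constructor <;> constructor <;> linarith [hr.1, hr.2]
    have hs' : s ∈ Ioo (-ε) ε ∩ Ioo (-ε - r) (ε - r) := by
      constructor <;> constructor <;> linarith [hs.1, hs.2, hsr.1, hsr.2]
    rw [← hd s hs']
    refine eqOn_velocity_of_isGeodesicAt (g := g) (isOpen_Ioo.inter isOpen_Ioo)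
      ((ordConnected_Ioo.inter ordConnected_Ioo).isPreconnected) (fun t ht => (hc v' t ht.1).1)
      (fun t ht => (hc v (t + r) (hmem ht)).1.comp_add) h0 ?_ hs'
    rw [hd 0 h0, hc0, zero_add, hv]
  -- The time-`r` map on `SM`. The default branch is not taken for `|r| ≤ δ`, where the pieces have
  -- unit speed.
  let φ : ℝ → UnitTangent M g → UnitTangent M g := fun r v =>
    if h : sqLen g (velocity (c v) r) = 1 then ⟨velocity (c v) r, h⟩ else v
  have hφ : ∀ r v, |r| ≤ δ → (φ r v).incl g = velocity (c v) r := by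
    intro r v hr
    rw [abs_le] at hr
    have h1 := (hc v r ⟨by linarith, by linarith⟩).2
    have h2 : φ r v = ⟨velocity (c v) r, h1⟩ := dif_pos h1
    rw [h2]
    rfl
  have hδa : |δ| ≤ δ := (abs_of_pos hδ).le
  have hδn : |-δ| ≤ δ := by rwa [abs_neg]
  have hinv : ∀ r v, |r| ≤ δ → φ (-r) (φ r v) = v := by
    intro r v hr
    apply UnitTangent.ext_incl
    rw [hφ _ _ (by rwa [abs_neg]), hshift v (φ r v) r hr (hφ r v hr).symm (-r) (by rwa [abs_neg])
      (by simpa using hδ.le), neg_add_cancel, hc0]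
  -- Since the time-`δ` map is invertible, its integer powers provide starting vectors for negative
  -- times as well.
  let P : Equiv.Perm (UnitTangent M g) :=
    ⟨φ δ, φ (-δ), fun v => hinv δ v hδa, fun v => by simpa using hinv (-δ) v hδn⟩
  let w : ℤ → UnitTangent M g := fun k => (P ^ k) v
  have hw : ∀ k, velocity (c (w k)) δ = (w (k + 1)).incl g := by
    intro k
    have : w (k + 1) = φ δ (w k) := by
      simp only [w]
      rw [add_comm, zpow_add, zpow_one]
      rfl
    rw [this, hφ _ _ hδa]
  let γ : ℝ → M := fun t => c (w ⌊t / δ⌋) (t - ⌊t / δ⌋ * δ)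
  -- The floor selects piece `k` only to the right of `kδ`. To the left it selects piece `k - 1`,
  -- which agrees with piece `k` there by `hshift`.
  have hγ : ∀ (k : ℤ) (t : ℝ), |t - k * δ| < δ → γ t = c (w k) (t + -(k * δ)) := by
    intro k t ht
    rw [abs_lt] at ht
    have h1 : (k : ℝ) - 1 < t / δ := by rw [lt_div_iff₀ hδ]; linarith
    have h2 : t / δ < k + 1 := by rw [div_lt_iff₀ hδ]; linarith
    rcases le_or_gt (k : ℝ) (t / δ) with h3 | h3
    · have : ⌊t / δ⌋ = k := Int.floor_eq_iff.2 ⟨h3, h2⟩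
      simp only [γ, this, sub_eq_add_neg]
    · have h4 : ⌊t / δ⌋ = k - 1 := Int.floor_eq_iff.2 ⟨by push_cast; linarith, by
        push_cast; linarith⟩
      have h5 : t < k * δ := by rwa [div_lt_iff₀ hδ] at h3
      have h6 := hw (k - 1)
      rw [sub_add_cancel] at h6
      have h7 := hshift (w (k - 1)) (w k) δ hδa h6 (t + -(k * δ))
        (abs_le.2 ⟨by linarith, by linarith⟩) (abs_le.2 ⟨by linarith, by linarith⟩)
      have h8 : c (w k) (t + -(k * δ)) = c (w (k - 1)) (t + -(k * δ) + δ) :=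
        congrArg (fun w : TangentBundle (𝓡 (d + 1)) M => w.1) h7
      simp only [γ, h4]
      rw [h8]
      congr 1
      push_cast
      ring
  have hγ' : ∀ t, ∃ k : ℤ, t + -(k * δ) ∈ Ioo (-ε) ε ∧
      (fun s => c (w k) (s + -(k * δ))) =ᶠ[𝓝 t] γ := by
    intro t
    have h1 : (⌊t / δ⌋ : ℝ) * δ ≤ t := by rw [← le_div_iff₀ hδ]; exact Int.floor_le _
    have h2 : t < (⌊t / δ⌋ + 1 : ℝ) * δ := by rw [← div_lt_iff₀ hδ]; exact Int.lt_floor_add_one _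
    refine ⟨⌊t / δ⌋, ⟨by linarith, by linarith⟩, ?_⟩
    filter_upwards [isOpen_Ioo.mem_nhds (show t ∈ Ioo (⌊t / δ⌋ * δ - δ) (⌊t / δ⌋ * δ + δ) from
      ⟨by linarith, by linarith⟩)] with s hs
    exact (hγ _ s (abs_lt.2 ⟨by linarith [hs.1], by linarith [hs.2]⟩)).symm
  refine ⟨γ, isGeodesic_iff.2 fun t => ?_, ?_, fun t => ?_⟩
  · obtain ⟨k, hk, he⟩ := hγ' t
    exact ((hc (w k) _ hk).1.comp_add).congr he
  · have he : (fun s => c (w 0) (s + 0)) =ᶠ[𝓝 0] γ := by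
      filter_upwards [isOpen_Ioo.mem_nhds (show (0 : ℝ) ∈ Ioo (-δ) δ from
        ⟨by linarith, hδ⟩)] with s hs
      rw [hγ 0 s (by rw [abs_lt]; simpa using hs)]
      simp
    rw [← velocity_congr he]
    simp only [add_zero]
    rw [hc0]
    rfl
  · obtain ⟨k, hk, he⟩ := hγ' t
    rw [← velocity_congr he, velocity_comp_add (hc (w k) _ hk).1.mdifferentiableAt]
    exact (hc (w k) _ hk).2

/-! ### The geodesic flow and its group law. -/

section Flow

variable [T2Space M] [CompactSpace M] (g : SmoothMetric d M)

theorem isGeodesic_geodesic (v : UnitTangent M g) :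
    IsGeodesic g (geodesic g (v.incl g)) ∧ velocity (geodesic g (v.incl g)) 0 = v.incl g := by
  obtain ⟨γ, h1, h2, -⟩ := exists_isGeodesic g v
  have h : ∃ γ : ℝ → M, IsGeodesic g γ ∧ velocity γ 0 = v.incl g := ⟨γ, h1, h2⟩
  rw [geodesic, dif_pos h]
  exact h.choose_spec

/-- By uniqueness the chosen geodesic has the velocities of a unit speed one, so the default branch
of `geodesicFlow` is never reached. -/
theorem incl_geodesicFlow (v : UnitTangent M g) (s : ℝ) :
    (geodesicFlow g (v, s)).incl g = velocity (geodesic g (v.incl g)) s := by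
  obtain ⟨γ, h1, h2, h3⟩ := exists_isGeodesic g v
  obtain ⟨h4, h5⟩ := isGeodesic_geodesic g v
  have h6 : velocity (d := d) (geodesic g (v.incl g)) s = velocity γ s :=
    eqOn_velocity_of_isGeodesicAt (g := g) isOpen_univ isPreconnected_univ
      (fun t _ => isGeodesic_iff.1 h4 t) (fun t _ => isGeodesic_iff.1 h1 t) (mem_univ 0)
      (h5.trans h2.symm) (mem_univ s)
  have h7 : sqLen g (velocity (geodesic g (v.incl g)) s) = 1 := by rw [h6, h3]
  have h8 : geodesicFlow g (v, s) = ⟨velocity (geodesic g (v.incl g)) s, h7⟩ := dif_pos h7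
  rw [h8]
  rfl

variable {g}

theorem incl_geodesicFlow_eq {v : UnitTangent M g} {γ : ℝ → M} {J : Set ℝ} (hJ : IsOpen J)
    (hJc : IsPreconnected J) (hγ : ∀ t ∈ J, IsGeodesicAt g γ t) (h0 : (0 : ℝ) ∈ J)
    (hv : velocity γ 0 = v.incl g) {s : ℝ} (hs : s ∈ J) :
    (geodesicFlow g (v, s)).incl g = velocity γ s := by
  obtain ⟨h4, h5⟩ := isGeodesic_geodesic g v
  rw [incl_geodesicFlow]
  exact eqOn_velocity_of_isGeodesicAt (g := g) hJ hJc (fun t _ => isGeodesic_iff.1 h4 t) hγ h0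
    (h5.trans hv.symm) hs

variable (g)

theorem geodesicFlow_zero (v : UnitTangent M g) : geodesicFlow g (v, 0) = v :=
  UnitTangent.ext_incl (by rw [incl_geodesicFlow, (isGeodesic_geodesic g v).2])

theorem geodesicFlow_add (v : UnitTangent M g) (s t : ℝ) :
    geodesicFlow g (v, t + s) = geodesicFlow g (geodesicFlow g (v, s), t) := by
  have h1 := isGeodesic_iff.1 (isGeodesic_geodesic g v).1
  apply UnitTangent.ext_incl
  rw [incl_geodesicFlow, incl_geodesicFlow_eq (v := geodesicFlow g (v, s))
    (γ := fun t => geodesic g (v.incl g) (t + s)) isOpen_univ isPreconnected_univ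
    (fun t _ => (h1 (t + s)).comp_add) (mem_univ 0) ?_ (mem_univ t),
    velocity_comp_add (h1 _).mdifferentiableAt]
  rw [velocity_comp_add (h1 _).mdifferentiableAt, zero_add, incl_geodesicFlow]

end Flow

/-! ### Regularity of the geodesic flow and invariance of the forms at all times. -/

/-- At `v`, the map `f : SM → SM` is differentiable and preserves the restrictions to `SM` of the
Liouville form and of the symplectic form. -/
structure PreservesFormsAt (g : SmoothMetric d M) (f : UnitTangent M g → UnitTangent M g)
    (v : UnitTangent M g) : Prop where
  mdifferentiableAt : MDifferentiableAt (unitModel d) (unitModel d) f v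
  liouville : ∀ X : TangentSpace (unitModel d) v,
    liouvilleForm g ((f v).incl g) (dIncl g (f v) (mfderiv (unitModel d) (unitModel d) f v X)) =
      liouvilleForm g (v.incl g) (dIncl g v X)
  omega : ∀ X Y : TangentSpace (unitModel d) v,
    omegaG g ((f v).incl g) (dIncl g (f v) (mfderiv (unitModel d) (unitModel d) f v X))
        (dIncl g (f v) (mfderiv (unitModel d) (unitModel d) f v Y)) =
      omegaG g (v.incl g) (dIncl g v X) (dIncl g v Y)

theorem PreservesFormsAt.comp {g : SmoothMetric d M} {f h : UnitTangent M g → UnitTangent M g}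
    {v : UnitTangent M g} (hh : PreservesFormsAt g h (f v)) (hf : PreservesFormsAt g f v) :
    PreservesFormsAt g (h ∘ f) v := by
  have h1 : ∀ X : TangentSpace (unitModel d) v, mfderiv (unitModel d) (unitModel d) (h ∘ f) v X =
      mfderiv (unitModel d) (unitModel d) h (f v) (mfderiv (unitModel d) (unitModel d) f v X) :=
    fun X => congrArg (fun A => A X) (mfderiv_comp v hh.mdifferentiableAt hf.mdifferentiableAt)
  refine ⟨hh.mdifferentiableAt.comp v hf.mdifferentiableAt, fun X => ?_, fun X Y => ?_⟩
  · rw [h1, ← hf.liouville, ← hh.liouville]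
    rfl
  · rw [h1, h1, ← hf.omega, ← hh.omega]
    rfl

/-- All tangent spaces unfold to the model space; taking the vectors there allows the base point to
be replaced by an equal one. -/
theorem omegaG_congr (g : SmoothMetric d M) {w w' : TangentBundle (𝓡 (d + 1)) M} (h : w = w')
    {X X' Y Y' : EucModel d × EucModel d} (hX : X = X') (hY : Y = Y') :
    omegaG g w X Y = omegaG g w' X' Y' := by
  subst h hX hY
  rfl

theorem liouvilleForm_congr (g : SmoothMetric d M) {w w' : TangentBundle (𝓡 (d + 1)) M}
    (h : w = w') {X X' : EucModel d × EucModel d} (hX : X = X') :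
    liouvilleForm g w X = liouvilleForm g w' X' := by
  subst h hX
  rfl

section Flow

variable [T2Space M] [CompactSpace M] (g : SmoothMetric d M)

/-- The regularity and invariance properties of the geodesic flow for small times. -/
theorem exists_local_contMDiffAt_geodesicFlow (v₀ : UnitTangent M g) :
    ∃ W ∈ 𝓝 v₀, ∃ ε > 0, ∀ v ∈ W, ∀ t ∈ Ioo (-ε) ε,
      ContMDiffAt ((unitModel d).prod 𝓘(ℝ, ℝ)) (unitModel d) 2 (geodesicFlow g) (v, t) ∧
        PreservesFormsAt g (fun u => geodesicFlow g (u, t)) v := by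
  obtain ⟨W, hW, ε, hε, Θ, hWo, h0, h⟩ := exists_local_geodesicFlow g (v₀.incl g)
  refine ⟨UnitTangent.incl g ⁻¹' W, (contMDiff_incl g).continuous.continuousAt hW, ε, hε,
    fun v hv t ht => ?_⟩
  have h00 : (0 : ℝ) ∈ Ioo (-ε) ε := ⟨by linarith, hε⟩
  -- Uniqueness identifies the globally defined flow with the local flow of `TM`, whose regularity
  -- and invariance are known.
  have key : ∀ u : UnitTangent M g, u.incl g ∈ W → ∀ s ∈ Ioo (-ε) ε,
      (geodesicFlow g (u, s)).incl g = Θ (u.incl g, s) := by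
    intro u hu s hs
    rw [incl_geodesicFlow_eq (γ := fun s => (Θ (u.incl g, s)).1) isOpen_Ioo isPreconnected_Ioo
      (fun t ht => (h _ hu t ht).2.1) h00 ?_ hs, (h _ hu s hs).2.2.1]
    rw [(h _ hu 0 h00).2.2.1, h0 _ hu]
  have hinc : ContMDiffAt ((unitModel d).prod 𝓘(ℝ, ℝ)) ((𝓡 (d + 1)).tangent.prod 𝓘(ℝ, ℝ)) 2
      (fun q : UnitTangent M g × ℝ => (q.1.incl g, q.2)) (v, t) :=
    ((((contMDiff_incl g).of_le (by norm_cast)).comp contMDiff_fst).prodMk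
      contMDiff_snd).contMDiffAt
  have hWv : ∀ᶠ u : UnitTangent M g in 𝓝 v, u.incl g ∈ W :=
    (contMDiff_incl g).continuous.continuousAt (hWo.mem_nhds hv)
  have hΘ := h _ hv t ht
  have hsm : ContMDiffAt ((unitModel d).prod 𝓘(ℝ, ℝ)) (unitModel d) 2 (geodesicFlow g) (v, t) := by
    refine contMDiffAt_of_incl ((ContMDiffAt.comp (v, t) (g := Θ) hΘ.1
      hinc).congr_of_eventuallyEq ?_)
    filter_upwards [hWv.prod_nhds (isOpen_Ioo.mem_nhds ht)] with q hq
    exact key q.1 hq.1 q.2 hq.2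
  have hd : MDifferentiableAt (unitModel d) (unitModel d) (fun u => geodesicFlow g (u, t)) v :=
    (hsm.comp v (f := fun u : UnitTangent M g => (u, t))
      (contMDiffAt_id.prodMk contMDiffAt_const)).mdifferentiableAt (by simp)
  have hdΘ : MDifferentiableAt (𝓡 (d + 1)).tangent (𝓡 (d + 1)).tangent (fun u => Θ (u, t))
      (v.incl g) :=
    (hΘ.1.comp (v.incl g) (f := fun u : TangentBundle (𝓡 (d + 1)) M => (u, t))
      (contMDiffAt_id.prodMk contMDiffAt_const)).mdifferentiableAt (by simp)
  have hpt := key v hv t ht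
  have h1 := (hasMFDerivAt_incl g (geodesicFlow g (v, t))).comp v hd.hasMFDerivAt
  have h2 := hdΘ.hasMFDerivAt.comp v (hasMFDerivAt_incl g v)
  have h3 : UnitTangent.incl g ∘ (fun u => geodesicFlow g (u, t)) =ᶠ[𝓝 v]
      (fun u => Θ (u, t)) ∘ UnitTangent.incl g := by
    filter_upwards [hWv] with u hu using key u hu t ht
  have hD : ∀ X : TangentSpace (unitModel d) v, (dIncl g (geodesicFlow g (v, t))
      (mfderiv (unitModel d) (unitModel d) (fun u => geodesicFlow g (u, t)) v X) :
        EucModel d × EucModel d) = mfderiv (𝓡 (d + 1)).tangent (𝓡 (d + 1)).tangent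
          (fun u => Θ (u, t)) (v.incl g) (dIncl g v X) := fun X =>
    congrArg (fun A : EucModel d × EuclideanSpace ℝ (Fin d) →L[ℝ] EucModel d × EucModel d => A X)
      (hasMFDerivAt_unique h1 (h2.congr_of_eventuallyEq h3))
  refine ⟨hsm, hd, fun X => ?_, fun X Y => ?_⟩
  · rw [← hΘ.2.2.2.2.2 _ (dSqLen_dIncl g v X)]
    exact liouvilleForm_congr g hpt (hD X)
  · rw [← hΘ.2.2.2.2.1]
    exact omegaG_congr g hpt (hD X) (hD Y)

theorem exists_uniform_contMDiffAt_geodesicFlow :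
    ∃ ε > 0, ∀ v : UnitTangent M g, ∀ t ∈ Ioo (-ε) ε,
      ContMDiffAt ((unitModel d).prod 𝓘(ℝ, ℝ)) (unitModel d) 2 (geodesicFlow g) (v, t) ∧
        PreservesFormsAt g (fun u => geodesicFlow g (u, t)) v := by
  have key : ∃ ε > 0, ∀ v ∈ (univ : Set (UnitTangent M g)), ∀ t ∈ Ioo (-ε) ε,
      ContMDiffAt ((unitModel d).prod 𝓘(ℝ, ℝ)) (unitModel d) 2 (geodesicFlow g) (v, t) ∧
        PreservesFormsAt g (fun u => geodesicFlow g (u, t)) v := by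
    refine isCompact_univ.induction_on (p := fun S => ∃ ε > 0, ∀ v ∈ S, ∀ t ∈ Ioo (-ε) ε,
      ContMDiffAt ((unitModel d).prod 𝓘(ℝ, ℝ)) (unitModel d) 2 (geodesicFlow g) (v, t) ∧
        PreservesFormsAt g (fun u => geodesicFlow g (u, t)) v)
      ⟨1, one_pos, fun v hv => hv.elim⟩ ?_ ?_ ?_
    · rintro S S' hS ⟨ε, hε, h⟩
      exact ⟨ε, hε, fun v hv => h v (hS hv)⟩
    · rintro S S' ⟨ε, hε, h⟩ ⟨ε', hε', h'⟩
      refine ⟨min ε ε', lt_min hε hε', fun v hv t ht => ?_⟩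
      rcases hv with hv | hv
      · exact h v hv t ⟨by linarith [ht.1, min_le_left ε ε'], ht.2.trans_le (min_le_left _ _)⟩
      · exact h' v hv t ⟨by linarith [ht.1, min_le_right ε ε'], ht.2.trans_le (min_le_right _ _)⟩
    · intro v₀ _
      obtain ⟨W, hW, ε, hε, h⟩ := exists_local_contMDiffAt_geodesicFlow g v₀
      exact ⟨W, mem_nhdsWithin_of_mem_nhds hW, ε, hε, h⟩
  obtain ⟨ε, hε, h⟩ := key
  exact ⟨ε, hε, fun v => h v (mem_univ v)⟩

/-- Near `(v, t + s)` the flow is `Φ(Φ(·, s), · - s)`, by the group law. -/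
theorem contMDiffAt_geodesicFlow_add {v : UnitTangent M g} {s t : ℝ}
    (hs : ContMDiffAt ((unitModel d).prod 𝓘(ℝ, ℝ)) (unitModel d) 2 (geodesicFlow g) (v, s))
    (ht : ContMDiffAt ((unitModel d).prod 𝓘(ℝ, ℝ)) (unitModel d) 2 (geodesicFlow g)
      (geodesicFlow g (v, s), t)) :
    ContMDiffAt ((unitModel d).prod 𝓘(ℝ, ℝ)) (unitModel d) 2 (geodesicFlow g) (v, t + s) := by
  have h1 : geodesicFlow g = fun q : UnitTangent M g × ℝ =>
      geodesicFlow g (geodesicFlow g (q.1, s), q.2 - s) := by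
    funext q
    rw [← geodesicFlow_add, sub_add_cancel]
  have h2 : ContMDiffAt ((unitModel d).prod 𝓘(ℝ, ℝ)) ((unitModel d).prod 𝓘(ℝ, ℝ)) 2
      (fun q : UnitTangent M g × ℝ => (geodesicFlow g (q.1, s), q.2 - s)) (v, t + s) := by
    refine ContMDiffAt.prodMk ?_ ?_
    · exact ContMDiffAt.comp (v, t + s) (g := geodesicFlow g)
        (f := fun q : UnitTangent M g × ℝ => (q.1, s)) hs
        (contMDiffAt_fst.prodMk contMDiffAt_const)
    · exact ContMDiffAt.comp (v, t + s) (g := fun r : ℝ => r - s)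
        (f := fun q : UnitTangent M g × ℝ => q.2)
        (contDiff_id.sub contDiff_const).contDiffAt.contMDiffAt contMDiffAt_snd
  rw [h1]
  refine ContMDiffAt.comp (v, t + s) (g := geodesicFlow g)
    (f := fun q : UnitTangent M g × ℝ => (geodesicFlow g (q.1, s), q.2 - s)) ?_ h2
  simp only [add_sub_cancel_right]
  exact ht

/-- An arbitrary time is a multiple `n r` of a time below the uniform bound. The group law and the
chain rule then propagate regularity and invariance by induction on `n`. -/
theorem geodesicFlow_properties (v : UnitTangent M g) (s : ℝ) :
    ContMDiffAt ((unitModel d).prod 𝓘(ℝ, ℝ)) (unitModel d) 2 (geodesicFlow g) (v, s) ∧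
      PreservesFormsAt g (fun u => geodesicFlow g (u, s)) v := by
  obtain ⟨ε, hε, h⟩ := exists_uniform_contMDiffAt_geodesicFlow g
  obtain ⟨n, hn⟩ := exists_nat_gt (|s| / ε)
  have hn0 : (0 : ℝ) < n := lt_of_le_of_lt (by positivity) hn
  obtain ⟨r, hr, hrs⟩ : ∃ r ∈ Ioo (-ε) ε, s = n * r := by
    refine ⟨s / n, abs_lt.1 ?_, by field_simp⟩
    rw [abs_div, Nat.abs_cast, div_lt_iff₀ hn0]
    rw [div_lt_iff₀ hε] at hn
    linarith
  rw [hrs]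
  clear hn hn0 hrs
  induction n with
  | zero => exact h v _ (by simpa using hε)
  | succ n ih =>
    obtain ⟨h1, h2⟩ := ih
    obtain ⟨h3, h4⟩ := h (geodesicFlow g (v, n * r)) r hr
    have he : ((n + 1 : ℕ) : ℝ) * r = r + n * r := by push_cast; ring
    rw [he]
    refine ⟨contMDiffAt_geodesicFlow_add g h1 h3, ?_⟩
    have h5 : (fun u => geodesicFlow g (u, r + n * r)) =
        (fun u => geodesicFlow g (u, r)) ∘ fun u => geodesicFlow g (u, n * r) :=
      funext fun u => geodesicFlow_add g u _ _
    rw [h5]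
    exact PreservesFormsAt.comp (f := fun u => geodesicFlow g (u, n * r)) h4 h2

end Flow

/-! ### Vertical vectors and the symplectic form -/

theorem omegaG_zero_left (g : SmoothMetric d M) (w : TangentBundle (𝓡 (d + 1)) M)
    (Y : TangentSpace (𝓡 (d + 1)).tangent w) : omegaG g w 0 Y = 0 := by
  rw [omegaG_eq_sympl_self, map_zero]
  simp [sympl]

theorem omegaG_sub_left (g : SmoothMetric d M) (w : TangentBundle (𝓡 (d + 1)) M)
    (X X' Y : TangentSpace (𝓡 (d + 1)).tangent w) :
    omegaG g w (X - X') Y = omegaG g w X Y - omegaG g w X' Y := by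
  simp only [omegaG_eq_sympl_self, map_sub, sympl, sub_apply, Prod.fst_sub]
  ring

theorem omegaG_swap (g : SmoothMetric d M) (w : TangentBundle (𝓡 (d + 1)) M)
    (X Y : TangentSpace (𝓡 (d + 1)).tangent w) : omegaG g w X Y = -omegaG g w Y X := by
  simp only [omegaG]
  ring

/-- `X ∈ T_w TM` is the vertical lift of `a ∈ T_{π(w)} M`. -/
structure IsVerticalLift (g : SmoothMetric d M) (w : TangentBundle (𝓡 (d + 1)) M)
    (X : TangentSpace (𝓡 (d + 1)).tangent w) (a : TangentSpace (𝓡 (d + 1)) w.1) : Prop where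
  dBaseTM_eq_zero : dBaseTM w X = 0
  omegaG_eq : ∀ Y, omegaG g w X Y = g.inner w.1 a (dBaseTM w Y)
  dSqLen_eq : dSqLen g w X = 2 * g.inner w.1 w.2 a
  eq_zero : a = 0 → X = 0

theorem bijective_mfderiv_chart {x₀ p : M} (hp : p ∈ (extChartAt (𝓡 (d + 1)) x₀).source) :
    Function.Bijective
      (mfderiv (𝓡 (d + 1)) 𝓘(ℝ, EucModel d) (extChartAt (𝓡 (d + 1)) x₀) p) := by
  obtain ⟨e, he⟩ := isInvertible_mfderiv_extChartAt (I := 𝓡 (d + 1)) hp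
  rw [← he]
  exact e.bijective

/-- In natural coordinates the vector is `(0, a)`. All terms with derivatives of the metric are
multiplied by the zero first component or cancel, leaving `G(a, Y.1)` for `sympl` and `2 G(u, a)`
for the squared length. -/
theorem isVerticalLift_of_dTangentCoord (g : SmoothMetric d M) {w : TangentBundle (𝓡 (d + 1)) M}
    {X : TangentSpace (𝓡 (d + 1)).tangent w} {a : TangentSpace (𝓡 (d + 1)) w.1}
    (h1 : (dTangentCoord w.1 w X).1 = 0) (h2 : (dTangentCoord w.1 w X).2 =
      mfderiv (𝓡 (d + 1)) 𝓘(ℝ, EucModel d) (extChartAt (𝓡 (d + 1)) w.1) w.1 a) :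
    IsVerticalLift g w X a := by
  have hs : w.1 ∈ (extChartAt (𝓡 (d + 1)) w.1).source := mem_extChartAt_source _
  have hG := differentiableAt_coordMetric g (tangentCoord_mem hs)
  have hA := bijective_mfderiv_chart hs
  have hc := tangentCoord_eq hs
  refine ⟨?_, fun Y => ?_, ?_, fun ha => ?_⟩
  · rw [dTangentCoord_fst hs] at h1
    exact hA.1 (h1.trans (map_zero _).symm)
  · rw [omegaG_eq_sympl g hs, sympl, fderiv_momentum_apply hG, fderiv_momentum_apply hG,
      inner_eq_coordMetric g hs, ← dTangentCoord_fst hs, ← h2, h1]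
    have h3 : (tangentCoord w.1 w).1 = extChartAt (𝓡 (d + 1)) w.1 w.1 := rfl
    simp only [h3, map_zero, zero_apply, add_zero, sub_zero]
  · rw [dSqLen_apply g hs, fderiv_kinetic_apply hG (coordMetric_symm g _ _), h1, h2,
      inner_eq_coordMetric g hs, map_zero, zero_add, momentum, hc]
  · subst ha
    rw [map_zero] at h2
    refine (bijective_dTangentCoord hs).1 ?_
    rw [map_zero]
    exact Prod.ext h1 h2

theorem exists_isVerticalLift (g : SmoothMetric d M) (w : TangentBundle (𝓡 (d + 1)) M)
    (a : TangentSpace (𝓡 (d + 1)) w.1) : ∃ X, IsVerticalLift g w X a := by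
  have hs : w.1 ∈ (extChartAt (𝓡 (d + 1)) w.1).source := mem_extChartAt_source _
  obtain ⟨X, hX⟩ := (bijective_dTangentCoord hs).2 ((0 : EucModel d),
    (mfderiv (𝓡 (d + 1)) 𝓘(ℝ, EucModel d) (extChartAt (𝓡 (d + 1)) w.1) w.1 a : EucModel d))
  exact ⟨X, isVerticalLift_of_dTangentCoord g (by rw [hX]) (by rw [hX])⟩

theorem exists_isVerticalLift_of_dBaseTM (g : SmoothMetric d M)
    {w : TangentBundle (𝓡 (d + 1)) M} {X : TangentSpace (𝓡 (d + 1)).tangent w}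
    (hX : dBaseTM w X = 0) : ∃ a, IsVerticalLift g w X a := by
  have hs : w.1 ∈ (extChartAt (𝓡 (d + 1)) w.1).source := mem_extChartAt_source _
  obtain ⟨a, ha⟩ := (bijective_mfderiv_chart hs).2 (dTangentCoord w.1 w X).2
  refine ⟨a, isVerticalLift_of_dTangentCoord g ?_ ha.symm⟩
  rw [dTangentCoord_fst hs, hX, map_zero]
  rfl

theorem surjective_dBaseTM (w : TangentBundle (𝓡 (d + 1)) M) :
    Function.Surjective (dBaseTM w) := by
  intro a
  have hs : w.1 ∈ (extChartAt (𝓡 (d + 1)) w.1).source := mem_extChartAt_source _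
  obtain ⟨X, hX⟩ := (bijective_dTangentCoord hs).2
    ((mfderiv (𝓡 (d + 1)) 𝓘(ℝ, EucModel d) (extChartAt (𝓡 (d + 1)) w.1) w.1 a : EucModel d),
      (0 : EucModel d))
  refine ⟨X, (bijective_mfderiv_chart hs).1 ?_⟩
  rw [← dTangentCoord_fst hs, hX]

/-- The covector chosen in the definition is unique because `dBaseTM` is surjective. -/
theorem lowerOmega_eq {g : SmoothMetric d M} {w : TangentBundle (𝓡 (d + 1)) M}
    {X : TangentSpace (𝓡 (d + 1)).tangent w} {η : TangentSpace (𝓡 (d + 1)) w.1 →L[ℝ] ℝ}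
    (h : ∀ Y, omegaG g w X Y = η (dBaseTM w Y)) : lowerOmega g w X = η := by
  have hex : ∃ η : TangentSpace (𝓡 (d + 1)) w.1 →L[ℝ] ℝ,
    ∀ Y : TangentSpace (𝓡 (d + 1)).tangent w, omegaG g w X Y = η (dBaseTM w Y) := ⟨η, h⟩
  rw [lowerOmega, dif_pos hex]
  refine ContinuousLinearMap.ext fun a => ?_
  obtain ⟨Y, rfl⟩ := surjective_dBaseTM w a
  rw [← hex.choose_spec, h]

/-- The metric identifies covectors with vectors. -/
theorem exists_inner_eq (g : SmoothMetric d M) {p : M} (η : TangentSpace (𝓡 (d + 1)) p →L[ℝ] ℝ) :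
    ∃ a, ∀ b, g.inner p a b = η b := by
  let B : EucModel d →L[ℝ] EucModel d →L[ℝ] ℝ := g.inner p
  have hB : B.IsInvertible := isInvertible_of_posDef fun a ha => g.pos p a ha
  obtain ⟨e, he⟩ := hB
  refine ⟨e.symm η, fun b => ?_⟩
  have h1 : B (e.symm η) = η := by rw [← he]; exact e.apply_symm_apply η
  exact congrArg (fun A : EucModel d →L[ℝ] ℝ => A b) h1

theorem inner_vec_vec (g : SmoothMetric d M) (v : UnitTangent M g) :
    g.inner (v.base g) (v.vec g) (v.vec g) = 1 := v.2

/-- The differential of the squared length on the vertical lift of `a` is `2 g(v, a)`, so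
orthogonality to `v` makes the lift tangent to `SM`. -/
theorem exists_dIncl_isVerticalLift (g : SmoothMetric d M) (v : UnitTangent M g)
    {a : TangentSpace (𝓡 (d + 1)) (v.base g)} (ha : g.inner (v.base g) (v.vec g) a = 0) :
    ∃ X, IsVerticalLift g (v.incl g) (dIncl g v X) a := by
  obtain ⟨Y, hY⟩ := exists_isVerticalLift g (v.incl g) a
  have h1 : dSqLen g (v.incl g) Y = 0 := by
    rw [hY.dSqLen_eq]
    exact mul_eq_zero_of_right _ ha
  obtain ⟨X, rfl⟩ := exists_dIncl_eq g v h1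
  exact ⟨X, hY⟩

/-- A lift to `TM` is made tangent to `SM` by subtracting a multiple of the vertical lift of `v`,
which does not change the projection and on which the differential of the squared length is `2`. -/
theorem surjective_dBase (g : SmoothMetric d M) (v : UnitTangent M g) :
    Function.Surjective (dBase g v) := by
  intro a
  obtain ⟨Y, hY⟩ := surjective_dBaseTM (v.incl g) a
  obtain ⟨V, hV⟩ := exists_isVerticalLift g (v.incl g) (v.vec g)
  have h1 : dSqLen g (v.incl g) V = 2 := by
    rw [hV.dSqLen_eq]
    exact (congrArg (2 * ·) (inner_vec_vec g v)).trans (mul_one 2)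
  obtain ⟨X, hX⟩ := exists_dIncl_eq g v
    (Y := Y - (dSqLen g (v.incl g) Y / 2) • V) (by rw [map_sub, map_smul, h1]; simp)
  refine ⟨X, ?_⟩
  rw [← dBaseTM_dIncl, hX, map_sub, map_smul, hV.dBaseTM_eq_zero, smul_zero, sub_zero, hY]

/-- A vector of `SM` in the kernels of the symplectic form and of the Liouville form
vanishes. -/
theorem eq_zero_of_omegaG_eq_zero (g : SmoothMetric d M) (v : UnitTangent M g)
    {Z : TangentSpace (unitModel d) v}
    (h : ∀ Y, omegaG g (v.incl g) (dIncl g v Z) (dIncl g v Y) = 0)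
    (hl : g.inner (v.base g) (v.vec g) (dBase g v Z) = 0) : Z = 0 := by
  -- The Liouville hypothesis makes `dBase Z` orthogonal to `v`, so its vertical lift is an
  -- admissible test vector, and the pairing is minus the squared length of `dBase Z`. Once `Z` is
  -- known to be the lift of some `a`, testing against a vector over `a` gives the squared length of
  -- `a`.
  obtain ⟨Y, hY⟩ := exists_dIncl_isVerticalLift g v hl
  have h1 := h Y
  rw [omegaG_swap, hY.omegaG_eq, dBaseTM_dIncl, neg_eq_zero] at h1
  have h2 : dBase g v Z = 0 := by
    by_contra hne
    exact (g.pos _ _ hne).ne' h1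
  rw [← dBaseTM_dIncl] at h2
  obtain ⟨a, ha⟩ := exists_isVerticalLift_of_dBaseTM g h2
  obtain ⟨Y', hY'⟩ := surjective_dBase g v a
  have h3 := h Y'
  rw [ha.omegaG_eq, dBaseTM_dIncl, hY'] at h3
  have h4 : a = 0 := by
    by_contra hne
    exact (g.pos _ _ hne).ne' h3
  exact dIncl_injective g v ((ha.eq_zero h4).trans (map_zero _).symm)

/-! ### The differential of the geodesic flow -/

theorem dProj_apply (g : SmoothMetric d M) (v : UnitTangent M g) (s : ℝ)
    (X : TangentSpace (unitModel d) v) (τ : ℝ) : dProj g v s (X, τ) = X := by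
  rw [dProj, mfderiv_fst]
  rfl

theorem hasMFDerivAt_congr_point {g : SmoothMetric d M} {f : UnitTangent M g → UnitTangent M g}
    {v v' : UnitTangent M g} (h : v = v')
    {L : EucModel d × EuclideanSpace ℝ (Fin d) →L[ℝ] EucModel d × EuclideanSpace ℝ (Fin d)}
    (hL : HasMFDerivAt (unitModel d) (unitModel d) f v L) :
    HasMFDerivAt (unitModel d) (unitModel d) f v' L := by
  subst h
  exact hL

theorem dBase_congr {g : SmoothMetric d M} {v v' : UnitTangent M g} (h : v = v')
    (X : EucModel d × EuclideanSpace ℝ (Fin d)) :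
    (dBase g v X : EucModel d) = dBase g v' X := by
  subst h
  rfl

theorem eq_zero_of_forall_dBaseTM {w : TangentBundle (𝓡 (d + 1)) M}
    {η : TangentSpace (𝓡 (d + 1)) w.1 →L[ℝ] ℝ} (h : ∀ Y, η (dBaseTM w Y) = 0) : η = 0 := by
  refine ContinuousLinearMap.ext fun a => ?_
  obtain ⟨Y, rfl⟩ := surjective_dBaseTM w a
  exact h Y

section Flow

variable [T2Space M] [CompactSpace M] (g : SmoothMetric d M)

theorem hasMFDerivAt_geodesicFlow_left (v : UnitTangent M g) (s : ℝ) :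
    HasMFDerivAt (unitModel d) (unitModel d) (fun u => geodesicFlow g (u, s)) v (dvFlow g v s) :=
  (geodesicFlow_properties g v s).2.mdifferentiableAt.hasMFDerivAt

/-- The geodesic vector field, along the orbit of `v`. -/
def flowField (v : UnitTangent M g) (s : ℝ) :
    TangentSpace (unitModel d) (geodesicFlow g (v, s)) :=
  mfderiv 𝓘(ℝ, ℝ) (unitModel d) (fun t => geodesicFlow g (v, t)) s (1 : ℝ)

theorem hasMFDerivAt_geodesicFlow_right (v : UnitTangent M g) (s : ℝ) :
    HasMFDerivAt 𝓘(ℝ, ℝ) (unitModel d) (fun t => geodesicFlow g (v, t)) s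
      (mfderiv 𝓘(ℝ, ℝ) (unitModel d) (fun t => geodesicFlow g (v, t)) s) :=
  (((geodesicFlow_properties g v s).1.comp s (f := fun t : ℝ => (v, t))
    (contMDiffAt_const.prodMk contMDiffAt_id)).mdifferentiableAt (by simp)).hasMFDerivAt

theorem dFlow_apply (v : UnitTangent M g) (s : ℝ) (X : TangentSpace (unitModel d) v) (τ : ℝ) :
    dFlow g v s (X, τ) = dvFlow g v s X + τ • flowField g v s := by
  have h1 : MDifferentiableAt ((unitModel d).prod 𝓘(ℝ, ℝ)) (unitModel d) (geodesicFlow g) (v, s) :=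
    (geodesicFlow_properties g v s).1.mdifferentiableAt (by simp)
  have h2 := mfderiv_prod_eq_add_apply
    (v := ((X, τ) : TangentSpace ((unitModel d).prod 𝓘(ℝ, ℝ)) (v, s))) h1
  refine h2.trans ?_
  have h3 : mfderiv 𝓘(ℝ, ℝ) (unitModel d) (fun t => geodesicFlow g (v, t)) s τ =
      τ • flowField g v s := by
    have := (mfderiv 𝓘(ℝ, ℝ) (unitModel d) (fun t => geodesicFlow g (v, t)) s).map_smul τ (1 : ℝ)
    rw [flowField, ← this]
    congr 1
    exact (mul_one τ).symm
  exact congrArg (dvFlow g v s X + ·) h3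

/-- Projecting an orbit of the flow to `M` gives the geodesic, whose velocity is the orbit itself.
-/
theorem dBase_flowField (v : UnitTangent M g) (s : ℝ) :
    dBase g (geodesicFlow g (v, s)) (flowField g v s) = (geodesicFlow g (v, s)).vec g := by
  have h1 := ((hasMFDerivAt_base g (geodesicFlow g (v, s))).comp s
    (hasMFDerivAt_geodesicFlow_right g v s)).mfderiv
  have h2 : UnitTangent.base g ∘ (fun t => geodesicFlow g (v, t)) = geodesic g (v.incl g) :=
    funext fun t => congrArg (fun w : TangentBundle (𝓡 (d + 1)) M => w.1) (incl_geodesicFlow g v t)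
  have h3 : ((geodesicFlow g (v, s)).vec g : EucModel d) =
      mfderiv 𝓘(ℝ, ℝ) (𝓡 (d + 1)) (geodesic g (v.incl g)) s (1 : ℝ) :=
    congrArg (fun w : TangentBundle (𝓡 (d + 1)) M => (w.2 : EucModel d)) (incl_geodesicFlow g v s)
  rw [h2] at h1
  exact (congrArg (fun A : ℝ →L[ℝ] EucModel d => A 1) h1).symm.trans h3.symm

/-- Flow invariance of the geodesic field: the identity `Φ(v, t + s) = Φ(Φ(v, t), s)` is
differentiated at `t = 0`, and the vector is the field at time zero. -/
theorem exists_flowField_initial (v : UnitTangent M g) (s : ℝ) :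
    ∃ X : TangentSpace (unitModel d) v, dBase g v X = v.vec g ∧
      dvFlow g v s X = flowField g v s := by
  refine ⟨(flowField g v 0 : EucModel d × EuclideanSpace ℝ (Fin d)), ?_, ?_⟩
  · have h1 := dBase_flowField g v 0
    have h2 : ((geodesicFlow g (v, 0)).vec g : EucModel d) = v.vec g := by rw [geodesicFlow_zero]
    exact (dBase_congr (geodesicFlow_zero g v).symm _).trans
      (Eq.trans (α := EucModel d) h1 h2)
  · have h1 := (hasMFDerivAt_congr_point (geodesicFlow_zero g v).symm
      (hasMFDerivAt_geodesicFlow_left g v s)).comp (0 : ℝ) (hasMFDerivAt_geodesicFlow_right g v 0)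
    have h2 : HasMFDerivAt 𝓘(ℝ, ℝ) (unitModel d) (fun t => geodesicFlow g (v, t)) (0 + s)
        (mfderiv 𝓘(ℝ, ℝ) (unitModel d) (fun t => geodesicFlow g (v, t)) (0 + s)) :=
      hasMFDerivAt_geodesicFlow_right g v (0 + s)
    have h3 := h2.comp (0 : ℝ) (hasMFDerivAt_add_const s 0)
    have h4 : (fun t => geodesicFlow g (v, t)) ∘ (fun t : ℝ => t + s) =
        (fun u => geodesicFlow g (u, s)) ∘ fun t => geodesicFlow g (v, t) := by
      funext t
      simp only [Function.comp]
      rw [add_comm, geodesicFlow_add]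
    rw [h4] at h3
    have h5 := congrArg (fun A : ℝ →L[ℝ] EucModel d × EuclideanSpace ℝ (Fin d) => A 1)
      (hasMFDerivAt_unique h1 h3)
    have h6 : (mfderiv 𝓘(ℝ, ℝ) (unitModel d) (fun t => geodesicFlow g (v, t)) (0 + s) :
        ℝ →L[ℝ] EucModel d × EuclideanSpace ℝ (Fin d)) =
        mfderiv 𝓘(ℝ, ℝ) (unitModel d) (fun t => geodesicFlow g (v, t)) s := by rw [zero_add]
    exact h5.trans (congrArg (fun A : ℝ →L[ℝ] EucModel d × EuclideanSpace ℝ (Fin d) => A 1) h6)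

/-- The map `Φ(·, -s)` is inverse to `Φ(·, s)`, so its differential gives preimages. -/
theorem surjective_dvFlow (v : UnitTangent M g) (s : ℝ) : Function.Surjective (dvFlow g v s) := by
  intro Y
  have h0 : geodesicFlow g (geodesicFlow g (v, s), -s) = v := by
    rw [← geodesicFlow_add, neg_add_cancel, geodesicFlow_zero]
  have h1 := (hasMFDerivAt_congr_point h0.symm (hasMFDerivAt_geodesicFlow_left g v s)).comp
    (geodesicFlow g (v, s)) (hasMFDerivAt_geodesicFlow_left g (geodesicFlow g (v, s)) (-s))
  have h2 : (fun u => geodesicFlow g (u, s)) ∘ (fun u => geodesicFlow g (u, -s)) = id := by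
    funext u
    simp only [Function.comp, id]
    rw [← geodesicFlow_add, add_neg_cancel, geodesicFlow_zero]
  rw [h2] at h1
  refine ⟨(dvFlow g (geodesicFlow g (v, s)) (-s) Y : EucModel d × EuclideanSpace ℝ (Fin d)), ?_⟩
  exact congrArg (fun A : EucModel d × EuclideanSpace ℝ (Fin d) →L[ℝ]
    EucModel d × EuclideanSpace ℝ (Fin d) => A Y) (hasMFDerivAt_unique h1 (hasMFDerivAt_id _))

theorem omegaG_dvFlow (v : UnitTangent M g) (s : ℝ) (X Y : TangentSpace (unitModel d) v) :
    omegaG g ((geodesicFlow g (v, s)).incl g) (dIncl g (geodesicFlow g (v, s)) (dvFlow g v s X))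
      (dIncl g (geodesicFlow g (v, s)) (dvFlow g v s Y)) =
        omegaG g (v.incl g) (dIncl g v X) (dIncl g v Y) :=
  (geodesicFlow_properties g v s).2.omega X Y

theorem inner_dBase_dvFlow (v : UnitTangent M g) (s : ℝ) (X : TangentSpace (unitModel d) v) :
    g.inner ((geodesicFlow g (v, s)).base g) ((geodesicFlow g (v, s)).vec g)
      (dBase g (geodesicFlow g (v, s)) (dvFlow g v s X)) =
        g.inner (v.base g) (v.vec g) (dBase g v X) := by
  rw [← dBaseTM_dIncl, ← dBaseTM_dIncl]
  exact (geodesicFlow_properties g v s).2.liouville X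

/-! ### The two conditions and the conjugate pairs -/

theorem covectorCondition_iff (v : UnitTangent M g) (s : ℝ)
    (η : TangentSpace (𝓡 (d + 1)) (v.base g) →L[ℝ] ℝ)
    (η' : TangentSpace (𝓡 (d + 1)) ((geodesicFlow g (v, s)).base g) →L[ℝ] ℝ) :
    CovectorCondition g v s η η' ↔ ConjugateCovectors g v s η η' := by
  have hR : ∀ (X : TangentSpace (unitModel d) v) (τ : ℝ),
      η' (dBase g (geodesicFlow g (v, s)) (dFlow g v s (X, τ))) =
        η' (dBase g (geodesicFlow g (v, s)) (dvFlow g v s X)) +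
          τ * η' ((geodesicFlow g (v, s)).vec g) := by
    intro X τ
    rw [dFlow_apply, map_add, map_smul, dBase_flowField, map_add, map_smul, smul_eq_mul]
  constructor
  · intro h
    have h1 : ∀ (X : TangentSpace (unitModel d) v) (τ : ℝ), η (dBase g v X) =
        η' (dBase g (geodesicFlow g (v, s)) (dvFlow g v s X)) +
          τ * η' ((geodesicFlow g (v, s)).vec g) := by
      intro X τ
      rw [← hR]
      exact (congrArg (fun Y => η (dBase g v Y)) (dProj_apply g v s X τ)).symm.trans
        (congrArg (fun A => A (X, τ)) h)
    have h2 : ∀ X : TangentSpace (unitModel d) v, η (dBase g v X) =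
        η' (dBase g (geodesicFlow g (v, s)) (dvFlow g v s X)) := fun X => by
      simpa using h1 X 0
    have h3 : η' ((geodesicFlow g (v, s)).vec g) = 0 := by
      have h4 := h1 0 1
      rw [h2 0] at h4
      linarith
    refine ⟨ContinuousLinearMap.ext h2, ?_, h3⟩
    -- Applying the first equation to the initial geodesic field turns `η(v)` into `η'(ṽ)`.
    obtain ⟨X, hX, hX'⟩ := exists_flowField_initial g v s
    rw [← hX, h2, hX', dBase_flowField, h3]
  · rintro ⟨h1, -, h3⟩
    refine ContinuousLinearMap.ext fun q => ?_
    obtain ⟨X, τ⟩ : TangentSpace (unitModel d) v × ℝ := q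
    have h2 : η (dBase g v X) = η' (dBase g (geodesicFlow g (v, s)) (dvFlow g v s X)) :=
      congrArg (fun A => A X) h1
    change η (dBase g v (dProj g v s (X, τ))) =
      η' (dBase g (geodesicFlow g (v, s)) (dFlow g v s (X, τ)))
    rw [hR, dProj_apply, h2, h3, mul_zero, add_zero]

/-- A pair of covectors satisfying the conjugacy conditions comes from the conjugate kernel. -/
theorem exists_conjKernel_of_conjugateCovectors {v : UnitTangent M g} {s : ℝ}
    {η : TangentSpace (𝓡 (d + 1)) (v.base g) →L[ℝ] ℝ}
    {η' : TangentSpace (𝓡 (d + 1)) ((geodesicFlow g (v, s)).base g) →L[ℝ] ℝ}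
    (h : ConjugateCovectors g v s η η') :
    ∃ X ∈ conjKernel g (v, s),
      (∀ Y, omegaG g (v.incl g) (dIncl g v X) Y = η (dBaseTM (v.incl g) Y)) ∧
      ∀ Y, omegaG g ((geodesicFlow g (v, s)).incl g)
        (dIncl g (geodesicFlow g (v, s)) (dvFlow g v s X)) Y =
          η' (dBaseTM ((geodesicFlow g (v, s)).incl g) Y) := by
  obtain ⟨h1, h2, h3⟩ := h
  have h1' : ∀ X : TangentSpace (unitModel d) v, η (dBase g v X) =
      η' (dBase g (geodesicFlow g (v, s)) (dvFlow g v s X)) := fun X => congrArg (fun A => A X) h1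
  obtain ⟨a, ha⟩ := exists_inner_eq g η
  obtain ⟨a', ha'⟩ := exists_inner_eq g η'
  obtain ⟨X, hX⟩ := exists_dIncl_isVerticalLift g v (a := a)
    ((g.symm _ _ _).trans ((ha _).trans h2))
  obtain ⟨X', hX'⟩ := exists_dIncl_isVerticalLift g (geodesicFlow g (v, s)) (a := a')
    ((g.symm _ _ _).trans ((ha' _).trans h3))
  have hXη : ∀ Y, omegaG g (v.incl g) (dIncl g v X) Y = η (dBaseTM (v.incl g) Y) :=
    fun Y => (hX.omegaG_eq Y).trans (ha _)
  have hXη' : ∀ Y, omegaG g ((geodesicFlow g (v, s)).incl g)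
      (dIncl g (geodesicFlow g (v, s)) X') Y =
        η' (dBaseTM ((geodesicFlow g (v, s)).incl g) Y) :=
    fun Y => (hX'.omegaG_eq Y).trans (ha' _)
  have hb : dBase g v X = 0 := 
    (dBaseTM_dIncl g v X).symm.trans hX.dBaseTM_eq_zero
  have hb' : dBase g (geodesicFlow g (v, s)) X' = 0 :=
    (dBaseTM_dIncl g _ X').symm.trans hX'.dBaseTM_eq_zero
  -- The difference is paired with arbitrary vectors written as `d_vΦ Y`. Invariance of `ω_g` and
  -- the first equation of (2) make the pairing vanish. Its Liouville form is zero because `X` and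
  -- `X'` are vertical and the flow preserves that form.
  have key : dvFlow g v s X = X' := by
    rw [← sub_eq_zero]
    refine eq_zero_of_omegaG_eq_zero g (geodesicFlow g (v, s)) (fun Y => ?_) ?_
    · obtain ⟨Y, rfl⟩ := surjective_dvFlow g v s Y
      rw [map_sub, omegaG_sub_left, omegaG_dvFlow, hXη, hXη', dBaseTM_dIncl, dBaseTM_dIncl, h1',
        sub_self]
    · rw [map_sub, map_sub, inner_dBase_dvFlow, hb, hb', map_zero, map_zero, sub_zero]
  refine ⟨X, ⟨?_, hb⟩, hXη, ?_⟩
  · change dBase g (geodesicFlow g (v, s)) (dvFlow g v s X) = 0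
    rw [key, hb']
  · rw [key]
    exact hXη'

/-- A vector of the conjugate kernel yields a pair of covectors satisfying the conjugacy
conditions. -/
theorem exists_conjugateCovectors_of_conjKernel {v : UnitTangent M g} {s : ℝ}
    {X : TangentSpace (unitModel d) v} (hX : X ∈ conjKernel g (v, s)) :
    ∃ (η : TangentSpace (𝓡 (d + 1)) (v.base g) →L[ℝ] ℝ)
      (η' : TangentSpace (𝓡 (d + 1)) ((geodesicFlow g (v, s)).base g) →L[ℝ] ℝ),
      ConjugateCovectors g v s η η' ∧
      (∀ Y, omegaG g (v.incl g) (dIncl g v X) Y = η (dBaseTM (v.incl g) Y)) ∧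
      ∀ Y, omegaG g ((geodesicFlow g (v, s)).incl g)
        (dIncl g (geodesicFlow g (v, s)) (dvFlow g v s X)) Y =
          η' (dBaseTM ((geodesicFlow g (v, s)).incl g) Y) := by
  obtain ⟨hX', hX⟩ := hX
  replace hX : dBaseTM (v.incl g) (dIncl g v X) = 0 := (dBaseTM_dIncl g v X).trans hX
  replace hX' : dBaseTM ((geodesicFlow g (v, s)).incl g)
      (dIncl g (geodesicFlow g (v, s)) (dvFlow g v s X)) = 0 := (dBaseTM_dIncl g _ _).trans hX'
  obtain ⟨a, ha⟩ := exists_isVerticalLift_of_dBaseTM g hX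
  obtain ⟨a', ha'⟩ := exists_isVerticalLift_of_dBaseTM g hX'
  refine ⟨g.inner _ a, g.inner _ a', ⟨?_, ?_, ?_⟩, ha.omegaG_eq, ha'.omegaG_eq⟩
  · refine ContinuousLinearMap.ext fun Y => ?_
    have h1 := omegaG_dvFlow g v s X Y
    rw [ha.omegaG_eq, ha'.omegaG_eq, dBaseTM_dIncl, dBaseTM_dIncl] at h1
    exact h1.symm
  -- Tangency of `X` to `SM` annihilates the differential of the squared length, which on a vertical
  -- lift of `a` is `2 g(v, a)`.
  · have h1 := ha.dSqLen_eq
    rw [dSqLen_dIncl, g.symm] at h1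
    exact (mul_eq_zero.1 h1.symm).resolve_left two_ne_zero
  · have h1 := ha'.dSqLen_eq
    rw [dSqLen_dIncl, g.symm] at h1
    exact (mul_eq_zero.1 h1.symm).resolve_left two_ne_zero

end Flow

end Manifold

end

/-! ### Assembly of the theorem. -/

theorem lemma3p6{d : ℕ} (hd : 1 ≤ d) {M : Type*} [TopologicalSpace M]
    [ChartedSpace (EucModel d) M] [IsManifold (𝓡 (d + 1)) ∞ M]
    [T2Space M] [CompactSpace M] [ConnectedSpace M] (g : SmoothMetric d M) :
    (∀ (v : UnitTangent M g) (s : ℝ)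
      (η : TangentSpace (𝓡 (d + 1)) (v.base g) →L[ℝ] ℝ)
      (η' : TangentSpace (𝓡 (d + 1)) ((geodesicFlow g (v, s)).base g) →L[ℝ] ℝ),
      (CovectorCondition g v s η η' ↔ ConjugateCovectors g v s η η') ∧
      (ConjugateCovectors g v s η η' → s ≠ 0 →
        ((η ≠ 0 ∨ η' ≠ 0) → IsConjugatePair g (v, s)) ∧
        ∀ k : ℕ, 1 ≤ k → k ≤ d → (v, s) ∈ regularConj g k →
          ((⟨v.base g, η⟩, ⟨(geodesicFlow g (v, s)).base g, η'⟩) :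
            CotangentTotal d M × CotangentTotal d M) ∈ conjMap g '' conjBundle g k)) ∧
    (∀ k : ℕ, 1 ≤ k → k ≤ d → ∀ ζ ∈ conjMap g '' conjBundle g k,
      ∃ (v : UnitTangent M g) (s : ℝ)
        (η : TangentSpace (𝓡 (d + 1)) (v.base g) →L[ℝ] ℝ)
        (η' : TangentSpace (𝓡 (d + 1)) ((geodesicFlow g (v, s)).base g) →L[ℝ] ℝ),
        (v, s) ∈ regularConj g k ∧
        ζ = (⟨v.base g, η⟩, ⟨(geodesicFlow g (v, s)).base g, η'⟩) ∧
        ConjugateCovectors g v s η η') := by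
  have hmap : ∀ (v : UnitTangent M g) (s : ℝ) (X : TangentSpace (unitModel d) v)
      (η : TangentSpace (𝓡 (d + 1)) (v.base g) →L[ℝ] ℝ)
      (η' : TangentSpace (𝓡 (d + 1)) ((geodesicFlow g (v, s)).base g) →L[ℝ] ℝ),
      (∀ Y, omegaG g (v.incl g) (dIncl g v X) Y = η (dBaseTM (v.incl g) Y)) →
      (∀ Y, omegaG g ((geodesicFlow g (v, s)).incl g)
        (dIncl g (geodesicFlow g (v, s)) (dvFlow g v s X)) Y =
          η' (dBaseTM ((geodesicFlow g (v, s)).incl g) Y)) →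
      conjMap g ⟨(v, s), X⟩ = ((⟨v.base g, η⟩, ⟨(geodesicFlow g (v, s)).base g, η'⟩) :
            CotangentTotal d M × CotangentTotal d M) := by
    intro v s X η η' h h'
    rw [← lowerOmega_eq h, ← lowerOmega_eq h']
    rfl
  refine ⟨fun v s η η' => ⟨covectorCondition_iff g v s η η', fun h hs => ⟨fun hne => ⟨hs, ?_⟩,
    fun k _ _ hk => ?_⟩⟩, fun k _ _ ζ hζ => ?_⟩
  · obtain ⟨X, hX, h1, h2⟩ := exists_conjKernel_of_conjugateCovectors g h
    -- If the kernel were trivial, then `X = 0`; both covectors would then pair to zero with every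
    -- projected vector, and so vanish.
    intro hbot
    rw [hbot] at hX
    have hX0 : X = 0 := hX
    subst hX0
    rcases hne with hne | hne
    · refine hne (eq_zero_of_forall_dBaseTM (w := v.incl g) fun Y => (h1 Y).symm.trans ?_)
      rw [map_zero, omegaG_zero_left]
    · refine hne (eq_zero_of_forall_dBaseTM (w := (geodesicFlow g (v, s)).incl g) fun Y =>
        (h2 Y).symm.trans ?_)
      rw [map_zero, map_zero, omegaG_zero_left]
  · obtain ⟨X, hX, h1, h2⟩ := exists_conjKernel_of_conjugateCovectors g h
    exact ⟨⟨(v, s), X⟩, ⟨hk, hX⟩, hmap v s X η η' h1 h2⟩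
  · obtain ⟨⟨⟨v, s⟩, X⟩, ⟨hk, hX⟩, rfl⟩ := hζ
    obtain ⟨η, η', h, h1, h2⟩ := exists_conjugateCovectors_of_conjKernel g hX
    exact ⟨v, s, η, η', hk, hmap v s X η η' h1 h2, h⟩
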